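/- **Setting.** Let $M$ be a connected oriented smooth 5-manifold. The inner product on $T\oplus T^*$ is given by $(X+\xi,X+\xi)=\xi(X)$, and $T\oplus T^*$ acts on forms by $(X+\xi)\cdot\varphi=i_X\varphi+\xi\wedge\varphi$. For an odd form $\varphi$ and an even form $\psi$ put $\langle\varphi,\psi\rangle=\varphi_1\wedge\psi_4-\varphi_3\wedge\psi_2+\varphi_5\wedge\psi_0\in\Lambda^5T^*$. For an even form $\varphi$ let $Q(\varphi)\in\Lambda^5T^*\otimes(T\oplus T^*)$ be defined by $(Q(\varphi),v)=\langle v\cdot\varphi,\varphi\rangle$ for all $v$, and for a pair $\rho=(\rho_1,\rho_2)$ of even forms put $f(\rho)=(Q(\rho_1),Q(\rho_2))\in(\Lambda^5T^*)^{2}$. Let $\rho=(\rho_1,\rho_2)$ be a pair of smooth even forms on $M$ with $f(\rho)\neq0$ everywhere, and let $\phi=|f(\rho)|^{1/2}$ be its positive volume form. Let $\hat\rho=(\hat\rho_1,\hat\rho_2)$ be the pair of odd forms for which the derivative of $\rho\mapsto|f(\rho)|^{1/2}$ at $\rho$ is $\dot\rho\mapsto\langle\hat\rho_1,\dot\rho_1\rangle+\langle\hat\rho_2,\dot\rho_2\rangle$.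 Suppose that $d\rho=0=d\hat\rho$ and that the degree zero component of $\rho$ (a pair of functions) is not identically zero. **Proposition.** There are $A\in SL(2,\mathbf R)$ and a closed 2-form $B$ on $M$ such that $\rho'=A\,e^B\rho$ has the shape $$\rho_1'=\omega+(\text{4-form}),\qquad \rho_2'=1+(\text{4-form}),$$ with $\omega$ a 2-form. Let $A,B$ be any such pair, and suppose that $\omega$ has maximal rank $4$ at $p\in M$. Put $\varepsilon=1$ if $f(\rho)<0$ at $p$ (equivalently, the span $V$ of $v_1,h,v_2$ below has signature $(2,1)$) and $\varepsilon=-1$ if $f(\rho)>0$ at $p$ (signature $(1,2)$). Then there are coordinates $x_1,\dots,x_5$ on a neighbourhood of $p$ in which $$\rho_1'=dx_1\wedge dx_2+dx_3\wedge dx_4+\varepsilon\,dx_1\wedge dx_3\wedge dx_4\wedge dx_5,\qquad \rho_2'=1+dx_2\wedge dx_3\wedge dx_4\wedge dx_5 .$$ Moreover, if the sections $v_1,h,v_2$ of $T\oplus T^*$ are defined by $Q(\rho_1'+z\rho_2')=\phi\otimes(v_1+2zh+z^2v_2)$ for all real $z$, then on this coordinate neighbourhood their real linear span is the span of $$\frac{\partial}{\partial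 x_5}+\varepsilon\,dx_1,\qquad \frac{\partial}{\partial x_1},\qquad \varepsilon\,\frac{\partial}{\partial x_2}+dx_2,$$ and $v_1,h,v_2$ commute pairwise for the Courant bracket $$[X+\xi,Y+\eta]=[X,Y]+\mathcal L_X\eta-\mathcal L_Y\xi-\tfrac12 d(i_X\eta-i_Y\xi).$$ -/

import Mathlib

open scoped Manifold ContDiff

noncomputable section

namespace GenGeom

/-! ### Exterior algebra at a point

Exterior forms of degree `k` are Mathlib's continuous alternating maps `E [⋀^Fin k]→L[ℝ] ℝ`, with
the normalisation in which `(ξ ∧ η) (X, Y) = ξ X * η Y - ξ Y * η X`.  -/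

section Algebra

variable {E : Type*} [NormedAddCommGroup E] [NormedSpace ℝ E]

/-- The wedge product, as a continuous bilinear map, by recursion on the degree of the left factor.
For a form `α` of degree `k + 1`,
`(α ∧ β) (v₀, …, vₘ) = (k + 1)⁻¹ * ∑ i, (-1) ^ i * (i_{vᵢ} α ∧ β) (v₀, …, v̂ᵢ, …, vₘ)`,
which unfolds to the usual sum over shuffles. -/
def wedgeL : (k n : ℕ) →
    (E [⋀^Fin k]→L[ℝ] ℝ) →L[ℝ] (E [⋀^Fin n]→L[ℝ] ℝ) →L[ℝ] (E [⋀^Fin (n + k)]→L[ℝ] ℝ)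
  | 0, n => (ContinuousLinearMap.lsmul ℝ ℝ (E := E [⋀^Fin n]→L[ℝ] ℝ)).comp
      ((ContinuousAlternatingMap.constOfIsEmptyLIE ℝ E ℝ
        (Fin 0)).symm.toContinuousLinearEquiv.toContinuousLinearMap)
  | k + 1, n => ((k + 1 : ℝ)⁻¹) •
      ((ContinuousLinearMap.compL ℝ (E [⋀^Fin n]→L[ℝ] ℝ) (E →L[ℝ] E [⋀^Fin (n + k)]→L[ℝ] ℝ)
          (E [⋀^Fin (n + k + 1)]→L[ℝ] ℝ)
          (ContinuousAlternatingMap.alternatizeUncurryFinCLM ℝ E ℝ)).comp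
        (((ContinuousLinearMap.flipₗᵢ ℝ E (E [⋀^Fin n]→L[ℝ] ℝ)
            (E [⋀^Fin (n + k)]→L[ℝ] ℝ)).toContinuousLinearEquiv.toContinuousLinearMap).comp
          ((ContinuousLinearMap.compL ℝ E (E [⋀^Fin k]→L[ℝ] ℝ)
              ((E [⋀^Fin n]→L[ℝ] ℝ) →L[ℝ] (E [⋀^Fin (n + k)]→L[ℝ] ℝ)) (wedgeL k n)).comp
            (ContinuousAlternatingMap.curryLeftLI.toContinuousLinearMap))))

/-- The wedge product `α ∧ β` of a `k`-form and an `n`-form. -/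
def wedge {k n : ℕ} (α : E [⋀^Fin k]→L[ℝ] ℝ) (β : E [⋀^Fin n]→L[ℝ] ℝ) :
    E [⋀^Fin (n + k)]→L[ℝ] ℝ := wedgeL k n α β

theorem wedge_zero_left {n : ℕ} (α : E [⋀^Fin 0]→L[ℝ] ℝ) (β : E [⋀^Fin n]→L[ℝ] ℝ) :
    wedge α β = α ![] • β := by
  simp only [wedge, wedgeL, ContinuousLinearMap.comp_apply, ContinuousLinearMap.lsmul_apply]
  congr 1
  simp [ContinuousAlternatingMap.constOfIsEmptyLIE]
  rfl

theorem wedge_succ_apply {k n : ℕ} (α : E [⋀^Fin (k + 1)]→L[ℝ] ℝ) (β : E [⋀^Fin n]→L[ℝ] ℝ)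
    (v : Fin (n + k + 1) → E) :
    wedge α β v = (k + 1 : ℝ)⁻¹ * ∑ i : Fin (n + k + 1), (-1 : ℝ) ^ (i : ℕ) *
      wedge (α.curryLeft (v i)) β (i.removeNth v) := by
  simp [wedge, wedgeL, ContinuousAlternatingMap.alternatizeUncurryFin_apply]

/-- A covector as a form of degree one. -/
def oneForm (ξ : E →L[ℝ] ℝ) : E [⋀^Fin 1]→L[ℝ] ℝ :=
  ContinuousAlternatingMap.ofSubsingleton ℝ E ℝ 0 ξ

/-- The constant `c` as a form of degree zero. -/
def zeroForm (c : ℝ) : E [⋀^Fin 0]→L[ℝ] ℝ :=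
  ContinuousAlternatingMap.constOfIsEmpty ℝ E (Fin 0) c

variable (E) in
/-- Even forms in dimension five, `Λ⁰ ⊕ Λ² ⊕ Λ⁴`; these are the spinors. -/
abbrev EvenForm : Type _ :=
  (E [⋀^Fin 0]→L[ℝ] ℝ) × (E [⋀^Fin 2]→L[ℝ] ℝ) × (E [⋀^Fin 4]→L[ℝ] ℝ)

variable (E) in
/-- Odd forms in dimension five, `Λ¹ ⊕ Λ³ ⊕ Λ⁵`. -/
abbrev OddForm : Type _ :=
  (E [⋀^Fin 1]→L[ℝ] ℝ) × (E [⋀^Fin 3]→L[ℝ] ℝ) × (E [⋀^Fin 5]→L[ℝ] ℝ)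

variable (E) in
/-- The generalized tangent space `T ⊕ T*`; the pair `(X, ξ)` is `X + ξ`. -/
abbrev GenVec : Type _ := E × (E →L[ℝ] ℝ)

/-- The inner product on `T ⊕ T*` with `(X + ξ, X + ξ) = ξ X`. -/
def genInner (u v : GenVec E) : ℝ := (u.2 v.1 + v.2 u.1) / 2

/-- Clifford action `(X + ξ) · ρ = i_X ρ + ξ ∧ ρ` on even forms; in dimension five the components
have degrees one, three and five. -/
def clifford (u : GenVec E) (ρ : EvenForm E) : OddForm E :=
  (ρ.2.1.curryLeft u.1 + wedge (oneForm u.2) ρ.1,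
   ρ.2.2.curryLeft u.1 + wedge (oneForm u.2) ρ.2.1,
   wedge (oneForm u.2) ρ.2.2)

/-- The Mukai pairing `⟨φ, ψ⟩ = [φ ∧ σ ψ]₅` of an odd form with an even form, where `σ` is
multiplication by `(-1) ^ m` in degrees `2 m` and `2 m + 1`. -/
def mukai (φ : OddForm E) (ψ : EvenForm E) : E [⋀^Fin 5]→L[ℝ] ℝ :=
  wedge φ.1 ψ.2.2 - wedge φ.2.1 ψ.2.1 + wedge φ.2.2 ψ.1

/-- The action `φ ↦ e^B φ` of a two-form, in dimension five. -/
def expB (B : E [⋀^Fin 2]→L[ℝ] ℝ) (φ : EvenForm E) : EvenForm E :=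
  (φ.1,
   φ.2.1 + φ.1 ![] • B,
   φ.2.2 + wedge B φ.2.1 + (φ.1 ![] / 2) • wedge B B)

/-- The action of a `2 × 2` matrix on pairs `(ρ₁, ρ₂)` of even forms. -/
def matAct (A : Matrix (Fin 2) (Fin 2) ℝ) (ρ : EvenForm E × EvenForm E) :
    EvenForm E × EvenForm E :=
  (A 0 0 • ρ.1 + A 0 1 • ρ.2, A 1 0 • ρ.1 + A 1 1 • ρ.2)

end Algebra

/-- The five-dimensional model space. -/
abbrev E5 : Type := EuclideanSpace ℝ (Fin 5)

/-- The standard basis of the model space. -/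
def basisVec (i : Fin 5) : E5 := EuclideanSpace.single i 1

/-- The coordinate covectors. -/
def coordCovec (i : Fin 5) : E5 →L[ℝ] ℝ := EuclideanSpace.proj i

/-- The coordinate one-forms; `dx 0, …, dx 4` are `dx₁, …, dx₅`. -/
def dx (i : Fin 5) : E5 [⋀^Fin 1]→L[ℝ] ℝ := oneForm (coordCovec i)

/-- The quotient `μ / ν` of two top-degree forms, where `ν ≠ 0`. -/
def topRatio (μ ν : E5 [⋀^Fin 5]→L[ℝ] ℝ) : ℝ := μ basisVec / ν basisVec

/-- The vector `Q(ρ)` in `T ⊕ T*`, relative to the volume element `ν`, that is, the vector with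
`(Q(ρ), v) ν = ⟨v · ρ, ρ⟩` for every `v` in `T ⊕ T*`; see `genInner_Qvec`. -/
def Qvec (ν : E5 [⋀^Fin 5]→L[ℝ] ℝ) (ρ : EvenForm E5) : GenVec E5 :=
  (∑ i, (2 * topRatio (mukai (clifford (0, coordCovec i) ρ) ρ) ν) • basisVec i,
   ∑ i, (2 * topRatio (mukai (clifford (basisVec i, 0) ρ) ρ) ν) • coordCovec i)

theorem topRatio_smul (μ : E5 [⋀^Fin 5]→L[ℝ] ℝ) {ν : E5 [⋀^Fin 5]→L[ℝ] ℝ} (hν : ν ≠ 0) :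
    topRatio μ ν • ν = μ := by
  let b : Module.Basis (Fin 5) ℝ E5 := (EuclideanSpace.basisFun (Fin 5) ℝ).toBasis
  have hb : (b : Fin 5 → E5) = basisVec := by
    ext i : 1
    simp [b, basisVec]
  have key : ∀ α β : E5 [⋀^Fin 5]→L[ℝ] ℝ, α basisVec = β basisVec → α = β := by
    intro α β h
    apply ContinuousAlternatingMap.toAlternatingMap_injective
    refine Module.Basis.ext_alternating b fun w hw => ?_
    obtain ⟨σ, rfl⟩ : ∃ σ : Equiv.Perm (Fin 5), w = σ :=
      ⟨Equiv.ofBijective w (Finite.injective_iff_bijective.mp hw), rfl⟩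
    have e1 := α.toAlternatingMap.map_perm (b : Fin 5 → E5) σ
    have e2 := β.toAlternatingMap.map_perm (b : Fin 5 → E5) σ
    rw [hb] at e1 e2 ⊢
    exact e1.trans ((congrArg _ h).trans e2.symm)
  have h0 : ν basisVec ≠ 0 := fun h => hν (key ν 0 (by simpa using h))
  apply key
  simp [topRatio, div_mul_cancel₀ _ h0]

theorem genInner_Qvec {ν : E5 [⋀^Fin 5]→L[ℝ] ℝ} (hν : ν ≠ 0) (ρ : EvenForm E5) (v : GenVec E5) :
    genInner (Qvec ν ρ) v • ν = mukai (clifford v ρ) ρ := by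
  have hone : ∀ ξ η : E5 →L[ℝ] ℝ, oneForm (ξ + η) = oneForm ξ + oneForm η := fun _ _ => rfl
  have honesmul : ∀ (c : ℝ) (ξ : E5 →L[ℝ] ℝ), oneForm (c • ξ) = c • oneForm ξ := fun _ _ => rfl
  let L : GenVec E5 →ₗ[ℝ] ℝ :=
    { toFun := fun u => topRatio (mukai (clifford u ρ) ρ) ν
      map_add' := by
        intro u w
        simp only [topRatio, ← add_div]
        congr 1
        simp only [mukai, clifford, wedge, hone, Prod.fst_add, Prod.snd_add, map_add,
          add_apply, ContinuousAlternatingMap.add_apply, ContinuousAlternatingMap.sub_apply]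
        ring
      map_smul' := by
        intro c u
        simp only [topRatio, RingHom.id_apply, smul_eq_mul, ← mul_div_assoc]
        congr 1
        simp only [mukai, clifford, wedge, honesmul, Prod.smul_fst, Prod.smul_snd, map_smul,
          map_add, add_apply, smul_apply,
          ContinuousAlternatingMap.add_apply, ContinuousAlternatingMap.sub_apply,
          ContinuousAlternatingMap.smul_apply, smul_eq_mul]
        ring }
  have hX : v.1 = ∑ i, (v.1 i) • basisVec i := by
    ext j
    simp [basisVec, Finset.sum_apply, Pi.single_apply]
  have hξ : v.2 = ∑ i, (v.2 (basisVec i)) • coordCovec i := by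
    ext w
    have hw : w = ∑ i, (w i) • basisVec i := by
      ext j
      simp [basisVec, Finset.sum_apply, Pi.single_apply]
    conv_lhs => rw [hw]
    simp [coordCovec, mul_comm]
  have hv : v = ∑ i, (v.1 i) • ((basisVec i, 0) : GenVec E5)
      + ∑ i, (v.2 (basisVec i)) • ((0, coordCovec i) : GenVec E5) := by
    refine Prod.ext ?_ ?_
    · simpa [Prod.fst_sum] using hX
    · simpa [Prod.snd_sum] using hξ
  have hL : genInner (Qvec ν ρ) v = L v := by
    conv_rhs => rw [hv]
    simp only [map_add, map_sum, map_smul, smul_eq_mul, genInner, Qvec]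
    simp only [sum_apply, smul_apply, smul_eq_mul]
    have hc : ∀ i, coordCovec i v.1 = v.1 i := fun i => rfl
    simp only [hc, add_div, Finset.sum_div]
    congr 1 <;> refine Finset.sum_congr rfl fun i _ => ?_ <;> simp only [L, LinearMap.coe_mk, AddHom.coe_mk] <;> ring
  rw [hL]
  exact topRatio_smul _ hν

/-- The quartic `f(ρ) = (Q(ρ₁), Q(ρ₂))`, relative to the volume element `ν`: as an element of
`(Λ⁵)^{⊗ 2}` it is `quartic ν ρ • ν ⊗ ν`, which does not depend on `ν ≠ 0`. -/
def quartic (ν : E5 [⋀^Fin 5]→L[ℝ] ℝ) (ρ : EvenForm E5 × EvenForm E5) : ℝ :=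
  genInner (Qvec ν ρ.1) (Qvec ν ρ.2)

/-- The volume form `φ(ρ) = |f(ρ)|^{1/2}`, for the orientation given by `ν ≠ 0`. -/
def volOf (ν : E5 [⋀^Fin 5]→L[ℝ] ℝ) (ρ : EvenForm E5 × EvenForm E5) : E5 [⋀^Fin 5]→L[ℝ] ℝ :=
  √|quartic ν ρ| • ν

/-- `ρ'` is the form `ρ̂` dual to `ρ`: the derivative of the map `φ` from pairs of even forms to
volume forms satisfies `Dφ_ρ(σ) = ⟨ρ'₁, σ₁⟩ + ⟨ρ'₂, σ₂⟩` for all `σ`. The orientation is that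
of `ν`. -/
def IsHat (ν : E5 [⋀^Fin 5]→L[ℝ] ℝ) (ρ : EvenForm E5 × EvenForm E5)
    (ρ' : OddForm E5 × OddForm E5) : Prop :=
  ∀ σ : EvenForm E5 × EvenForm E5,
    HasDerivAt (fun t : ℝ => volOf ν (ρ + t • σ)) (mukai ρ'.1 σ.1 + mukai ρ'.2 σ.2) 0

/-- The vectors `v₁, h, v₂` of `T ⊕ T*` with `Q(ρ₁ + z ρ₂) = ν ⊗ (v₁ + 2 z h + z² v₂)`, where `ν` is
the volume form. -/
def triple (ν : E5 [⋀^Fin 5]→L[ℝ] ℝ) (ρ : EvenForm E5 × EvenForm E5) : Fin 3 → GenVec E5 :=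
  ![Qvec ν ρ.1,
    (1 / 2 : ℝ) • (Qvec ν (ρ.1 + ρ.2) - Qvec ν ρ.1 - Qvec ν ρ.2),
    Qvec ν ρ.2]

/-! ### Differential forms on a five-manifold

Mathlib's `TangentSpace (𝓡 5) p` is by definition the model space `E5`, so that a field of `k`-forms
is a function on `M` with values in `E5 [⋀^Fin k]→L[ℝ] ℝ`. Mathlib's `mfderiv`, and with it the
expression of a form in a chart, refers to this identification. -/

section Manifold

variable {M : Type*} [TopologicalSpace M] [ChartedSpace E5 M]

/-- The differential of the inverse of a chart, from the model space to `T_p M`. -/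
def chartSymmDeriv (e : OpenPartialHomeomorph M E5) (y : E5) : E5 →L[ℝ] E5 :=
  mfderiv (𝓡 5) (𝓡 5) e.symm y

/-- The differential of a chart at `p`, from `T_p M` to the model space. -/
def chartDeriv (e : OpenPartialHomeomorph M E5) (p : M) : E5 →L[ℝ] E5 :=
  mfderiv (𝓡 5) (𝓡 5) e p

/-- The expression of a field of `k`-forms in a chart `e`: its pull-back by `e.symm`. It is
meaningful on `e.target`. -/
def formRep {k : ℕ} (e : OpenPartialHomeomorph M E5) (α : M → E5 [⋀^Fin k]→L[ℝ] ℝ) (y : E5) :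
    E5 [⋀^Fin k]→L[ℝ] ℝ :=
  (α (e.symm y)).compContinuousLinearMap (chartSymmDeriv e y)

/-- The expression of a field of even forms in a chart. -/
def evenRep (e : OpenPartialHomeomorph M E5) (ρ : M → EvenForm E5) (y : E5) : EvenForm E5 :=
  (formRep e (fun p => (ρ p).1) y, formRep e (fun p => (ρ p).2.1) y,
    formRep e (fun p => (ρ p).2.2) y)

/-- The expression of a section of `T ⊕ T*` in a chart. -/
def genRep (e : OpenPartialHomeomorph M E5) (u : M → GenVec E5) (y : E5) : GenVec E5 :=
  (chartDeriv e (e.symm y) (u (e.symm y)).1, (u (e.symm y)).2.comp (chartSymmDeriv e y))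

/-- A smooth differential form. -/
def SmoothForm {k : ℕ} (α : M → E5 [⋀^Fin k]→L[ℝ] ℝ) : Prop :=
  ∀ e ∈ IsManifold.maximalAtlas (𝓡 5) ∞ M, ContDiffOn ℝ ∞ (formRep e α) e.target

/-- `d α = 0`, for a differential form of pure degree. -/
def ClosedForm {k : ℕ} (α : M → E5 [⋀^Fin k]→L[ℝ] ℝ) : Prop :=
  ∀ e ∈ IsManifold.maximalAtlas (𝓡 5) ∞ M, ∀ y ∈ e.target, extDeriv (formRep e α) y = 0

/-- A smooth field of even forms. -/
def SmoothEven (ρ : M → EvenForm E5) : Prop :=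
  SmoothForm (fun p => (ρ p).1) ∧ SmoothForm (fun p => (ρ p).2.1) ∧ SmoothForm (fun p => (ρ p).2.2)

/-- `d ρ = 0` for a field of even forms. -/
def ClosedEven (ρ : M → EvenForm E5) : Prop :=
  ClosedForm (fun p => (ρ p).1) ∧ ClosedForm (fun p => (ρ p).2.1) ∧ ClosedForm (fun p => (ρ p).2.2)

/-- A smooth field of odd forms. -/
def SmoothOdd (ρ : M → OddForm E5) : Prop :=
  SmoothForm (fun p => (ρ p).1) ∧ SmoothForm (fun p => (ρ p).2.1) ∧ SmoothForm (fun p => (ρ p).2.2)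

/-- `d ρ = 0` for a field of odd forms. -/
def ClosedOdd (ρ : M → OddForm E5) : Prop :=
  ClosedForm (fun p => (ρ p).1) ∧ ClosedForm (fun p => (ρ p).2.1) ∧ ClosedForm (fun p => (ρ p).2.2)

/-- `ρ = (ρ₁, ρ₂)` is a solution of the variational equations `dρ = 0 = dρ̂` on the manifold `M` with
the orientation of `φ`, and `φ` is its invariant volume form `|f(ρ)|^{1/2}`. In particular
`f(ρ) ≠ 0` at each point. -/
structure IsSolution (ρ : M → EvenForm E5 × EvenForm E5) (φ : M → E5 [⋀^Fin 5]→L[ℝ] ℝ) :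
    Prop where
  smooth_fst : SmoothEven fun p => (ρ p).1
  smooth_snd : SmoothEven fun p => (ρ p).2
  smooth_vol : SmoothForm φ
  vol_ne_zero : ∀ p, φ p ≠ 0
  volOf_eq : ∀ p, volOf (φ p) (ρ p) = φ p
  closed_fst : ClosedEven fun p => (ρ p).1
  closed_snd : ClosedEven fun p => (ρ p).2
  closed_hat : ∃ ρ' : M → OddForm E5 × OddForm E5, (∀ p, IsHat (φ p) (ρ p) (ρ' p)) ∧
    SmoothOdd (fun p => (ρ' p).1) ∧ SmoothOdd (fun p => (ρ' p).2) ∧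
    ClosedOdd (fun p => (ρ' p).1) ∧ ClosedOdd (fun p => (ρ' p).2)

/-- The action of a matrix and a two-form `B` on a field of pairs of even forms. -/
def transform (A : Matrix (Fin 2) (Fin 2) ℝ) (B : M → E5 [⋀^Fin 2]→L[ℝ] ℝ)
    (ρ : M → EvenForm E5 × EvenForm E5) (p : M) : EvenForm E5 × EvenForm E5 :=
  matAct A (expB (B p) (ρ p).1, expB (B p) (ρ p).2)

/-- `A ∈ SL(2, ℝ)` and the closed two-form `B` bring `ρ` to the shape
`ρ₁ = ω + (degree 4)`, `ρ₂ = 1 + (degree 4)`. -/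
structure Normalizes (A : Matrix (Fin 2) (Fin 2) ℝ) (B : M → E5 [⋀^Fin 2]→L[ℝ] ℝ)
    (ρ : M → EvenForm E5 × EvenForm E5) : Prop where
  det_eq_one : A.det = 1
  smooth : SmoothForm B
  closed : ClosedForm B
  deg_zero_fst : ∀ p, (transform A B ρ p).1.1 = 0
  deg_zero_snd : ∀ p, (transform A B ρ p).2.1 = zeroForm 1
  deg_two_snd : ∀ p, (transform A B ρ p).2.2.1 = 0

end Manifold

/-- The rank of a two-form. -/
def rankTwoForm (α : E5 [⋀^Fin 2]→L[ℝ] ℝ) : ℕ :=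
  Module.finrank ℝ (LinearMap.range (α.curryLeft : E5 →ₗ[ℝ] E5 [⋀^Fin 1]→L[ℝ] ℝ))

/-- `ρ₁ = dx₁∧dx₂ + dx₃∧dx₄ + ε dx₁∧dx₃∧dx₄∧dx₅`, `ρ₂ = 1 + dx₂∧dx₃∧dx₄∧dx₅`. -/
def normalForm (ε : ℝ) : EvenForm E5 × EvenForm E5 :=
  ((0, wedge (dx 0) (dx 1) + wedge (dx 2) (dx 3),
      ε • wedge (dx 0) (wedge (dx 2) (wedge (dx 3) (dx 4)))),
   (zeroForm 1, 0, wedge (dx 1) (wedge (dx 2) (wedge (dx 3) (dx 4)))))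

/-- `∂/∂x₅ + ε dx₁`, `∂/∂x₁`, `ε ∂/∂x₂ + dx₂`. -/
def normalTriple (ε : ℝ) : Fin 3 → GenVec E5 :=
  ![(basisVec 4, ε • coordCovec 0), (basisVec 0, 0), (ε • basisVec 1, coordCovec 1)]

/-- The Lie derivative of a one-form on (an open subset of) the model space. -/
def lieDeriv (X : E5 → E5) (η : E5 → E5 →L[ℝ] ℝ) (x : E5) : E5 →L[ℝ] ℝ :=
  fderiv ℝ η x (X x) + (η x).comp (fderiv ℝ X x)

/-- The Courant bracket
`[X + ξ, Y + η] = [X, Y] + L_X η - L_Y ξ - ½ d(i_X η - i_Y ξ)`. -/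
def courant (u v : E5 → GenVec E5) (x : E5) : GenVec E5 :=
  (VectorField.lieBracket ℝ (fun y => (u y).1) (fun y => (v y).1) x,
   lieDeriv (fun y => (u y).1) (fun y => (v y).2) x
     - lieDeriv (fun y => (v y).1) (fun y => (u y).2) x
     - (1 / 2 : ℝ) • fderiv ℝ (fun y => (v y).2 (u y).1 - (u y).2 (v y).1) x)

end GenGeom

end

/-!
A solution is put in the shape `(Ω + γ₁, 1 + γ₂)` by constants: its components of degree zero are
closed, hence constant on the connected manifold, so that a fixed matrix of determinant one takes
them to `(0, 1)`, and then a closed two-form `B` removes the term of degree two of the second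
component (`exists_normalizes`).  Everything else happens near a point, in a chart.

*Algebra.*  Relative to the volume form `ν` four-forms are vectors: let `γᵢ = i_{Gᵢ} ν` and
`Ω ∧ Ω = i_Y ν`.  By `Qvec_eq` the vector `Q(a + β + γ)` is explicit, the quartic is invariant under
`SL(2)` and `e^B`, and on the normalised shape it is `-8 Ω(G₁, G₂)`.  As `ν` is its own volume form
this number is `± 1`, so that `Ω(G₁, G₂) = ε / 8`.  The quartic is affine in each of `Ω`, `γ₁` and
`γ₂` separately, which gives the derivative of the volume along the corresponding lines
(`hat_relations`): up to constants the one-forms of the dual pair are `θᵢ = i_{Gᵢ} Ω`, and its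
three-forms yield `χ` with `χ ∧ β = -4 ε β(G₁, G₂) ν` for all two-forms `β`.

*Commuting fields.*  Hence `θ₁`, `θ₂` and `χ` are closed, and so is the reduced form
`Ω' = Ω - 8 ε θ₁ ∧ θ₂`.  The fields `G₁`, `G₂` and `Y` annihilate `Ω'`, the first two annihilate
`χ`, and `i_Y χ = -Ω'`.  Since `i_{[U, V]} = L_U i_V - i_V L_U`, the brackets of `G₁`, `G₂`, `Y` are
annihilated by both `Ω` and `χ`, and a vector annihilated by both is zero
(`NormalData.lieBracket_eq_zero`).  If `Ω` has rank four then `Ω'` does not vanish and the three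
fields are linearly independent.

*Straightening.*  Commuting independent fields are coordinate fields in suitable coordinates
(`exists_straightening`).  Their simultaneous flow `Ψ` is obtained from the smooth inverse function
theorem on the Banach space of continuous paths: the paths `γ` with `γ' = ∑ⱼ aⱼ Xⱼ(γ)` and
`γ(0) = x` are the fixed points of an integral operator depending smoothly on `(a, x, γ)`, and
`∂Ψ/∂aⱼ = Xⱼ(Ψ)` because `t ↦ t Xⱼ(γ(t))` solves the linearised equation
(`exists_commuting_flow`).

*Coordinates.*  Where `G₁`, `G₂`, `Y` are the first three coordinate fields, `Ω'` is a multiple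
`h dy₄ ∧ dy₅` with `h` a function of `y₄` and `y₅`; straightening once more it is `df ∧ dy₅`.  With
primitives `fᵢ` of `θᵢ` this gives `Ω = 8 ε df₁ ∧ df₂ + df ∧ dy₅`, so that
`(ε √8 f₁, √8 f₂, f, y₅, (2 / √8) y₃)` are coordinates in which `Ω` is the standard form and `G₁`,
`G₂`, `Y` are constant (`exists_normal_coordinates`).  These determine `ν`, and therefore `γ₁` and
`γ₂` (`eq_normalForm`).  The vectors `v₁`, `h`, `v₂` are constant in these coordinates too, which
gives their span and the vanishing of their Courant brackets (`triple_of_gvec`, `courant_eq_zero`).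
-/

noncomputable section
namespace GenGeom

/-! ### The wedge product of alternating forms

Commutativity and associativity are stated for the individual degrees that occur: with numerals for
the degrees both sides have definitionally equal types, and no form has to be transported along an
equality of degrees. -/

theorem removeNth_succ_vecCons {X : Type*} {n : ℕ} (x : X) (v : Fin (n + 1) → X)
    (i : Fin (n + 1)) :
    i.succ.removeNth (Matrix.vecCons x v) = Matrix.vecCons x (i.removeNth v) := by
  ext j : 1
  refine Fin.cases ?_ (fun j => ?_) j
  · simp [Fin.removeNth]
  · simp [Fin.removeNth]

section WedgeAlgebra
variable {E : Type*} [NormedAddCommGroup E] [NormedSpace ℝ E]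

theorem curryLeft_injective {n : ℕ} {α β : E [⋀^Fin (n + 1)]→L[ℝ] ℝ}
    (h : ∀ v, α.curryLeft v = β.curryLeft v) : α = β := by
  ext w
  have := congrArg (fun η => η (Fin.tail w)) (h (w 0))
  simpa [ContinuousAlternatingMap.curryLeft_apply_apply, Matrix.vecCons] using this

theorem curryLeft_neg_apply {n : ℕ} (α : E [⋀^Fin (n + 1)]→L[ℝ] ℝ) (v : E) :
    (-α).curryLeft v = -α.curryLeft v := rfl

/-- Naturality of the wedge product under pull-back by a linear map. -/
theorem wedge_compContinuousLinearMap {F : Type*} [NormedAddCommGroup F] [NormedSpace ℝ F]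
    (L : F →L[ℝ] E) {k n : ℕ} (α : E [⋀^Fin k]→L[ℝ] ℝ) (β : E [⋀^Fin n]→L[ℝ] ℝ) :
    wedge (α.compContinuousLinearMap L) (β.compContinuousLinearMap L) =
      (wedge α β).compContinuousLinearMap L := by
  induction k with
  | zero =>
    ext v
    rw [wedge_zero_left, wedge_zero_left]
    simp only [ContinuousAlternatingMap.smul_apply,
      ContinuousAlternatingMap.compContinuousLinearMap_apply]
    congr 2
    exact Subsingleton.elim _ _
  | succ k ih =>
    ext v
    rw [wedge_succ_apply, ContinuousAlternatingMap.compContinuousLinearMap_apply, wedge_succ_apply]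
    congr 1
    refine Finset.sum_congr rfl fun i _ => ?_
    congr 1
    rw [ContinuousAlternatingMap.curryLeft_compContinuousLinearMap, ih]
    rfl

theorem wedge_add_left {k n : ℕ} (α α' : E [⋀^Fin k]→L[ℝ] ℝ) (β : E [⋀^Fin n]→L[ℝ] ℝ) :
    wedge (α + α') β = wedge α β + wedge α' β := by simp [wedge]

theorem wedge_add_right {k n : ℕ} (α : E [⋀^Fin k]→L[ℝ] ℝ) (β β' : E [⋀^Fin n]→L[ℝ] ℝ) :
    wedge α (β + β') = wedge α β + wedge α β' := by simp [wedge]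

theorem wedge_sub_left {k n : ℕ} (α α' : E [⋀^Fin k]→L[ℝ] ℝ) (β : E [⋀^Fin n]→L[ℝ] ℝ) :
    wedge (α - α') β = wedge α β - wedge α' β := by simp [wedge]

theorem wedge_sub_right {k n : ℕ} (α : E [⋀^Fin k]→L[ℝ] ℝ) (β β' : E [⋀^Fin n]→L[ℝ] ℝ) :
    wedge α (β - β') = wedge α β - wedge α β' := by simp [wedge]

theorem wedge_smul_left {k n : ℕ} (c : ℝ) (α : E [⋀^Fin k]→L[ℝ] ℝ) (β : E [⋀^Fin n]→L[ℝ] ℝ) :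
    wedge (c • α) β = c • wedge α β := by simp [wedge]

theorem wedge_smul_right {k n : ℕ} (c : ℝ) (α : E [⋀^Fin k]→L[ℝ] ℝ) (β : E [⋀^Fin n]→L[ℝ] ℝ) :
    wedge α (c • β) = c • wedge α β := by simp [wedge]

theorem wedge_neg_right {k n : ℕ} (α : E [⋀^Fin k]→L[ℝ] ℝ) (β : E [⋀^Fin n]→L[ℝ] ℝ) :
    wedge α (-β) = -wedge α β := by simp [wedge]

theorem wedge_neg_left {k n : ℕ} (α : E [⋀^Fin k]→L[ℝ] ℝ) (β : E [⋀^Fin n]→L[ℝ] ℝ) :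
    wedge (-α) β = -wedge α β := by simp [wedge]

@[simp] theorem wedge_zero_form_left {k n : ℕ} (β : E [⋀^Fin n]→L[ℝ] ℝ) :
    wedge (0 : E [⋀^Fin k]→L[ℝ] ℝ) β = 0 := by simp [wedge]

@[simp] theorem wedge_zero_form_right {k n : ℕ} (α : E [⋀^Fin k]→L[ℝ] ℝ) :
    wedge α (0 : E [⋀^Fin n]→L[ℝ] ℝ) = 0 := by simp [wedge]

/-- The recursion for the wedge product, with the first argument split off. -/
theorem wedge_succ_apply_vecCons {k n : ℕ} (α : E [⋀^Fin (k + 1)]→L[ℝ] ℝ)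
    (β : E [⋀^Fin n]→L[ℝ] ℝ) (x : E) (v : Fin (n + k) → E) :
    (k + 1 : ℝ) * wedge α β (Matrix.vecCons x v) = wedge (α.curryLeft x) β v -
      ∑ i : Fin (n + k), (-1 : ℝ) ^ (i : ℕ) *
        wedge (α.curryLeft (v i)) β (i.succ.removeNth (Matrix.vecCons x v)) := by
  rw [wedge_succ_apply, ← mul_assoc, mul_inv_cancel₀ (by positivity), one_mul, Fin.sum_univ_succ]
  simp only [Fin.val_zero, pow_zero, one_mul, Fin.val_succ, pow_succ, sub_eq_add_neg,
    ← Finset.sum_neg_distrib, Matrix.cons_val_zero, Matrix.cons_val_succ]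
  congr 1
  refine Finset.sum_congr rfl fun i _ => ?_
  ring

theorem curryLeft_curryLeft_swap {n : ℕ} (α : E [⋀^Fin (n + 2)]→L[ℝ] ℝ) (x y : E) :
    (α.curryLeft x).curryLeft y = -(α.curryLeft y).curryLeft x := by
  have h := ContinuousAlternatingMap.curryLeft_same α (x + y)
  have hx := ContinuousAlternatingMap.curryLeft_same α x
  have hy := ContinuousAlternatingMap.curryLeft_same α y
  simp only [map_add, ContinuousAlternatingMap.curryLeft_add, add_apply, hx, hy, zero_add,
    add_zero] at h
  exact eq_neg_of_add_eq_zero_left (by rw [add_comm] at h; exact h)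

/-- Contraction with a vector is an antiderivation; here the first factor has degree one. The cases
of degree two and three reduce to it by contracting under the sum that defines the product. -/
theorem curryLeft_wedge_one {n : ℕ} (α : E [⋀^Fin 1]→L[ℝ] ℝ) (β : E [⋀^Fin (n + 1)]→L[ℝ] ℝ)
    (x : E) : (wedge α β).curryLeft x =
      wedge (α.curryLeft x) β - wedge α (β.curryLeft x) := by
  ext v
  have h := wedge_succ_apply_vecCons α β x v
  simp only [wedge_zero_left, ContinuousAlternatingMap.smul_apply, Nat.cast_zero, zero_add,
      one_mul] at h
  rw [ContinuousAlternatingMap.curryLeft_apply_apply, h, ContinuousAlternatingMap.sub_apply,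
    wedge_zero_left, wedge_succ_apply]
  simp only [Nat.cast_zero, zero_add, inv_one, one_mul, wedge_zero_left,
    ContinuousAlternatingMap.smul_apply]
  congr 1
  refine Finset.sum_congr rfl fun i _ => ?_
  have e : β (i.succ.removeNth (Matrix.vecCons x v)) = β.curryLeft x (i.removeNth v) := by
    rw [β.curryLeft_apply_apply, ← removeNth_succ_vecCons]
  rw [← e]

theorem curryLeft_wedge_two {n : ℕ} (α : E [⋀^Fin 2]→L[ℝ] ℝ) (β : E [⋀^Fin (n + 1)]→L[ℝ] ℝ)
    (x : E) : (wedge α β).curryLeft x =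
      wedge (α.curryLeft x) β + wedge α (β.curryLeft x) := by
  ext v
  have h := wedge_succ_apply_vecCons α β x v
  have e : ∀ i : Fin (n + 1 + 1),
      wedge (α.curryLeft (v i)) β (i.succ.removeNth (Matrix.vecCons x v)) =
      (wedge (α.curryLeft (v i)) β).curryLeft x (i.removeNth v) := fun i => by
    rw [ContinuousAlternatingMap.curryLeft_apply_apply, ← removeNth_succ_vecCons]
  simp only [e, curryLeft_wedge_one, curryLeft_curryLeft_swap α _ x, wedge_neg_left] at h
  have h1 := wedge_succ_apply (α.curryLeft x) β v
  have h2 := wedge_succ_apply α (β.curryLeft x) v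
  rw [ContinuousAlternatingMap.curryLeft_apply_apply, ContinuousAlternatingMap.add_apply]
  simp only [ContinuousAlternatingMap.sub_apply, ContinuousAlternatingMap.neg_apply, mul_sub,
    Finset.sum_sub_distrib, mul_neg, Finset.sum_neg_distrib] at h
  norm_num at h h1 h2
  rw [← h1] at h
  linarith

theorem curryLeft_wedge_three {n : ℕ} (α : E [⋀^Fin 3]→L[ℝ] ℝ) (β : E [⋀^Fin (n + 1)]→L[ℝ] ℝ)
    (x : E) : (wedge α β).curryLeft x =
      wedge (α.curryLeft x) β - wedge α (β.curryLeft x) := by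
  ext v
  have h := wedge_succ_apply_vecCons α β x v
  have e : ∀ i : Fin (n + 1 + 2),
      wedge (α.curryLeft (v i)) β (i.succ.removeNth (Matrix.vecCons x v)) =
      (wedge (α.curryLeft (v i)) β).curryLeft x (i.removeNth v) := fun i => by
    rw [ContinuousAlternatingMap.curryLeft_apply_apply, ← removeNth_succ_vecCons]
  simp only [e, curryLeft_wedge_two, curryLeft_curryLeft_swap α _ x, wedge_neg_left] at h
  have h1 := wedge_succ_apply (α.curryLeft x) β v
  have h2 := wedge_succ_apply α (β.curryLeft x) v
  rw [ContinuousAlternatingMap.curryLeft_apply_apply, ContinuousAlternatingMap.sub_apply]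
  simp only [ContinuousAlternatingMap.add_apply, ContinuousAlternatingMap.neg_apply, mul_add,
    Finset.sum_add_distrib, mul_neg, Finset.sum_neg_distrib] at h
  norm_num at h h1 h2
  linarith

/-- Moving the `i`-th argument of an alternating form to the front. -/
theorem smul_map_vecCons_removeNth {n : ℕ} (α : E [⋀^Fin (n + 1)]→L[ℝ] ℝ) (v : Fin (n + 1) → E)
    (i : Fin (n + 1)) :
    (-1 : ℝ) ^ (i : ℕ) * α (Matrix.vecCons (v i) (i.removeNth v)) = α v := by
  have h := α.map_insertNth i (v i) (i.removeNth v)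
  rw [Fin.insertNth_self_removeNth] at h
  rw [h]
  simp

theorem wedge_one_zero (α : E [⋀^Fin 1]→L[ℝ] ℝ) (c : E [⋀^Fin 0]→L[ℝ] ℝ) :
    @Eq (E [⋀^Fin 1]→L[ℝ] ℝ) (wedge α c) (c ![] • α) := by
  ext v
  rw [wedge_succ_apply]
  simp only [wedge_zero_left, ContinuousAlternatingMap.smul_apply, smul_eq_mul]
  have := smul_map_vecCons_removeNth α v 0
  simp only [ContinuousAlternatingMap.curryLeft_apply_apply, Fin.sum_univ_succ] at this ⊢
  simp at this ⊢
  rw [← this, mul_comm]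
  congr 2
  · exact Subsingleton.elim _ _
  · congr 1
    exact Subsingleton.elim _ _

theorem wedge_two_zero (α : E [⋀^Fin 2]→L[ℝ] ℝ) (c : E [⋀^Fin 0]→L[ℝ] ℝ) :
    @Eq (E [⋀^Fin 2]→L[ℝ] ℝ) (wedge α c) (c ![] • α) := by
  ext v
  have e : ∀ i : Fin 2, (-1 : ℝ) ^ (i : ℕ) * (c ![] * α.curryLeft (v i) (i.removeNth v)) =
      c ![] * α v := fun i => by
    rw [mul_left_comm, ContinuousAlternatingMap.curryLeft_apply_apply, smul_map_vecCons_removeNth]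
  rw [wedge_succ_apply]
  simp only [wedge_one_zero, ContinuousAlternatingMap.smul_apply, smul_eq_mul]
  refine (congrArg _ (Finset.sum_congr rfl fun i _ => e i)).trans ?_
  simp
  norm_num
  ring

theorem wedge_three_zero (α : E [⋀^Fin 3]→L[ℝ] ℝ) (c : E [⋀^Fin 0]→L[ℝ] ℝ) :
    @Eq (E [⋀^Fin 3]→L[ℝ] ℝ) (wedge α c) (c ![] • α) := by
  ext v
  have e : ∀ i : Fin 3, (-1 : ℝ) ^ (i : ℕ) * (c ![] * α.curryLeft (v i) (i.removeNth v)) =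
      c ![] * α v := fun i => by
    rw [mul_left_comm, ContinuousAlternatingMap.curryLeft_apply_apply, smul_map_vecCons_removeNth]
  rw [wedge_succ_apply]
  simp only [wedge_two_zero, ContinuousAlternatingMap.smul_apply, smul_eq_mul]
  refine (congrArg _ (Finset.sum_congr rfl fun i _ => e i)).trans ?_
  simp
  norm_num
  ring

theorem wedge_four_zero (α : E [⋀^Fin 4]→L[ℝ] ℝ) (c : E [⋀^Fin 0]→L[ℝ] ℝ) :
    @Eq (E [⋀^Fin 4]→L[ℝ] ℝ) (wedge α c) (c ![] • α) := by
  ext v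
  have e : ∀ i : Fin 4, (-1 : ℝ) ^ (i : ℕ) * (c ![] * α.curryLeft (v i) (i.removeNth v)) =
      c ![] * α v := fun i => by
    rw [mul_left_comm, ContinuousAlternatingMap.curryLeft_apply_apply, smul_map_vecCons_removeNth]
  rw [wedge_succ_apply]
  simp only [wedge_three_zero, ContinuousAlternatingMap.smul_apply, smul_eq_mul]
  refine (congrArg _ (Finset.sum_congr rfl fun i _ => e i)).trans ?_
  simp
  norm_num
  ring

theorem wedge_five_zero (α : E [⋀^Fin 5]→L[ℝ] ℝ) (c : E [⋀^Fin 0]→L[ℝ] ℝ) :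
    @Eq (E [⋀^Fin 5]→L[ℝ] ℝ) (wedge α c) (c ![] • α) := by
  ext v
  have e : ∀ i : Fin 5, (-1 : ℝ) ^ (i : ℕ) * (c ![] * α.curryLeft (v i) (i.removeNth v)) =
      c ![] * α v := fun i => by
    rw [mul_left_comm, ContinuousAlternatingMap.curryLeft_apply_apply, smul_map_vecCons_removeNth]
  rw [wedge_succ_apply]
  simp only [wedge_four_zero, ContinuousAlternatingMap.smul_apply, smul_eq_mul]
  refine (congrArg _ (Finset.sum_congr rfl fun i _ => e i)).trans ?_
  simp
  norm_num
  ring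

theorem wedge_comm_one_one (α β : E [⋀^Fin 1]→L[ℝ] ℝ) : wedge α β = -wedge β α := by
  refine curryLeft_injective fun v => ?_
  rw [curryLeft_neg_apply]
  simp only [curryLeft_wedge_one, wedge_zero_left, wedge_one_zero]
  module

theorem wedge_comm_one_two (α : E [⋀^Fin 1]→L[ℝ] ℝ) (β : E [⋀^Fin 2]→L[ℝ] ℝ) :
    wedge α β = wedge β α := by
  refine curryLeft_injective fun v => ?_
  rw [curryLeft_wedge_one, curryLeft_wedge_two, wedge_zero_left, wedge_two_zero,
    wedge_comm_one_one]
  module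

theorem wedge_comm_two_two (α β : E [⋀^Fin 2]→L[ℝ] ℝ) : wedge α β = wedge β α := by
  refine curryLeft_injective fun v => ?_
  rw [curryLeft_wedge_two, curryLeft_wedge_two, wedge_comm_one_two, wedge_comm_one_two]
  exact add_comm (wedge β (α.curryLeft v)) _

theorem wedge_comm_one_three (α : E [⋀^Fin 1]→L[ℝ] ℝ) (β : E [⋀^Fin 3]→L[ℝ] ℝ) :
    wedge α β = -wedge β α := by
  refine curryLeft_injective fun v => ?_
  rw [curryLeft_neg_apply, curryLeft_wedge_one,
    curryLeft_wedge_three, wedge_zero_left, wedge_three_zero, wedge_comm_one_two]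
  module

theorem wedge_comm_two_three (α : E [⋀^Fin 2]→L[ℝ] ℝ) (β : E [⋀^Fin 3]→L[ℝ] ℝ) :
    wedge α β = wedge β α := by
  refine curryLeft_injective fun v => ?_
  rw [curryLeft_wedge_two, curryLeft_wedge_three, wedge_comm_one_three, wedge_comm_two_two]
  module

theorem wedge_assoc_one_one_one (α β γ : E [⋀^Fin 1]→L[ℝ] ℝ) :
    wedge (wedge α β) γ = wedge α (wedge β γ) := by
  refine curryLeft_injective fun v => ?_
  simp only [curryLeft_wedge_one, curryLeft_wedge_two, wedge_sub_left, wedge_sub_right,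
    wedge_zero_left, wedge_one_zero, wedge_two_zero, wedge_smul_left, wedge_smul_right]
  module

theorem wedge_assoc_one_one_two (α β : E [⋀^Fin 1]→L[ℝ] ℝ) (γ : E [⋀^Fin 2]→L[ℝ] ℝ) :
    wedge (wedge α β) γ = wedge α (wedge β γ) := by
  refine curryLeft_injective fun v => ?_
  simp only [curryLeft_wedge_one, curryLeft_wedge_two, wedge_sub_left, wedge_sub_right,
    wedge_zero_left, wedge_one_zero, wedge_smul_left, wedge_smul_right, wedge_assoc_one_one_one]
  module

theorem wedge_assoc_one_two_one (α : E [⋀^Fin 1]→L[ℝ] ℝ) (β : E [⋀^Fin 2]→L[ℝ] ℝ)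
    (γ : E [⋀^Fin 1]→L[ℝ] ℝ) :
    wedge (wedge α β) γ = wedge α (wedge β γ) := by
  refine curryLeft_injective fun v => ?_
  simp only [curryLeft_wedge_one, curryLeft_wedge_two, curryLeft_wedge_three, wedge_sub_left,
    wedge_add_right,
    wedge_zero_left, wedge_two_zero, wedge_three_zero, wedge_smul_left, wedge_smul_right,
    wedge_assoc_one_one_one]
  module

theorem wedge_assoc_one_two_two (α : E [⋀^Fin 1]→L[ℝ] ℝ) (β γ : E [⋀^Fin 2]→L[ℝ] ℝ) :
    wedge (wedge α β) γ = wedge α (wedge β γ) := by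
  refine curryLeft_injective fun v => ?_
  simp only [curryLeft_wedge_one, curryLeft_wedge_two, curryLeft_wedge_three, wedge_sub_left,
    wedge_add_right,
    wedge_zero_left, wedge_smul_left, wedge_assoc_one_one_two, wedge_assoc_one_two_one]
  module

theorem eq_zero_of_finrank_lt [FiniteDimensional ℝ E] {n : ℕ} (h : Module.finrank ℝ E < n)
    (α : E [⋀^Fin n]→L[ℝ] ℝ) : α = 0 := by
  ext v
  refine α.toAlternatingMap.map_linearDependent v fun hv => ?_
  have := hv.fintype_card_le_finrank
  simp at this
  omega

/-- The contraction of `β ∧ γ`, which vanishes for reasons of degree. -/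
theorem curryLeft_four_wedge_two [FiniteDimensional ℝ E] (hE : Module.finrank ℝ E = 5)
    (γ : E [⋀^Fin 4]→L[ℝ] ℝ) (β : E [⋀^Fin 2]→L[ℝ] ℝ) (x : E) :
    wedge (γ.curryLeft x) β = -wedge (β.curryLeft x) γ := by
  have h := curryLeft_wedge_two β γ x
  rw [eq_zero_of_finrank_lt (by omega) (wedge β γ), ContinuousAlternatingMap.curryLeft_zero,
    wedge_comm_two_three] at h
  exact (neg_eq_of_add_eq_zero_right h.symm).symm

/-- The contraction of `α ∧ β`, which vanishes for reasons of degree. -/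
theorem curryLeft_three_wedge_three [FiniteDimensional ℝ E] (hE : Module.finrank ℝ E = 5)
    (α β : E [⋀^Fin 3]→L[ℝ] ℝ) (x : E) :
    wedge (α.curryLeft x) β = wedge α (β.curryLeft x) := by
  have h := curryLeft_wedge_three α β x
  rw [eq_zero_of_finrank_lt (by omega) (wedge α β), ContinuousAlternatingMap.curryLeft_zero] at h
  exact sub_eq_zero.mp h.symm

end WedgeAlgebra

/-! ### The vectors of four-forms and the covariant Q in dimension five -/

theorem curryLeft_add_apply {E : Type*} [NormedAddCommGroup E] [NormedSpace ℝ E] {n : ℕ}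
    (α β : E [⋀^Fin (n + 1)]→L[ℝ] ℝ) (v : E) :
    (α + β).curryLeft v = α.curryLeft v + β.curryLeft v := rfl

theorem finrank_E5 : Module.finrank ℝ E5 = 5 := by simp

@[simp] theorem oneForm_apply {E : Type*} [NormedAddCommGroup E] [NormedSpace ℝ E]
    (ξ : E →L[ℝ] ℝ) (v : Fin 1 → E) : oneForm ξ v = ξ (v 0) := rfl

@[simp] theorem zeroForm_apply {E : Type*} [NormedAddCommGroup E] [NormedSpace ℝ E]
    (c : ℝ) (v : Fin 0 → E) : (zeroForm c : E [⋀^Fin 0]→L[ℝ] ℝ) v = c := rfl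

/-- A form of degree one as a covector. -/
def covec {E : Type*} [NormedAddCommGroup E] [NormedSpace ℝ E] (α : E [⋀^Fin 1]→L[ℝ] ℝ) :
    E →L[ℝ] ℝ := (ContinuousAlternatingMap.ofSubsingleton ℝ E ℝ 0).symm α

section Covec
variable {E : Type*} [NormedAddCommGroup E] [NormedSpace ℝ E]

@[simp] theorem oneForm_covec (α : E [⋀^Fin 1]→L[ℝ] ℝ) : oneForm (covec α) = α :=
  (ContinuousAlternatingMap.ofSubsingleton ℝ E ℝ 0).apply_symm_apply α

theorem covec_apply (α : E [⋀^Fin 1]→L[ℝ] ℝ) (x : E) : covec α x = α ![x] := by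
  conv_rhs => rw [← oneForm_covec α, oneForm_apply]
  rfl

@[simp] theorem covec_add (α β : E [⋀^Fin 1]→L[ℝ] ℝ) : covec (α + β) = covec α + covec β := by
  ext; simp [covec_apply]

@[simp] theorem covec_smul (c : ℝ) (α : E [⋀^Fin 1]→L[ℝ] ℝ) : covec (c • α) = c • covec α := by
  ext; simp [covec_apply]

theorem curryLeft_oneForm_apply (ξ : E →L[ℝ] ℝ) (x : E) : (oneForm ξ).curryLeft x ![] = ξ x := rfl
end Covec

theorem basisVec_expansion (v : E5) : ∑ i, coordCovec i v • basisVec i = v := by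
  ext j
  simp [basisVec, coordCovec, Finset.sum_apply, Pi.single_apply]

theorem coordCovec_basisVec (i j : Fin 5) :
    coordCovec i (basisVec j) = if i = j then 1 else 0 := by
  simp [coordCovec, basisVec]

theorem covec_expansion (ξ : E5 →L[ℝ] ℝ) : ∑ i, ξ (basisVec i) • coordCovec i = ξ := by
  ext v
  conv_rhs => rw [← basisVec_expansion v]
  simp [mul_comm]

/-- `∑ᵢ dxᵢ ∧ i_{∂ᵢ} α = k α` for a form of degree `k`. -/
theorem sum_coord_wedge_curryLeft {k : ℕ} (α : E5 [⋀^Fin (k + 1)]→L[ℝ] ℝ) :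
    ∑ j, wedge (oneForm (coordCovec j)) (α.curryLeft (basisVec j)) = (k + 1 : ℝ) • α := by
  ext v
  rw [ContinuousAlternatingMap.sum_apply]
  simp only [wedge_succ_apply, Nat.cast_zero, zero_add, inv_one, one_mul, wedge_zero_left,
    ContinuousAlternatingMap.smul_apply, curryLeft_oneForm_apply, smul_eq_mul]
  rw [Finset.sum_comm]
  have : ∀ i : Fin (k + 1), ∑ j, (-1 : ℝ) ^ (i : ℕ) *
      (coordCovec j (v i) * α.curryLeft (basisVec j) (i.removeNth v)) = α v := fun i => by
    rw [← smul_map_vecCons_removeNth α v i, ← Finset.mul_sum]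
    congr 1
    conv_rhs => rw [← ContinuousAlternatingMap.curryLeft_apply_apply, ← basisVec_expansion (v i)]
    simp only [map_sum, map_smul, ContinuousAlternatingMap.sum_apply,
      ContinuousAlternatingMap.smul_apply, smul_eq_mul]
  exact (Finset.sum_congr rfl fun i _ => this i).trans (by simp)

/-- The wedge product with covectors is nondegenerate on forms of positive degree below the top
one. -/
theorem eq_zero_of_oneForm_wedge {k : ℕ} (hk : k + 1 < 5) (α : E5 [⋀^Fin (k + 1)]→L[ℝ] ℝ)
    (h : ∀ ξ, wedge (oneForm ξ) α = 0) : α = 0 := by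
  have h1 : ∀ j, wedge (oneForm (coordCovec j)) (α.curryLeft (basisVec j)) = α := fun j => by
    have := curryLeft_wedge_one (oneForm (coordCovec j)) α (basisVec j)
    rw [h, ContinuousAlternatingMap.curryLeft_zero, wedge_zero_left, curryLeft_oneForm_apply,
      coordCovec_basisVec, if_pos rfl, one_smul] at this
    exact (sub_eq_zero.mp this.symm).symm
  have h2 := sum_coord_wedge_curryLeft α
  simp only [h1, Finset.sum_const, Finset.card_univ, Fintype.card_fin] at h2
  have h4 : ((k + 1 : ℕ) : ℝ) < 5 := by exact_mod_cast hk
  push_cast at h4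
  ext v
  have h3 := congrArg (fun η => η v) h2
  simp only [ContinuousAlternatingMap.smul_apply, nsmul_eq_mul, smul_eq_mul] at h3
  norm_num at h3
  rcases h3 with h3 | h3
  · linarith
  · simpa using h3

section Pointwise

variable {ν : E5 [⋀^Fin 5]→L[ℝ] ℝ}

/-- The vector `G` representing a four-form relative to the volume element `ν`: `γ = i_G ν`, or
equivalently `ξ ∧ γ = ξ(G) ν` for all covectors `ξ`. -/
def gvec (ν : E5 [⋀^Fin 5]→L[ℝ] ℝ) (γ : E5 [⋀^Fin 4]→L[ℝ] ℝ) : E5 :=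
  ∑ i, topRatio (wedge (oneForm (coordCovec i)) γ) ν • basisVec i

theorem wedge_one_four (hν : ν ≠ 0) (α : E5 [⋀^Fin 1]→L[ℝ] ℝ) (γ : E5 [⋀^Fin 4]→L[ℝ] ℝ) :
    wedge α γ = α ![gvec ν γ] • ν := by
  have h1 : α = ∑ i, covec α (basisVec i) • oneForm (coordCovec i) := by
    rw [← oneForm_covec α]
    conv_lhs => rw [← covec_expansion (covec α)]
    ext v
    simp [ContinuousAlternatingMap.sum_apply]
  have h2 : wedge α γ = ∑ i, covec α (basisVec i) • wedge (oneForm (coordCovec i)) γ := by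
    conv_lhs => rw [h1]
    simp [wedge]
  rw [h2, ← covec_apply, gvec, map_sum, Finset.sum_smul]
  refine Finset.sum_congr rfl fun i _ => ?_
  rw [map_smul, smul_eq_mul, mul_comm, mul_smul, topRatio_smul _ hν]

theorem eq_of_forall_covec {x y : E5} (h : ∀ ξ : E5 →L[ℝ] ℝ, ξ x = ξ y) : x = y := by
  rw [← basisVec_expansion x, ← basisVec_expansion y]
  simp only [h]

theorem gvec_unique (hν : ν ≠ 0) {γ : E5 [⋀^Fin 4]→L[ℝ] ℝ} {x : E5}
    (h : ∀ ξ : E5 →L[ℝ] ℝ, wedge (oneForm ξ) γ = ξ x • ν) : gvec ν γ = x := by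
  refine eq_of_forall_covec fun ξ => ?_
  have := h ξ
  rw [wedge_one_four hν] at this
  exact smul_left_injective ℝ hν this

theorem gvec_curryLeft (hν : ν ≠ 0) (x : E5) : gvec ν (ν.curryLeft x) = x := by
  refine gvec_unique hν fun ξ => ?_
  have := curryLeft_wedge_one (oneForm ξ) ν x
  rw [eq_zero_of_finrank_lt (by simp) (wedge (oneForm ξ) ν),
    ContinuousAlternatingMap.curryLeft_zero, wedge_zero_left, curryLeft_oneForm_apply] at this
  exact (sub_eq_zero.mp this.symm).symm

theorem gvec_injective (hν : ν ≠ 0) {γ γ' : E5 [⋀^Fin 4]→L[ℝ] ℝ} (h : gvec ν γ = gvec ν γ') :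
    γ = γ' := by
  refine sub_eq_zero.mp (eq_zero_of_oneForm_wedge (by norm_num) _ fun ξ => ?_)
  rw [wedge_sub_right, wedge_one_four hν, wedge_one_four hν, h, sub_self]

@[simp] theorem gvec_add (γ γ' : E5 [⋀^Fin 4]→L[ℝ] ℝ) :
    gvec ν (γ + γ') = gvec ν γ + gvec ν γ' := by
  simp [gvec, wedge_add_right, topRatio, add_div, add_smul, Finset.sum_add_distrib]

@[simp] theorem gvec_smul (c : ℝ) (γ : E5 [⋀^Fin 4]→L[ℝ] ℝ) : gvec ν (c • γ) = c • gvec ν γ := by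
  simp [gvec, wedge_smul_right, topRatio, mul_div_assoc, Finset.smul_sum, smul_smul]

/-- The vector `Y` with `i_Y ν = α ∧ β`, for two-forms `α` and `β`. -/
def sqvec (ν : E5 [⋀^Fin 5]→L[ℝ] ℝ) (α β : E5 [⋀^Fin 2]→L[ℝ] ℝ) : E5 := gvec ν (wedge α β)

theorem sqvec_comm (α β : E5 [⋀^Fin 2]→L[ℝ] ℝ) : sqvec ν α β = sqvec ν β α := by
  rw [sqvec, wedge_comm_two_two]; rfl

@[simp] theorem sqvec_add_left (α α' β : E5 [⋀^Fin 2]→L[ℝ] ℝ) :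
    sqvec ν (α + α') β = sqvec ν α β + sqvec ν α' β :=
  (congrArg (gvec ν) (wedge_add_left α α' β)).trans (gvec_add _ _)

@[simp] theorem sqvec_smul_left (c : ℝ) (α β : E5 [⋀^Fin 2]→L[ℝ] ℝ) :
    sqvec ν (c • α) β = c • sqvec ν α β :=
  (congrArg (gvec ν) (wedge_smul_left c α β)).trans (gvec_smul _ _)

@[simp] theorem sqvec_add_right (α β β' : E5 [⋀^Fin 2]→L[ℝ] ℝ) :
    sqvec ν α (β + β') = sqvec ν α β + sqvec ν α β' := by
  simp only [sqvec_comm α, sqvec_add_left]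

@[simp] theorem sqvec_smul_right (c : ℝ) (α β : E5 [⋀^Fin 2]→L[ℝ] ℝ) :
    sqvec ν α (c • β) = c • sqvec ν α β := by
  simp only [sqvec_comm α, sqvec_smul_left]

/-- In dimension five `i_x (α ∧ β ∧ γ)` vanishes; in terms of the vectors of the four-forms `β ∧ γ`,
`α ∧ γ` and `α ∧ β`. -/
theorem cyclic_contraction (hν : ν ≠ 0) (α β γ : E5 [⋀^Fin 2]→L[ℝ] ℝ) (x : E5) :
    α ![x, sqvec ν β γ] + β ![x, sqvec ν α γ] + γ ![x, sqvec ν α β] = 0 := by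
  have h := curryLeft_four_wedge_two finrank_E5 (wedge α β) γ x
  have e : wedge α (β.curryLeft x) = wedge (β.curryLeft x) α := (wedge_comm_one_two _ _).symm
  rw [curryLeft_wedge_two, e, wedge_add_left, wedge_assoc_one_two_two, wedge_assoc_one_two_two,
    wedge_one_four hν, wedge_one_four hν, wedge_one_four hν, ← add_smul] at h
  have h' := smul_left_injective ℝ hν (h.trans (neg_smul _ _).symm)
  simp only [ContinuousAlternatingMap.curryLeft_apply_apply] at h'
  simp only [sqvec]
  linarith

/-- The symmetric bilinear map on even forms whose quadratic form is `Q`, in terms of the vectors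
representing four-forms. -/
def Qpolar (ν : E5 [⋀^Fin 5]→L[ℝ] ℝ) (ρ σ : EvenForm E5) : GenVec E5 :=
  ((2 * ρ.1 ![]) • gvec ν σ.2.2 + (2 * σ.1 ![]) • gvec ν ρ.2.2
      - (2 : ℝ) • sqvec ν ρ.2.1 σ.2.1,
    (-2 : ℝ) • (covec (ρ.2.1.curryLeft (gvec ν σ.2.2)) + covec (σ.2.1.curryLeft (gvec ν ρ.2.2))))

/-- The inner product on `T ⊕ T*` is nondegenerate. -/
theorem genInner_right_injective {u w : GenVec E5} (h : ∀ v, genInner u v = genInner w v) :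
    u = w := by
  refine Prod.ext (eq_of_forall_covec fun ξ => ?_) ?_
  · have := h (0, ξ)
    simp [genInner] at this
    linarith
  · ext x
    have := h (x, 0)
    simp [genInner] at this
    linarith

theorem two_form_swap (β : E5 [⋀^Fin 2]→L[ℝ] ℝ) (x y : E5) : β ![x, y] = -β ![y, x] := by
  have := congrArg (fun η => η ![]) (curryLeft_curryLeft_swap β x y)
  simpa [ContinuousAlternatingMap.curryLeft_apply_apply] using this

theorem two_form_self (β : E5 [⋀^Fin 2]→L[ℝ] ℝ) (x : E5) : β ![x, x] = 0 := by
  have := two_form_swap β x x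
  linarith

theorem covec_curryLeft_apply (β : E5 [⋀^Fin 2]→L[ℝ] ℝ) (x y : E5) :
    covec (β.curryLeft x) y = β ![x, y] := by
  rw [covec_apply, ContinuousAlternatingMap.curryLeft_apply_apply]

theorem two_form_add_right (β : E5 [⋀^Fin 2]→L[ℝ] ℝ) (x y z : E5) :
    β ![x, y + z] = β ![x, y] + β ![x, z] := by
  simp only [← covec_curryLeft_apply, map_add]

theorem two_form_sub_right (β : E5 [⋀^Fin 2]→L[ℝ] ℝ) (x y z : E5) :
    β ![x, y - z] = β ![x, y] - β ![x, z] := by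
  simp only [← covec_curryLeft_apply, map_sub]

theorem two_form_smul_right (β : E5 [⋀^Fin 2]→L[ℝ] ℝ) (x y : E5) (c : ℝ) :
    β ![x, c • y] = c * β ![x, y] := by
  simp only [← covec_curryLeft_apply, map_smul, smul_eq_mul]

/-- For `ρ = a + β + γ` with `γ = i_G ν` and `β ∧ β = i_Y ν`, the vector `Q(ρ)` is
`(4 a G - 2 Y) - 4 i_G β`. -/
theorem Qvec_eq (hν : ν ≠ 0) (ρ : EvenForm E5) : Qvec ν ρ = Qpolar ν ρ ρ := by
  refine genInner_right_injective fun v => smul_left_injective ℝ hν ?_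
  change genInner (Qvec ν ρ) v • ν = _ • ν
  rw [genInner_Qvec hν]
  obtain ⟨a, β, γ⟩ := ρ
  obtain ⟨x, ξ⟩ := v
  have e : (β.curryLeft x + a ![] • oneForm ξ) ![gvec ν γ] =
    β ![x, gvec ν γ] + a ![] * ξ (gvec ν γ) := rfl
  simp only [mukai, clifford, wedge_one_zero, wedge_five_zero, wedge_add_left,
    curryLeft_four_wedge_two finrank_E5, wedge_assoc_one_two_two, wedge_one_four hν, e]
  simp only [ContinuousAlternatingMap.curryLeft_apply_apply, oneForm_apply, Matrix.cons_val_zero,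
    genInner, Qpolar, map_sub, map_add, map_smul, smul_eq_mul, smul_apply, add_apply, covec_apply,
    sqvec]
  rw [two_form_swap β x]
  module

theorem Qpolar_comm (ρ σ : EvenForm E5) : Qpolar ν ρ σ = Qpolar ν σ ρ := by
  simp only [Qpolar]
  rw [sqvec_comm, add_comm (covec _), add_comm ((2 * ρ.1 ![]) • _)]

theorem Qpolar_comb_left (a b : ℝ) (ρ σ τ : EvenForm E5) :
    Qpolar ν (a • ρ + b • σ) τ = a • Qpolar ν ρ τ + b • Qpolar ν σ τ := by
  refine Prod.ext ?_ ?_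
  · simp [Qpolar]
    module
  · simp [Qpolar]
    ext x
    simp [covec_apply]
    ring

theorem Qpolar_comb_right (a b : ℝ) (ρ σ τ : EvenForm E5) :
    Qpolar ν τ (a • ρ + b • σ) = a • Qpolar ν τ ρ + b • Qpolar ν τ σ := by
  rw [Qpolar_comm, Qpolar_comb_left, Qpolar_comm ρ, Qpolar_comm σ]

/-- The vector `Q(ρ)` is null. -/
theorem genInner_Qpolar_self (hν : ν ≠ 0) (ρ : EvenForm E5) :
    genInner (Qpolar ν ρ ρ) (Qpolar ν ρ ρ) = 0 := by
  have h := cyclic_contraction hν ρ.2.1 ρ.2.1 ρ.2.1 (gvec ν ρ.2.2)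
  simp only [genInner, Qpolar, covec_apply, smul_apply, add_apply, map_sub, map_add, map_smul,
    smul_eq_mul, ContinuousAlternatingMap.curryLeft_apply_apply]
  rw [two_form_self]
  linear_combination (8 / 3 : ℝ) * h

/-- The three vectors are the coefficients of `Q(ρ₁ + z ρ₂)`, that is, the values of the
polarization of `Q` on the two components. -/
theorem triple_eq (hν : ν ≠ 0) (ρ : EvenForm E5 × EvenForm E5) :
    triple ν ρ = ![Qpolar ν ρ.1 ρ.1, Qpolar ν ρ.1 ρ.2, Qpolar ν ρ.2 ρ.2] := by
  have h : Qpolar ν (ρ.1 + ρ.2) (ρ.1 + ρ.2) =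
      Qpolar ν ρ.1 ρ.1 + (2 : ℝ) • Qpolar ν ρ.1 ρ.2 + Qpolar ν ρ.2 ρ.2 := by
    have := Qpolar_comb_left (ν := ν) 1 1 ρ.1 ρ.2 (ρ.1 + ρ.2)
    have h1 := Qpolar_comb_right (ν := ν) 1 1 ρ.1 ρ.2 ρ.1
    have h2 := Qpolar_comb_right (ν := ν) 1 1 ρ.1 ρ.2 ρ.2
    simp only [one_smul] at this h1 h2
    rw [this, h1, h2, Qpolar_comm ρ.2 ρ.1]
    module
  simp only [triple, Qvec_eq hν, h]
  congr 2
  module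

/-- A matrix acts on the quartic by the square of its determinant. Besides bilinearity this needs
that `Q(s ρ₁ + t ρ₂)` is null for all `s` and `t`. -/
theorem quartic_matAct (hν : ν ≠ 0) (A : Matrix (Fin 2) (Fin 2) ℝ)
    (ρ : EvenForm E5 × EvenForm E5) :
    quartic ν (matAct A ρ) = A.det ^ 2 * quartic ν ρ := by
  simp only [quartic, Qvec_eq hν, matAct, Matrix.det_fin_two]
  set q11 := Qpolar ν ρ.1 ρ.1
  set q12 := Qpolar ν ρ.1 ρ.2
  set q22 := Qpolar ν ρ.2 ρ.2
  have key : ∀ s t : ℝ, Qpolar ν (s • ρ.1 + t • ρ.2) (s • ρ.1 + t • ρ.2) =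
      s • (s • q11 + t • q12) + t • (s • q12 + t • q22) := fun s t => by
    rw [Qpolar_comb_left, Qpolar_comb_right, Qpolar_comb_right, Qpolar_comm ρ.2 ρ.1]
  have n : ∀ s t : ℝ, _ := fun s t => genInner_Qpolar_self hν (s • ρ.1 + t • ρ.2)
  simp only [key] at n ⊢
  have n1 := n 1 1
  have n2 := n 1 (-1)
  have n3 := n 1 2
  have n4 := n 1 0
  have n5 := n 0 1
  simp only [genInner, Prod.fst_add, Prod.snd_add, Prod.smul_fst, Prod.smul_snd, map_add, map_smul,
    add_apply, smul_apply, smul_eq_mul] at n1 n2 n3 n4 n5 ⊢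
  have m1 : q11.2 q11.1 = 0 := by linarith
  have m2 : q22.2 q22.1 = 0 := by linarith
  have m3 : q11.2 q12.1 + q12.2 q11.1 = 0 := by linarith
  have m4 : q22.2 q12.1 + q12.2 q22.1 = 0 := by linarith
  have m5 : 4 * q12.2 q12.1 + q11.2 q22.1 + q22.2 q11.1 = 0 := by linarith
  set a := A 0 0
  set b := A 0 1
  set c := A 1 0
  set d := A 1 1
  linear_combination a ^ 2 * c ^ 2 * m1 + b ^ 2 * d ^ 2 * m2 +
    (a ^ 2 * c * d + a * b * c ^ 2) * m3 + (a * b * d ^ 2 + b ^ 2 * c * d) * m4 +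
    a * b * c * d * m5

/-- `e^B` acts on `Q(ρ)` by the shear `X + ξ ↦ X + ξ - i_X B`. -/
theorem Qvec_expB (hν : ν ≠ 0) (B : E5 [⋀^Fin 2]→L[ℝ] ℝ) (ρ : EvenForm E5) :
    Qvec ν (expB B ρ) =
      ((Qvec ν ρ).1, (Qvec ν ρ).2 - covec (B.curryLeft (Qvec ν ρ).1)) := by
  obtain ⟨a, β, γ⟩ := ρ
  rw [Qvec_eq hν, Qvec_eq hν]
  have g : gvec ν (γ + wedge B β + (a ![] / 2) • wedge B B) =
      gvec ν γ + sqvec ν B β + (a ![] / 2) • sqvec ν B B :=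
    (gvec_add _ _).trans (congrArg₂ _ (gvec_add _ _) (gvec_smul _ _))
  refine Prod.ext ?_ ?_
  · change (2 * a ![]) • gvec ν (γ + wedge B β + (a ![] / 2) • wedge B B) +
      (2 * a ![]) • gvec ν (γ + wedge B β + (a ![] / 2) • wedge B B) -
      (2 : ℝ) • sqvec ν (β + a ![] • B) (β + a ![] • B) = _
    rw [g]
    simp only [Qpolar, sqvec_add_left, sqvec_add_right, sqvec_smul_left, sqvec_smul_right,
      sqvec_comm β B]
    module
  · have h1 := fun x => cyclic_contraction hν β β B x
    have h2 := fun x => cyclic_contraction hν β B B x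
    have h3 := fun x => cyclic_contraction hν B B B x
    ext x
    simp only [Qpolar, expB, g, smul_apply, add_apply, sub_apply, covec_apply,
      ContinuousAlternatingMap.curryLeft_apply_apply, smul_eq_mul]
    have h1 := h1 x
    have h2 := h2 x
    have h3 := h3 x
    rw [sqvec_comm β B] at h1 h2
    simp only [two_form_swap _ _ x, ContinuousAlternatingMap.add_apply,
      ContinuousAlternatingMap.smul_apply, smul_eq_mul, two_form_add_right,
      two_form_smul_right, two_form_sub_right]
    linear_combination 2 * h1 + 2 * a ![] * h2 + (2 / 3) * a ![] ^ 2 * h3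

theorem quartic_expB (hν : ν ≠ 0) (B : E5 [⋀^Fin 2]→L[ℝ] ℝ) (ρ : EvenForm E5 × EvenForm E5) :
    quartic ν (expB B ρ.1, expB B ρ.2) = quartic ν ρ := by
  simp only [quartic, Qvec_expB hν, genInner, sub_apply, covec_apply,
    ContinuousAlternatingMap.curryLeft_apply_apply]
  rw [two_form_swap B]
  ring

end Pointwise

/-! ### The dual odd forms -/

section Hat
variable {ν : E5 [⋀^Fin 5]→L[ℝ] ℝ}

theorem expB_comb (B : E5 [⋀^Fin 2]→L[ℝ] ℝ) (s t : ℝ) (ρ σ : EvenForm E5) :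
    expB B (s • ρ + t • σ) = s • expB B ρ + t • expB B σ := by
  refine Prod.ext rfl (Prod.ext ?_ ?_)
  · simp [expB]
    module
  · have e : wedge B (s • ρ.2.1 + t • σ.2.1) = s • wedge B ρ.2.1 + t • wedge B σ.2.1 := by
      rw [wedge_add_right, wedge_smul_right, wedge_smul_right]
    change (s • ρ.2.2 + t • σ.2.2) + wedge B (s • ρ.2.1 + t • σ.2.1) +
      ((s * ρ.1 ![] + t * σ.1 ![]) / 2) • wedge B B =
      s • (ρ.2.2 + wedge B ρ.2.1 + (ρ.1 ![] / 2) • wedge B B) +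
      t • (σ.2.2 + wedge B σ.2.1 + (σ.1 ![] / 2) • wedge B B)
    rw [e]
    module

/-- The action of a matrix and a two-form on pairs of even forms at a point. -/
def transformAt (A : Matrix (Fin 2) (Fin 2) ℝ) (B : E5 [⋀^Fin 2]→L[ℝ] ℝ)
    (ρ : EvenForm E5 × EvenForm E5) : EvenForm E5 × EvenForm E5 :=
  matAct A (expB B ρ.1, expB B ρ.2)

theorem quartic_transformAt (hν : ν ≠ 0) {A : Matrix (Fin 2) (Fin 2) ℝ} (hA : A.det = 1)
    (B : E5 [⋀^Fin 2]→L[ℝ] ℝ) (ρ : EvenForm E5 × EvenForm E5) :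
    quartic ν (transformAt A B ρ) = quartic ν ρ := by
  rw [transformAt, quartic_matAct hν, quartic_expB hν, hA, one_pow, one_mul]

/-- The even form of degrees two and four which `e^B` takes to `β + γ`. -/
def expBInv (B β : E5 [⋀^Fin 2]→L[ℝ] ℝ) (γ : E5 [⋀^Fin 4]→L[ℝ] ℝ) : EvenForm E5 :=
  (0, β, γ - wedge B β)

theorem expB_expBInv (B β : E5 [⋀^Fin 2]→L[ℝ] ℝ) (γ : E5 [⋀^Fin 4]→L[ℝ] ℝ) :
    expB B (expBInv B β γ) = (0, β, γ) := by
  refine Prod.ext rfl (Prod.ext ?_ ?_)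
  · simp [expB, expBInv]
  · have : (γ - wedge B β) + wedge B β + ((0 : ℝ) / 2) • wedge B B = γ := by module
    exact this

/-- The line in the space of pairs along which the first component of the transform varies by a
multiple of `β + γ` and the second one is constant. -/
theorem transformAt_add_fst {A : Matrix (Fin 2) (Fin 2) ℝ} (hA : A.det = 1)
    (B β : E5 [⋀^Fin 2]→L[ℝ] ℝ) (γ : E5 [⋀^Fin 4]→L[ℝ] ℝ) (ρ : EvenForm E5 × EvenForm E5)
    (t : ℝ) :
    transformAt A B (ρ + t • (A 1 1 • expBInv B β γ, -A 1 0 • expBInv B β γ)) =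
      transformAt A B ρ + t • ((0, β, γ), 0) := by
  rw [Matrix.det_fin_two] at hA
  have e : ∀ (ρ : EvenForm E5) (c : ℝ), expB B (ρ + t • c • expBInv B β γ) =
      expB B ρ + (t * c) • (0, β, γ) := fun ρ c => by
    have := expB_comb B 1 (t * c) ρ (expBInv B β γ)
    rwa [one_smul, one_smul, mul_smul, expB_expBInv] at this
  simp only [transformAt, matAct, Prod.fst_add, Prod.snd_add, Prod.smul_fst, Prod.smul_snd, e]
  refine Prod.ext ?_ ?_
  · change _ = (A 0 0 • expB B ρ.1 + A 0 1 • expB B ρ.2) + t • (0, β, γ)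
    match_scalars <;> first | ring1 | linear_combination t * hA
  · change _ = (A 1 0 • expB B ρ.1 + A 1 1 • expB B ρ.2) + t • (0 : EvenForm E5)
    module

/-- The line in the space of pairs along which the second component of the transform varies by a
multiple of `β + γ` and the first one is constant. -/
theorem transformAt_add_snd {A : Matrix (Fin 2) (Fin 2) ℝ} (hA : A.det = 1)
    (B β : E5 [⋀^Fin 2]→L[ℝ] ℝ) (γ : E5 [⋀^Fin 4]→L[ℝ] ℝ) (ρ : EvenForm E5 × EvenForm E5)
    (t : ℝ) :
    transformAt A B (ρ + t • (-A 0 1 • expBInv B β γ, A 0 0 • expBInv B β γ)) =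
      transformAt A B ρ + t • (0, (0, β, γ)) := by
  rw [Matrix.det_fin_two] at hA
  have e : ∀ (ρ : EvenForm E5) (c : ℝ), expB B (ρ + t • c • expBInv B β γ) =
      expB B ρ + (t * c) • (0, β, γ) := fun ρ c => by
    have := expB_comb B 1 (t * c) ρ (expBInv B β γ)
    rwa [one_smul, one_smul, mul_smul, expB_expBInv] at this
  simp only [transformAt, matAct, Prod.fst_add, Prod.snd_add, Prod.smul_fst, Prod.smul_snd, e]
  refine Prod.ext ?_ ?_
  · change _ = (A 0 0 • expB B ρ.1 + A 0 1 • expB B ρ.2) + t • (0 : EvenForm E5)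
    module
  · change _ = (A 1 0 • expB B ρ.1 + A 1 1 • expB B ρ.2) + t • (0, β, γ)
    match_scalars <;> first | ring1 | linear_combination t * hA

/-- The quartic on pairs of the shape `(Ω + γ₁, 1 + γ₂)`. -/
theorem quartic_normalized (hν : ν ≠ 0) (Ω : E5 [⋀^Fin 2]→L[ℝ] ℝ)
    (γ₁ γ₂ : E5 [⋀^Fin 4]→L[ℝ] ℝ) :
    quartic ν ((0, Ω, γ₁), (zeroForm 1, 0, γ₂)) = -8 * Ω ![gvec ν γ₁, gvec ν γ₂] := by
  rw [quartic, Qvec_eq hν, Qvec_eq hν]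
  have h0 : sqvec ν 0 0 = 0 := by
    have := sqvec_smul_left (ν := ν) 0 0 0
    simpa using this
  have h1 : covec ((0 : E5 [⋀^Fin 2]→L[ℝ] ℝ).curryLeft (gvec ν γ₂)) = 0 := by
    ext; simp [covec_apply]
  simp only [Qpolar, genInner, h0, h1, zeroForm_apply, smul_apply, add_apply,
    covec_curryLeft_apply, smul_zero, sub_zero,
    two_form_add_right, two_form_smul_right, smul_eq_mul, add_zero, zero_apply]
  ring

/-- The derivative of the volume along a line on which the quartic is an affine function, starting
from the value `q = ± 1`. -/
theorem volOf_hasDerivAt {ρ σ : EvenForm E5 × EvenForm E5} {q δ : ℝ} (hq : |q| = 1)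
    (h : ∀ t : ℝ, quartic ν (ρ + t • σ) = q + t * δ) :
    HasDerivAt (fun t : ℝ => volOf ν (ρ + t • σ)) ((q * δ / 2) • ν) 0 := by
  have hq2 : q * q = 1 := by rw [← abs_mul_abs_self, hq, one_mul]
  have h1 : HasDerivAt (fun t : ℝ => √(1 + t * (q * δ))) (q * δ / 2) 0 := by
    have := (((hasDerivAt_id (0 : ℝ)).mul_const (q * δ)).const_add 1).sqrt (by simp)
    simpa using this
  have h2 : (fun t : ℝ => √(1 + t * (q * δ)) • ν) =ᶠ[nhds 0] fun t => volOf ν (ρ + t • σ) := by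
    have h3 : ∀ᶠ t : ℝ in nhds 0, 0 < 1 + t * (q * δ) := by
      apply ContinuousAt.eventually_lt (by fun_prop) (by fun_prop)
      simp
    filter_upwards [h3] with t ht
    have : |q + t * δ| = 1 + t * (q * δ) := by
      have e : 1 + t * (q * δ) = q * (q + t * δ) := by linear_combination -hq2
      rw [← abs_of_pos ht, e, abs_mul, hq, one_mul]
    rw [volOf, h, this]
  exact (h1.smul_const ν).congr_of_eventuallyEq h2.symm

theorem mukai_smul_expBInv (ψ : OddForm E5) (B β : E5 [⋀^Fin 2]→L[ℝ] ℝ)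
    (γ : E5 [⋀^Fin 4]→L[ℝ] ℝ) (c : ℝ) :
    mukai ψ (c • expBInv B β γ) = c • (wedge ψ.1 γ - wedge (ψ.2.1 + wedge ψ.1 B) β) := by
  have e : mukai ψ (c • expBInv B β γ) = wedge ψ.1 (c • (γ - wedge B β)) -
    wedge ψ.2.1 (c • β) + wedge ψ.2.2 (c • (0 : E5 [⋀^Fin 0]→L[ℝ] ℝ)) := rfl
  rw [e, wedge_smul_right, wedge_smul_right, wedge_smul_right, wedge_zero_form_right,
    wedge_sub_right, wedge_add_left, wedge_assoc_one_two_two]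
  module

theorem one_form_ext {α β : E5 [⋀^Fin 1]→L[ℝ] ℝ} (h : ∀ x, α ![x] = β ![x]) : α = β := by
  rw [← oneForm_covec α, ← oneForm_covec β]
  congr 1
  ext x
  rw [covec_apply, covec_apply, h]

/-- The components of degrees one and three of the dual of a pair whose transform has the normalised
shape, with `Gᵢ` the vector of `γᵢ`: the one-forms are constant multiples of the contractions of `Ω`
with `G₂` and `G₁`, and the three-form `χ` satisfies `χ ∧ β = 4 q β(G₁, G₂) ν` for all two-forms
`β`. -/
theorem hat_relations (hν : ν ≠ 0) {A : Matrix (Fin 2) (Fin 2) ℝ} (hA : A.det = 1)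
    {B : E5 [⋀^Fin 2]→L[ℝ] ℝ} {ρ : EvenForm E5 × EvenForm E5} {ρ' : OddForm E5 × OddForm E5}
    (hvol : volOf ν ρ = ν) (hhat : IsHat ν ρ ρ') {Ω : E5 [⋀^Fin 2]→L[ℝ] ℝ}
    {γ₁ γ₂ : E5 [⋀^Fin 4]→L[ℝ] ℝ} (hT : transformAt A B ρ = ((0, Ω, γ₁), (zeroForm 1, 0, γ₂))) :
    |quartic ν ρ| = 1 ∧ quartic ν ρ = -8 * Ω ![gvec ν γ₁, gvec ν γ₂] ∧
    A 1 1 • ρ'.1.1 - A 1 0 • ρ'.2.1 = (4 * quartic ν ρ) • Ω.curryLeft (gvec ν γ₂) ∧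
    A 0 0 • ρ'.2.1 - A 0 1 • ρ'.1.1 = (-4 * quartic ν ρ) • Ω.curryLeft (gvec ν γ₁) ∧
    ∀ β : E5 [⋀^Fin 2]→L[ℝ] ℝ,
      wedge (A 1 1 • ρ'.1.2.1 - A 1 0 • ρ'.2.2.1 + wedge (A 1 1 • ρ'.1.1 - A 1 0 • ρ'.2.1) B) β =
        (4 * quartic ν ρ * β ![gvec ν γ₁, gvec ν γ₂]) • ν := by
  set q := quartic ν ρ with hq_def
  have hq : |q| = 1 := by
    have h1 : √|q| = 1 := smul_left_injective ℝ hν (by simpa [volOf] using hvol)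
    rwa [Real.sqrt_eq_one] at h1
  have hqv : q = -8 * Ω ![gvec ν γ₁, gvec ν γ₂] := by
    rw [hq_def, ← quartic_transformAt hν hA B, hT, quartic_normalized hν]
  -- the derivative of the volume along lines on which the quartic is affine
  have key : ∀ (σ : EvenForm E5 × EvenForm E5) (δ : ℝ),
      (∀ t : ℝ, quartic ν (ρ + t • σ) = q + t * δ) →
      mukai ρ'.1 σ.1 + mukai ρ'.2 σ.2 = (q * δ / 2) • ν := fun σ δ h =>
    (hhat σ).unique (volOf_hasDerivAt hq h)
  -- varying `γ₁`, then `γ₂`, then `Ω`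
  have four₁ : ∀ γ : E5 [⋀^Fin 4]→L[ℝ] ℝ, wedge (A 1 1 • ρ'.1.1 - A 1 0 • ρ'.2.1) γ =
      (-4 * q * Ω ![gvec ν γ, gvec ν γ₂]) • ν := fun γ => by
    have h := key _ (-8 * Ω ![gvec ν γ, gvec ν γ₂]) fun t => by
      rw [← quartic_transformAt hν hA B, transformAt_add_fst hA B 0 γ, hT]
      have := quartic_normalized hν Ω (γ₁ + t • γ) γ₂
      rw [gvec_add, gvec_smul, two_form_swap, two_form_add_right, two_form_smul_right,
        two_form_swap Ω _ (gvec ν γ₁), two_form_swap Ω _ (gvec ν γ)] at this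
      simp only [Prod.mk_add_mk, Prod.smul_mk, smul_zero, add_zero, this, hqv]
      ring
    rw [mukai_smul_expBInv, mukai_smul_expBInv] at h
    simp only [wedge_zero_form_right, sub_zero] at h
    rw [wedge_sub_left, wedge_smul_left, wedge_smul_left]
    refine Eq.trans ?_ (h.trans ?_)
    · module
    · congr 1
      ring
  have four₂ : ∀ γ : E5 [⋀^Fin 4]→L[ℝ] ℝ, wedge (A 0 0 • ρ'.2.1 - A 0 1 • ρ'.1.1) γ =
      (-4 * q * Ω ![gvec ν γ₁, gvec ν γ]) • ν := fun γ => by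
    have h := key _ (-8 * Ω ![gvec ν γ₁, gvec ν γ]) fun t => by
      rw [← quartic_transformAt hν hA B, transformAt_add_snd hA B 0 γ, hT]
      have := quartic_normalized hν Ω γ₁ (γ₂ + t • γ)
      rw [gvec_add, gvec_smul, two_form_add_right, two_form_smul_right] at this
      simp only [Prod.mk_add_mk, Prod.smul_mk, smul_zero, add_zero, this, hqv]
      ring
    rw [mukai_smul_expBInv, mukai_smul_expBInv] at h
    simp only [wedge_zero_form_right, sub_zero] at h
    rw [wedge_sub_left, wedge_smul_left, wedge_smul_left]
    refine Eq.trans ?_ (h.trans ?_)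
    · module
    · congr 1
      ring
  have two₁ : ∀ β : E5 [⋀^Fin 2]→L[ℝ] ℝ,
      wedge (A 1 1 • ρ'.1.2.1 - A 1 0 • ρ'.2.2.1 + wedge (A 1 1 • ρ'.1.1 - A 1 0 • ρ'.2.1) B) β =
        (4 * q * β ![gvec ν γ₁, gvec ν γ₂]) • ν := fun β => by
    have h := key _ (-8 * β ![gvec ν γ₁, gvec ν γ₂]) fun t => by
      rw [← quartic_transformAt hν hA B, transformAt_add_fst hA B β 0, hT]
      have := quartic_normalized hν (Ω + t • β) γ₁ γ₂
      rw [ContinuousAlternatingMap.add_apply, ContinuousAlternatingMap.smul_apply] at this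
      simp only [Prod.mk_add_mk, Prod.smul_mk, smul_zero, add_zero, this, hqv, smul_eq_mul]
      ring
    rw [mukai_smul_expBInv, mukai_smul_expBInv] at h
    simp only [wedge_zero_form_right, zero_sub] at h
    have e : ∀ (a b : ℝ) (χ χ' : E5 [⋀^Fin 3]→L[ℝ] ℝ) (θ θ' : E5 [⋀^Fin 1]→L[ℝ] ℝ),
        wedge (a • χ - b • χ' + wedge (a • θ - b • θ') B) β =
          a • wedge (χ + wedge θ B) β - b • wedge (χ' + wedge θ' B) β := fun a b χ χ' θ θ' => by
      have e1 : a • χ - b • χ' + wedge (a • θ - b • θ') B =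
          a • (χ + wedge θ B) - b • (χ' + wedge θ' B) := by
        rw [wedge_sub_left, wedge_smul_left, wedge_smul_left]
        module
      rw [e1, wedge_sub_left, wedge_smul_left, wedge_smul_left]
    rw [e]
    refine Eq.trans ?_ ((congrArg Neg.neg h).trans ?_)
    · module
    · module
  -- every vector is the vector of a four-form, so that the identities determine the one-forms
  have vec : ∀ (α : E5 [⋀^Fin 1]→L[ℝ] ℝ) (x : E5), wedge α (ν.curryLeft x) = α ![x] • ν :=
    fun α x => by rw [wedge_one_four hν, gvec_curryLeft hν]
  refine ⟨hq, hqv, ?_, ?_, two₁⟩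
  · refine one_form_ext fun x => smul_left_injective ℝ hν ?_
    change _ • ν = _ • ν
    rw [← vec, four₁, gvec_curryLeft hν, two_form_swap]
    congr 1
    simp [ContinuousAlternatingMap.curryLeft_apply_apply]
  · refine one_form_ext fun x => smul_left_injective ℝ hν ?_
    change _ • ν = _ • ν
    rw [← vec, four₂, gvec_curryLeft hν]
    congr 1

end Hat

/-! ### The reduced two-form and the three-form -/

section Chi
variable {ν : E5 [⋀^Fin 5]→L[ℝ] ℝ}

theorem two_form_eq_zero_of_wedge_three {β : E5 [⋀^Fin 2]→L[ℝ] ℝ}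
    (h : ∀ κ : E5 [⋀^Fin 3]→L[ℝ] ℝ, wedge β κ = 0) : β = 0 := by
  refine eq_zero_of_oneForm_wedge (by norm_num) _ fun ζ => ?_
  refine eq_zero_of_oneForm_wedge (k := 2) (by norm_num) _ fun η => ?_
  refine eq_zero_of_oneForm_wedge (k := 3) (by norm_num) _ fun ξ => ?_
  have := h (wedge (oneForm ξ) (wedge (oneForm η) (oneForm ζ)))
  rwa [wedge_comm_two_three, wedge_assoc_one_two_two, wedge_assoc_one_one_two] at this

/-- The two-form `Ω - Ω(G₁, G₂)⁻¹ θ₁ ∧ θ₂`, where `θᵢ` is the contraction of `Ω` with `Gᵢ` and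
`Ω(G₁, G₂) = -q / 8` with `q = ± 1`. -/
def reduced (q : ℝ) (Ω : E5 [⋀^Fin 2]→L[ℝ] ℝ) (x y : E5) : E5 [⋀^Fin 2]→L[ℝ] ℝ :=
  Ω + (8 * q) • wedge (Ω.curryLeft x) (Ω.curryLeft y)

theorem curryLeft_wedge_one_one (α β : E5 [⋀^Fin 1]→L[ℝ] ℝ) (x : E5) :
    @Eq (E5 [⋀^Fin 1]→L[ℝ] ℝ) ((wedge α β).curryLeft x) (α ![x] • β - β ![x] • α) := by
  rw [curryLeft_wedge_one, wedge_zero_left, wedge_one_zero,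
    ContinuousAlternatingMap.curryLeft_apply_apply, ContinuousAlternatingMap.curryLeft_apply_apply]

theorem reduced_curryLeft (q : ℝ) (Ω : E5 [⋀^Fin 2]→L[ℝ] ℝ) (x y z : E5) :
    (reduced q Ω x y).curryLeft z =
      Ω.curryLeft z + (8 * q) • (Ω ![x, z] • Ω.curryLeft y - Ω ![y, z] • Ω.curryLeft x) := by
  have e : (reduced q Ω x y).curryLeft z = Ω.curryLeft z +
    (8 * q) • (wedge (Ω.curryLeft x) (Ω.curryLeft y)).curryLeft z := rfl
  rw [e, curryLeft_wedge_one_one, ContinuousAlternatingMap.curryLeft_apply_apply,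
    ContinuousAlternatingMap.curryLeft_apply_apply]

theorem reduced_curryLeft_left {q : ℝ} (hq : q * q = 1) {Ω : E5 [⋀^Fin 2]→L[ℝ] ℝ} {x y : E5}
    (h : q = -8 * Ω ![x, y]) : (reduced q Ω x y).curryLeft x = 0 := by
  rw [reduced_curryLeft, two_form_self, two_form_swap Ω y x]
  match_scalars
  · linear_combination q * h - hq
  · ring

theorem reduced_curryLeft_right {q : ℝ} (hq : q * q = 1) {Ω : E5 [⋀^Fin 2]→L[ℝ] ℝ} {x y : E5}
    (h : q = -8 * Ω ![x, y]) : (reduced q Ω x y).curryLeft y = 0 := by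
  rw [reduced_curryLeft, two_form_self]
  match_scalars
  · linear_combination q * h - hq
  · ring

/-- The vector of `Ω ∧ Ω` is in the kernel of `Ω`. -/
theorem sqvec_contract (hν : ν ≠ 0) (Ω : E5 [⋀^Fin 2]→L[ℝ] ℝ) (x : E5) :
    Ω ![x, sqvec ν Ω Ω] = 0 := by
  have := cyclic_contraction hν Ω Ω Ω x
  linarith

theorem curryLeft_sqvec (hν : ν ≠ 0) (Ω : E5 [⋀^Fin 2]→L[ℝ] ℝ) :
    Ω.curryLeft (sqvec ν Ω Ω) = 0 := by
  refine one_form_ext fun x => ?_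
  rw [ContinuousAlternatingMap.curryLeft_apply_apply]
  change Ω ![_, x] = 0
  rw [two_form_swap, sqvec_contract hν, neg_zero]

/-- Contracting `Ω ∧ Ω` with `y` and then with `x`, where `Ω(x, y) = -q / 8`. -/
theorem curryLeft_curryLeft_wedge_self {q : ℝ} (hq : q * q = 1) {Ω : E5 [⋀^Fin 2]→L[ℝ] ℝ}
    {x y : E5} (h : q = -8 * Ω ![x, y]) :
    @Eq (E5 [⋀^Fin 2]→L[ℝ] ℝ) ((wedge (Ω.curryLeft y) Ω).curryLeft x)
      ((q / 8) • reduced q Ω x y) := by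
  have e1 : wedge (Ω.curryLeft y) (Ω.curryLeft x) = -wedge (Ω.curryLeft x) (Ω.curryLeft y) :=
    wedge_comm_one_one _ _
  have e2 : Ω ![y, x] = q / 8 := by rw [two_form_swap]; linarith
  rw [curryLeft_wedge_one, wedge_zero_left, ContinuousAlternatingMap.curryLeft_apply_apply,
    ContinuousAlternatingMap.curryLeft_apply_apply]
  have e3 : Matrix.vecCons y (Matrix.vecCons x ![]) = ![y, x] := rfl
  change Ω ![y, x] • Ω - wedge (Ω.curryLeft y) (Ω.curryLeft x) =
    (q / 8) • (Ω + (8 * q) • wedge (Ω.curryLeft x) (Ω.curryLeft y))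
  rw [e1, e2]
  match_scalars
  · ring
  · linear_combination -hq

theorem curryLeft_wedge_self (Ω : E5 [⋀^Fin 2]→L[ℝ] ℝ) (x : E5) :
    @Eq (E5 [⋀^Fin 3]→L[ℝ] ℝ) ((wedge Ω Ω).curryLeft x)
      ((2 : ℝ) • wedge (Ω.curryLeft x) Ω) := by
  have e : wedge Ω (Ω.curryLeft x) = wedge (Ω.curryLeft x) Ω := (wedge_comm_one_two _ _).symm
  rw [curryLeft_wedge_two, e]
  exact (two_smul ℝ (wedge (Ω.curryLeft x) Ω)).symm

/-- The hypothesis on `χ`, which also appears in the lemmas below, says that `χ` is a multiple of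
the contraction of `ν` with `x` and `y`. -/
theorem chi_curryLeft {χ : E5 [⋀^Fin 3]→L[ℝ] ℝ} {q : ℝ} {x y : E5}
    (hχ : ∀ β : E5 [⋀^Fin 2]→L[ℝ] ℝ, wedge χ β = (4 * q * β ![x, y]) • ν) (z : E5)
    (κ : E5 [⋀^Fin 3]→L[ℝ] ℝ) :
    wedge (χ.curryLeft z) κ = (4 * q * κ ![z, x, y]) • ν := by
  rw [curryLeft_three_wedge_three finrank_E5, hχ]
  rfl

theorem chi_curryLeft_left {χ : E5 [⋀^Fin 3]→L[ℝ] ℝ} {q : ℝ} {x y : E5}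
    (hχ : ∀ β : E5 [⋀^Fin 2]→L[ℝ] ℝ, wedge χ β = (4 * q * β ![x, y]) • ν) :
    χ.curryLeft x = 0 := by
  refine two_form_eq_zero_of_wedge_three fun κ => ?_
  rw [chi_curryLeft hχ, κ.map_eq_zero_of_eq ![x, x, y] (i := 0) (j := 1) rfl (by decide)]
  simp

theorem chi_curryLeft_right {χ : E5 [⋀^Fin 3]→L[ℝ] ℝ} {q : ℝ} {x y : E5}
    (hχ : ∀ β : E5 [⋀^Fin 2]→L[ℝ] ℝ, wedge χ β = (4 * q * β ![x, y]) • ν) :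
    χ.curryLeft y = 0 := by
  refine two_form_eq_zero_of_wedge_three fun κ => ?_
  rw [chi_curryLeft hχ, κ.map_eq_zero_of_eq ![y, x, y] (i := 0) (j := 2) rfl (by decide)]
  simp

/-- The contraction of `χ` with the vector of `Ω ∧ Ω` is the reduced two-form: both have the same
product with any three-form, as is seen by contracting `Ω ∧ Ω` with `y` and `x`. -/
theorem chi_curryLeft_sqvec (hν : ν ≠ 0) {χ : E5 [⋀^Fin 3]→L[ℝ] ℝ} {q : ℝ} {x y : E5}
    (hχ : ∀ β : E5 [⋀^Fin 2]→L[ℝ] ℝ, wedge χ β = (4 * q * β ![x, y]) • ν)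
    (hq : q * q = 1) {Ω : E5 [⋀^Fin 2]→L[ℝ] ℝ} (h : q = -8 * Ω ![x, y]) :
    χ.curryLeft (sqvec ν Ω Ω) = -reduced q Ω x y := by
  refine sub_eq_zero.mp (two_form_eq_zero_of_wedge_three fun κ => ?_)
  rw [wedge_sub_left, chi_curryLeft hχ, wedge_neg_left]
  have s1 : κ ![sqvec ν Ω Ω, x, y] = -κ ![x, sqvec ν Ω Ω, y] :=
    congrArg (fun η => η ![y]) (curryLeft_curryLeft_swap κ (sqvec ν Ω Ω) x)
  have s2 : κ ![x, sqvec ν Ω Ω, y] = -κ ![x, y, sqvec ν Ω Ω] :=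
    two_form_swap (κ.curryLeft x) (sqvec ν Ω Ω) y
  have s3 : κ ![x, y, sqvec ν Ω Ω] • ν = wedge ((κ.curryLeft x).curryLeft y) (wedge Ω Ω) := by
    rw [wedge_one_four hν]
    rfl
  have s4 : wedge ((κ.curryLeft x).curryLeft y) (wedge Ω Ω) =
      (-(q / 4)) • wedge (reduced q Ω x y) κ := by
    have t1 := curryLeft_four_wedge_two finrank_E5 (wedge Ω Ω) (κ.curryLeft x) y
    have t2 : wedge (wedge (Ω.curryLeft y) Ω) (κ.curryLeft x) =
        wedge (κ.curryLeft x) (wedge (Ω.curryLeft y) Ω) := (wedge_comm_two_three _ _).symm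
    rw [curryLeft_wedge_self, wedge_smul_left, t2, curryLeft_three_wedge_three finrank_E5,
      curryLeft_curryLeft_wedge_self hq h, wedge_smul_right, ← wedge_comm_two_three] at t1
    rw [← neg_neg (wedge ((κ.curryLeft x).curryLeft y) (wedge Ω Ω)), ← t1]
    module
  rw [s1, s2, neg_neg, mul_smul, s3, s4]
  match_scalars
  linear_combination -hq

/-- A vector annihilated by `Ω` and by `χ` vanishes: the kernel of `χ` is the plane spanned by `x`
and `y`, on which `Ω` is nondegenerate. -/
theorem eq_zero_of_contractions (hν : ν ≠ 0) {χ : E5 [⋀^Fin 3]→L[ℝ] ℝ} {q : ℝ} {x y : E5}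
    (hχ : ∀ β : E5 [⋀^Fin 2]→L[ℝ] ℝ, wedge χ β = (4 * q * β ![x, y]) • ν)
    (hq : q * q = 1) {Ω : E5 [⋀^Fin 2]→L[ℝ] ℝ} (h : q = -8 * Ω ![x, y]) {z : E5}
    (h1 : Ω.curryLeft z = 0) (h2 : χ.curryLeft z = 0) : z = 0 := by
  refine eq_of_forall_covec fun ξ => ?_
  have h3 := chi_curryLeft hχ z (wedge (oneForm ξ) Ω)
  have e1 : ∀ w, Ω ![z, w] = 0 := fun w => congrArg (fun η => η ![w]) h1
  have e2 : (wedge (oneForm ξ) Ω) ![z, x, y] = ξ z * Ω ![x, y] := by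
    have := congrArg (fun η => η ![x, y]) (curryLeft_wedge_one (oneForm ξ) Ω z)
    rw [h1, wedge_zero_form_right, sub_zero, wedge_zero_left, curryLeft_oneForm_apply] at this
    exact this
  rw [h2, wedge_zero_form_left, e2] at h3
  have h4 := (smul_eq_zero.mp h3.symm).resolve_right hν
  rw [map_zero]
  linear_combination -2 * h4 + q * ξ z * h - ξ z * hq

/-- If the reduced form vanishes then `Ω` is decomposable and has rank at most two. -/
theorem reduced_ne_zero {Ω : E5 [⋀^Fin 2]→L[ℝ] ℝ} (h4 : rankTwoForm Ω = 4) (q : ℝ) (x y : E5) :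
    reduced q Ω x y ≠ 0 := by
  classical
  intro h0
  have h1 : LinearMap.range (Ω.curryLeft : E5 →ₗ[ℝ] E5 [⋀^Fin 1]→L[ℝ] ℝ) ≤
      Submodule.span ℝ ({Ω.curryLeft x, Ω.curryLeft y} : Finset (E5 [⋀^Fin 1]→L[ℝ] ℝ)) := by
    rintro _ ⟨z, rfl⟩
    have := reduced_curryLeft q Ω x y z
    rw [h0] at this
    have e : Ω.curryLeft z = (8 * q * Ω ![y, z]) • Ω.curryLeft x -
        (8 * q * Ω ![x, z]) • Ω.curryLeft y := by
      have t : Ω.curryLeft z =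
          -((8 * q) • (Ω ![x, z] • Ω.curryLeft y - Ω ![y, z] • Ω.curryLeft x)) :=
        eq_neg_of_add_eq_zero_left this.symm
      rw [t]
      module
    change Ω.curryLeft z ∈ _
    rw [e]
    refine Submodule.sub_mem _ (Submodule.smul_mem _ _ (Submodule.subset_span (by simp)))
      (Submodule.smul_mem _ _ (Submodule.subset_span (by simp)))
  have h2 := (Submodule.finrank_mono h1).trans (finrank_span_finset_le_card _)
  rw [rankTwoForm] at h4
  rw [h4] at h2
  have := h2.trans Finset.card_le_two
  omega

end Chi

/-! ### Path spaces -/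

section Nemytskii
open Set Topology
-- a single universe, as the induction for smoothness replaces `F` by spaces of maps from `E` to `F`
universe u

/-- The closed unit interval, on which paths are parametrized. -/
abbrev PathDom : Type := Icc (0 : ℝ) 1

/-- Composition of paths with a fixed map. -/
def pathComp {X Y : Type*} [TopologicalSpace X] [TopologicalSpace Y] (f : C(X, Y))
    (γ : C(PathDom, X)) : C(PathDom, Y) := f.comp γ

variable {E F : Type u} [NormedAddCommGroup E] [NormedSpace ℝ E]
  [NormedAddCommGroup F] [NormedSpace ℝ F]

/-- Pointwise evaluation of a path of linear maps on a path of vectors. -/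
def pathEval : C(PathDom, E →L[ℝ] F) →L[ℝ] C(PathDom, E) →L[ℝ] C(PathDom, F) :=
  LinearMap.mkContinuous₂
    (LinearMap.mk₂ ℝ (fun (A : C(PathDom, E →L[ℝ] F)) (h : C(PathDom, E)) =>
        (⟨fun t => A t (h t), A.continuous.clm_apply h.continuous⟩ : C(PathDom, F)))
      (fun _ _ _ => by ext; simp) (fun _ _ _ => by ext; simp)
      (fun _ _ _ => by ext; simp) (fun _ _ _ => by ext; simp)) 1
    (fun A h => by
      rw [one_mul]
      refine (ContinuousMap.norm_le _ (by positivity)).mpr fun t => ?_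
      exact ((A t).le_opNorm _).trans
        (mul_le_mul (A.norm_coe_le_norm t) (h.norm_coe_le_norm t) (norm_nonneg _) (by positivity)))

/-- Composition with a `C¹` map is differentiable on paths: the derivative of the map is uniformly
continuous along the compact image of a path. -/
theorem hasFDerivAt_pathComp (f : C(E, F)) (f' : C(E, E →L[ℝ] F))
    (hf : ∀ x, HasFDerivAt f (f' x) x) (γ : C(PathDom, E)) :
    HasFDerivAt (pathComp f) (pathEval (pathComp f' γ)) γ := by
  rw [hasFDerivAt_iff_isLittleO_nhds_zero, Asymptotics.isLittleO_iff]
  intro c hc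
  have h1 := (isCompact_range γ.continuous).uniformContinuousAt_of_continuousAt f'
    (fun a _ => f'.continuous.continuousAt) (Metric.dist_mem_uniformity hc)
  obtain ⟨δ, hδ, h2⟩ := Metric.mem_uniformity_dist.mp h1
  filter_upwards [Metric.ball_mem_nhds (0 : C(PathDom, E)) hδ] with h hh
  rw [mem_ball_zero_iff] at hh
  refine (ContinuousMap.norm_le _ (by positivity)).mpr fun t => ?_
  have h3 : ∀ y ∈ Metric.ball (γ t) δ, ‖f' y - f' (γ t)‖ ≤ c := fun y hy => by
    have := h2 (a := γ t) (b := y) (by rwa [dist_comm]) (mem_range_self t)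
    rw [← dist_eq_norm, dist_comm]
    exact le_of_lt this
  have h4 := (convex_ball (γ t) δ).norm_image_sub_le_of_norm_hasFDerivWithin_le'
    (f := f) (φ := f' (γ t)) (x := γ t) (y := γ t + h t)
    (fun x _ => (hf x).hasFDerivWithinAt) h3 (Metric.mem_ball_self hδ)
    (by simpa using (h.norm_coe_le_norm t).trans_lt hh)
  simp only [add_sub_cancel_left] at h4
  exact h4.trans (mul_le_mul_of_nonneg_left (h.norm_coe_le_norm t) hc.le)

/-- Composition of paths with a map of class `C^n` is a map of class `C^n`. The derivative is again
given by composition, with the derivative of the map, which makes an induction on `n` possible. -/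
theorem contDiff_pathComp_nat (n : ℕ) : ∀ {F : Type u} [NormedAddCommGroup F] [NormedSpace ℝ F]
    (f : C(E, F)), ContDiff ℝ n f → ContDiff ℝ n (pathComp f) := by
  induction n with
  | zero =>
    intro F _ _ f _
    exact contDiff_zero.mpr (f.continuous_postcomp)
  | succ n ih =>
    intro F _ _ f hf
    rw [Nat.cast_add, Nat.cast_one] at hf ⊢
    have hf' := (contDiff_succ_iff_fderiv.mp hf).2.2
    let f' : C(E, E →L[ℝ] F) := ⟨fderiv ℝ f, hf'.continuous⟩
    have h1 : ∀ γ, HasFDerivAt (pathComp f) (pathEval (pathComp f' γ)) γ :=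
      hasFDerivAt_pathComp f f' fun x =>
        ((contDiff_succ_iff_fderiv.mp hf).1 x).hasFDerivAt
    rw [contDiff_succ_iff_fderiv]
    refine ⟨fun γ => (h1 γ).differentiableAt, by simp, ?_⟩
    have h2 : fderiv ℝ (pathComp f) = fun γ => pathEval (pathComp f' γ) :=
      funext fun γ => (h1 γ).fderiv
    rw [h2]
    exact (ContinuousLinearMap.contDiff (E := C(PathDom, E →L[ℝ] F))
      (F := C(PathDom, E) →L[ℝ] C(PathDom, F)) pathEval).comp (ih f' hf')

theorem contDiff_pathComp (f : C(E, F)) (hf : ContDiff ℝ ∞ f) : ContDiff ℝ ∞ (pathComp f) :=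
  contDiff_infty.mpr fun n => contDiff_pathComp_nat n f (contDiff_infty.mp hf n)

/-- The primitive of a path which vanishes at the initial point. -/
def pathIntegral : C(PathDom, E) →L[ℝ] C(PathDom, E) :=
  LinearMap.mkContinuous
    { toFun := fun γ => ⟨fun t => ∫ s in (0 : ℝ)..t, IccExtend zero_le_one γ s, by
        have : Continuous fun t : ℝ => ∫ s in (0 : ℝ)..t, IccExtend zero_le_one γ s :=
          intervalIntegral.continuous_primitive
            (fun a b => (γ.continuous.Icc_extend' ).intervalIntegrable a b) 0
        exact this.comp continuous_subtype_val⟩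
      map_add' := fun γ δ => by
        ext t
        have e : IccExtend zero_le_one (γ + δ) =
          fun s => IccExtend zero_le_one γ s + IccExtend zero_le_one δ s := rfl
        simp only [ContinuousMap.coe_mk, ContinuousMap.add_apply, e]
        exact intervalIntegral.integral_add (γ.continuous.Icc_extend'.intervalIntegrable _ _)
          (δ.continuous.Icc_extend'.intervalIntegrable _ _)
      map_smul' := fun c γ => by
        ext t
        have e : IccExtend zero_le_one (c • γ) = fun s => c • IccExtend zero_le_one γ s := rfl
        simp only [ContinuousMap.coe_mk, ContinuousMap.smul_apply, e, RingHom.id_apply]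
        exact intervalIntegral.integral_smul _ _ } 1
    (fun γ => by
      rw [one_mul]
      refine (ContinuousMap.norm_le _ (by positivity)).mpr fun t => ?_
      refine (intervalIntegral.norm_integral_le_of_norm_le_const (C := ‖γ‖)
        fun s _ => γ.norm_coe_le_norm _).trans ?_
      have : |(t : ℝ) - 0| ≤ 1 := by rw [sub_zero, abs_of_nonneg t.2.1]; exact t.2.2
      simpa using mul_le_mul_of_nonneg_left this (norm_nonneg γ))

theorem pathIntegral_apply (γ : C(PathDom, E)) (t : PathDom) :
    pathIntegral γ t = ∫ s in (0 : ℝ)..t, IccExtend zero_le_one γ s := rfl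

end Nemytskii

/-! ### The smooth inverse function theorem -/

section InverseFunction
variable {E F : Type*} [NormedAddCommGroup E] [NormedSpace ℝ E] [CompleteSpace E]
  [NormedAddCommGroup F] [NormedSpace ℝ F]

/-- The smooth inverse function theorem, with control of the derivative on the whole domain. -/
theorem exists_smooth_local_inverse {f : E → F} {U : Set E} (hU : IsOpen U)
    (hf : ContDiffOn ℝ ∞ f U) {a : E} (ha : a ∈ U) (f' : E ≃L[ℝ] F)
    (hf' : HasFDerivAt f (f' : E →L[ℝ] F) a) :
    ∃ e : OpenPartialHomeomorph E F, a ∈ e.source ∧ e.source ⊆ U ∧ (e : E → F) = f ∧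
      ContDiffOn ℝ ∞ e.symm e.target ∧
      ∀ x ∈ e.source, ∃ L : E ≃L[ℝ] F, HasFDerivAt f (L : E →L[ℝ] F) x ∧
        HasFDerivAt e.symm (L.symm : F →L[ℝ] E) (f x) := by
  have hfa : ∀ x ∈ U, ContDiffAt ℝ ∞ f x := fun x hx => hf.contDiffAt (hU.mem_nhds hx)
  set e₀ := (hfa a ha).toOpenPartialHomeomorph f hf' (by simp)
  have hcont : ContinuousOn (fderiv ℝ f) U :=
    hf.continuousOn_fderiv_of_isOpen hU (by simp)
  -- the local inverse is restricted to the open set where the derivative is invertible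
  set O : Set E := U ∩ fderiv ℝ f ⁻¹' Set.range ((↑) : (E ≃L[ℝ] F) → E →L[ℝ] F)
  have hO : IsOpen O := hcont.isOpen_inter_preimage hU ContinuousLinearEquiv.isOpen
  have key : ∀ x ∈ (e₀.restrOpen O hO).source, ∃ L : E ≃L[ℝ] F,
      HasFDerivAt f (L : E →L[ℝ] F) x := fun x hx => by
    obtain ⟨L, hL⟩ := hx.2.2
    exact ⟨L, hL ▸ ((hfa x hx.2.1).differentiableAt (by simp)).hasFDerivAt⟩
  refine ⟨e₀.restrOpen O hO, ⟨?_, ha, f', hf'.fderiv.symm⟩, fun x hx => hx.2.1, rfl, ?_, ?_⟩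
  · exact (hfa a ha).mem_toOpenPartialHomeomorph_source hf' (by simp)
  · intro y hy
    have hx := (e₀.restrOpen O hO).map_target hy
    obtain ⟨L, hL⟩ := key _ hx
    exact ((e₀.restrOpen O hO).contDiffAt_symm hy hL (hfa _ hx.2.1)).contDiffWithinAt
  · intro x hx
    obtain ⟨L, hL⟩ := key _ hx
    refine ⟨L, hL, ?_⟩
    have hy := (e₀.restrOpen O hO).map_source hx
    refine (e₀.restrOpen O hO).hasFDerivAt_symm hy ?_
    have h1 : (e₀.restrOpen O hO).symm (f x) = x := (e₀.restrOpen O hO).left_inv hx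
    rw [h1]
    exact hL

end InverseFunction

/-! ### Flows of commuting vector fields -/

section Flow
open Set Topology
universe u
variable {E : Type u} [NormedAddCommGroup E] [NormedSpace ℝ E] {m : ℕ}

/-- The constant path. -/
def pathConst : E →L[ℝ] C(PathDom, E) :=
  LinearMap.mkContinuous
    { toFun := fun x => ContinuousMap.const PathDom x
      map_add' := fun _ _ => rfl
      map_smul' := fun _ _ => rfl } 1
    (fun x => by
      rw [one_mul]
      exact (ContinuousMap.norm_le _ (by positivity)).mpr fun _ => le_rfl)

@[simp] theorem pathConst_apply (x : E) (t : PathDom) : pathConst x t = x := rfl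

/-- The integral operator whose fixed points are the paths `γ` on `[0, 1]` with `γ(0) = x` and
`γ' = ∑ⱼ aⱼ Xⱼ(γ)`; the parameter is `(a, x)`. -/
def flowOperator (X : Fin m → C(E, E)) (z : ((Fin m → ℝ) × E) × C(PathDom, E)) :
    C(PathDom, E) :=
  pathConst z.1.2 + pathIntegral (∑ j, z.1.1 j • pathComp (X j) z.2)

/-- The derivative of `flowOperator`. -/
def flowOperatorDeriv (X : Fin m → C(E, E)) (X' : Fin m → C(E, E →L[ℝ] E))
    (z : ((Fin m → ℝ) × E) × C(PathDom, E)) :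
    (((Fin m → ℝ) × E) × C(PathDom, E)) →L[ℝ] C(PathDom, E) :=
  pathConst.comp ((ContinuousLinearMap.snd ℝ (Fin m → ℝ) E).comp (ContinuousLinearMap.fst ℝ _ _)) +
    pathIntegral.comp (∑ j, (z.1.1 j • (pathEval (pathComp (X' j) z.2)).comp
        (ContinuousLinearMap.snd ℝ ((Fin m → ℝ) × E) C(PathDom, E)) +
      (((ContinuousLinearMap.proj (R := ℝ) (φ := fun _ : Fin m => ℝ) j).comp
        (ContinuousLinearMap.fst ℝ (Fin m → ℝ) E)).comp
          (ContinuousLinearMap.fst ℝ _ C(PathDom, E))).smulRight (pathComp (X j) z.2)))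

theorem hasFDerivAt_flowOperator (X : Fin m → C(E, E)) (X' : Fin m → C(E, E →L[ℝ] E))
    (hX : ∀ j x, HasFDerivAt (X j) (X' j x) x) (z : ((Fin m → ℝ) × E) × C(PathDom, E)) :
    HasFDerivAt (flowOperator X) (flowOperatorDeriv X X' z) z := by
  have h1 : HasFDerivAt (fun z : ((Fin m → ℝ) × E) × C(PathDom, E) => pathConst z.1.2)
      (pathConst.comp ((ContinuousLinearMap.snd ℝ (Fin m → ℝ) E).comp
        (ContinuousLinearMap.fst ℝ _ C(PathDom, E)))) z :=
    (pathConst.comp ((ContinuousLinearMap.snd ℝ (Fin m → ℝ) E).comp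
        (ContinuousLinearMap.fst ℝ _ C(PathDom, E)))).hasFDerivAt
  refine h1.add ?_
  refine HasFDerivAt.comp z (pathIntegral (E := E)).hasFDerivAt ?_
  refine HasFDerivAt.fun_sum fun j _ => ?_
  have h2 : HasFDerivAt (fun z : ((Fin m → ℝ) × E) × C(PathDom, E) => z.1.1 j)
      (((ContinuousLinearMap.proj (R := ℝ) (φ := fun _ : Fin m => ℝ) j).comp
        (ContinuousLinearMap.fst ℝ (Fin m → ℝ) E)).comp
          (ContinuousLinearMap.fst ℝ _ C(PathDom, E))) z :=
    (((ContinuousLinearMap.proj (R := ℝ) (φ := fun _ : Fin m => ℝ) j).comp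
        (ContinuousLinearMap.fst ℝ (Fin m → ℝ) E)).comp
          (ContinuousLinearMap.fst ℝ _ C(PathDom, E))).hasFDerivAt
  have h3 : HasFDerivAt (fun z : ((Fin m → ℝ) × E) × C(PathDom, E) => pathComp (X j) z.2)
      ((pathEval (pathComp (X' j) z.2)).comp
        (ContinuousLinearMap.snd ℝ ((Fin m → ℝ) × E) C(PathDom, E))) z :=
    HasFDerivAt.comp z (hasFDerivAt_pathComp (X j) (X' j) (hX j) z.2) hasFDerivAt_snd
  exact h2.fun_smul h3

theorem contDiff_flowOperator (X : Fin m → C(E, E)) (hX : ∀ j, ContDiff ℝ ∞ (X j)) :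
    ContDiff ℝ ∞ (flowOperator X) := by
  refine ContDiff.add ((pathConst (E := E)).contDiff.comp (contDiff_snd.comp contDiff_fst)) ?_
  refine (pathIntegral (E := E)).contDiff.comp ?_
  refine ContDiff.sum fun j _ => ?_
  have h2 : ContDiff ℝ ∞ (fun z : ((Fin m → ℝ) × E) × C(PathDom, E) => z.1.1 j) :=
    (contDiff_apply ℝ ℝ j).comp (contDiff_fst.comp contDiff_fst)
  have h3 : ContDiff ℝ ∞ (fun z : ((Fin m → ℝ) × E) × C(PathDom, E) => pathComp (X j) z.2) :=
    (contDiff_pathComp (X j) (hX j)).comp contDiff_snd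
  exact h2.smul h3

/-- The shear `(u, v) ↦ (u, v - T u)`. -/
def shearEquiv {V W : Type*} [NormedAddCommGroup V] [NormedSpace ℝ V] [NormedAddCommGroup W]
    [NormedSpace ℝ W] (T : V →L[ℝ] W) : (V × W) ≃L[ℝ] (V × W) :=
  ContinuousLinearEquiv.equivOfInverse
    ((ContinuousLinearMap.fst ℝ V W).prod
      (ContinuousLinearMap.snd ℝ V W - T.comp (ContinuousLinearMap.fst ℝ V W)))
    ((ContinuousLinearMap.fst ℝ V W).prod
      (ContinuousLinearMap.snd ℝ V W + T.comp (ContinuousLinearMap.fst ℝ V W)))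
    (fun x => by ext <;> simp) (fun x => by ext <;> simp)

theorem lieBracket_eq_zero_iff {V W : E → E} {x : E} :
    VectorField.lieBracket ℝ V W x = 0 ↔ fderiv ℝ W x (V x) = fderiv ℝ V x (W x) := by
  rw [VectorField.lieBracket, sub_eq_zero]

variable [CompleteSpace E]

/-- A fixed path of `flowOperator` is an integral curve; it extends to a function on the line, so
that derivatives at the end points make sense. -/
theorem flowOperator_fixed_hasDerivAt (X : Fin m → C(E, E)) (a : Fin m → ℝ) (x : E)
    (γ : C(PathDom, E)) (hγ : γ = flowOperator X ((a, x), γ)) :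
    ∃ g : ℝ → E, (∀ t : PathDom, g t = γ t) ∧
      ∀ t : PathDom, HasDerivAt g (∑ j, a j • X j (γ t)) t := by
  set δ : C(PathDom, E) := ∑ j, a j • pathComp (X j) γ
  refine ⟨fun t => x + ∫ s in (0 : ℝ)..t, IccExtend zero_le_one δ s, fun t => ?_, fun t => ?_⟩
  · exact (congrArg (fun η => η t) hγ).symm
  · have h := (δ.continuous.Icc_extend' (h := zero_le_one)).integral_hasStrictDerivAt 0 (t : ℝ)
    have h1 := h.hasDerivAt.const_add x
    have h2 : IccExtend zero_le_one δ t = ∑ j, a j • X j (γ t) := by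
      rw [IccExtend_val]
      simp [δ, pathComp]
    rwa [h2] at h1

/-- If the fields commute along a fixed path `γ`, then `t ↦ t Xⱼ(γ(t))` is the variation of `γ` in
the direction of the `j`-th parameter. -/
theorem flowOperatorDeriv_apply_single (X : Fin m → C(E, E)) (X' : Fin m → C(E, E →L[ℝ] E))
    (hX : ∀ j x, HasFDerivAt (X j) (X' j x) x) (a : Fin m → ℝ) (x : E) (γ : C(PathDom, E))
    (hγ : γ = flowOperator X ((a, x), γ))
    (hcomm : ∀ t i j, X' i (γ t) (X j (γ t)) = X' j (γ t) (X i (γ t))) (j : Fin m) :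
    let η : C(PathDom, E) := ⟨fun t => (t : ℝ) • X j (γ t), by fun_prop⟩
    flowOperatorDeriv X X' ((a, x), γ) ((Pi.single j 1, 0), η) = η := by
  intro η
  obtain ⟨g, hg, hg'⟩ := flowOperator_fixed_hasDerivAt X a x γ hγ
  set δ : C(PathDom, E) := ∑ i, (a i • pathEval (pathComp (X' i) γ) η +
    (Pi.single j 1 : Fin m → ℝ) i • pathComp (X i) γ) with hδ
  have h1 : flowOperatorDeriv X X' ((a, x), γ) ((Pi.single j 1, 0), η) = pathIntegral δ := by
    simp [flowOperatorDeriv, hδ]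
  rw [h1]
  ext t
  rw [pathIntegral_apply]
  have h2 : ∀ s : PathDom, HasDerivAt (fun r : ℝ => r • X j (g r)) (δ s) s := fun s => by
    have h3 : HasDerivAt (fun r : ℝ => X j (g r)) (X' j (γ s) (∑ i, a i • X i (γ s))) s := by
      have := (hX j (g s))
      rw [hg] at this
      have h4 : HasFDerivAt (X j) (X' j (γ s)) (g s) := by rw [hg]; exact this
      exact h4.comp_hasDerivAt (s : ℝ) (hg' s)
    have h5 := (hasDerivAt_id (s : ℝ)).smul h3
    refine h5.congr_deriv ?_
    have h7 : δ s = (s : ℝ) • ∑ i, a i • X' i (γ s) (X j (γ s)) + X j (γ s) := by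
      have e1 : ∀ i, (a i • pathEval (pathComp (X' i) γ) η +
          (Pi.single j 1 : Fin m → ℝ) i • pathComp (X i) γ) s =
          (s : ℝ) • a i • X' i (γ s) (X j (γ s)) +
            (Pi.single j 1 : Fin m → ℝ) i • X i (γ s) := fun i => by
        change a i • X' i (γ s) ((s : ℝ) • X j (γ s)) + _ = _
        rw [map_smul, smul_comm]
        rfl
      rw [hδ, ContinuousMap.sum_apply, Finset.smul_sum]
      rw [Finset.sum_congr rfl fun i _ => e1 i]
      simp only [Finset.sum_add_distrib, Pi.single_apply, ite_smul, one_smul, zero_smul,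
        Finset.sum_ite_eq', Finset.mem_univ, if_true]
    rw [h7, hg, id_eq, one_smul, map_sum]
    congr 2
    refine Finset.sum_congr rfl fun i _ => ?_
    rw [map_smul, hcomm s j i]
  have h6 : ∫ s in (0 : ℝ)..t, IccExtend zero_le_one δ s =
      (t : ℝ) • X j (g t) - (0 : ℝ) • X j (g 0) := by
    refine intervalIntegral.integral_eq_sub_of_hasDerivAt (f := fun r : ℝ => r • X j (g r)) ?_ ?_
    · intro s hs
      rw [uIcc_of_le t.2.1] at hs
      have hs' : s ∈ Icc (0 : ℝ) 1 := ⟨hs.1, hs.2.trans t.2.2⟩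
      have := h2 ⟨s, hs'⟩
      rwa [← IccExtend_val zero_le_one δ ⟨s, hs'⟩] at this
    · exact (δ.continuous.Icc_extend').intervalIntegrable _ _
  rw [h6, zero_smul, sub_zero, hg]
  rfl

/-- The simultaneous flow of commuting vector fields: a smooth map `Ψ` with `Ψ(0, x) = x` and
`∂Ψ/∂aⱼ = Xⱼ(Ψ)`. -/
theorem exists_commuting_flow (X : Fin m → E → E) (hX : ∀ j, ContDiff ℝ ∞ (X j)) {U : Set E}
    (hU : IsOpen U) {q : E} (hq : q ∈ U)
    (hcomm : ∀ i j, ∀ x ∈ U, VectorField.lieBracket ℝ (X i) (X j) x = 0) :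
    ∃ (Ψ : (Fin m → ℝ) × E → E) (N : Set ((Fin m → ℝ) × E)), IsOpen N ∧ (0, q) ∈ N ∧
      ContDiffOn ℝ ∞ Ψ N ∧ (∀ x, (0, x) ∈ N → Ψ (0, x) = x) ∧ (∀ u ∈ N, Ψ u ∈ U) ∧
      ∀ u ∈ N, ∀ j, fderiv ℝ Ψ u (Pi.single j 1, 0) = X j (Ψ u) := by
  let XC : Fin m → C(E, E) := fun j => ⟨X j, (hX j).continuous⟩
  let X' : Fin m → C(E, E →L[ℝ] E) := fun j =>
    ⟨fderiv ℝ (X j), (hX j).continuous_fderiv (by simp)⟩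
  have hX' : ∀ j x, HasFDerivAt (XC j) (X' j x) x := fun j x =>
    ((hX j).differentiable (by simp) x).hasFDerivAt
  -- fixed paths are the zeros of the second component of `G`
  let G : ((Fin m → ℝ) × E) × C(PathDom, E) → ((Fin m → ℝ) × E) × C(PathDom, E) :=
    fun z => (z.1, z.2 - flowOperator XC z)
  have hG : ContDiff ℝ ∞ G := contDiff_fst.prodMk (contDiff_snd.sub (contDiff_flowOperator XC hX))
  have hG' : ∀ z, HasFDerivAt G ((ContinuousLinearMap.fst ℝ _ _).prod
      (ContinuousLinearMap.snd ℝ _ _ - flowOperatorDeriv XC X' z)) z := fun z =>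
    hasFDerivAt_fst.prodMk (hasFDerivAt_snd.sub (hasFDerivAt_flowOperator XC X' hX' z))
  -- at `a = 0` the operator does not depend on the path, so that the derivative of `G` is a shear
  let z₀ : ((Fin m → ℝ) × E) × C(PathDom, E) := ((0, q), pathConst q)
  let T : ((Fin m → ℝ) × E) →L[ℝ] C(PathDom, E) :=
    (flowOperatorDeriv XC X' z₀).comp (ContinuousLinearMap.inl ℝ _ _)
  have hG₀ : HasFDerivAt G (shearEquiv T : _ →L[ℝ] _) z₀ := by
    convert hG' z₀ using 1
    ext1
    · ext <;> simp [shearEquiv, T]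
    · ext <;> simp [shearEquiv, T, flowOperatorDeriv, z₀]
  have hV : IsOpen {z : ((Fin m → ℝ) × E) × C(PathDom, E) | MapsTo z.2 univ U} :=
    (ContinuousMap.isOpen_setOfPred_mapsTo isCompact_univ hU).preimage continuous_snd
  obtain ⟨e, he0, heV, heG, hes, hed⟩ := exists_smooth_local_inverse hV hG.contDiffOn
    (a := z₀) (fun t _ => hq) (shearEquiv T) hG₀
  -- the end point of the path with parameters `u`
  let Ψ : (Fin m → ℝ) × E → E := fun u => (e.symm (u, 0)).2 ⟨1, by simp⟩
  have hz₀ : G z₀ = ((0, q), 0) := by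
    refine Prod.ext rfl ?_
    simp [G, z₀, flowOperator]
  have hinv : ∀ u, (u, (0 : C(PathDom, E))) ∈ e.target → (e.symm (u, 0)).1 = u ∧
      (e.symm (u, 0)).2 = flowOperator XC (u, (e.symm (u, 0)).2) := fun u hu => by
    have h := e.right_inv hu
    rw [heG] at h
    have h1 : (e.symm (u, 0)).1 = u := congrArg Prod.fst h
    have h2 : (e.symm (u, 0)).2 - flowOperator XC (e.symm (u, 0)) = 0 := congrArg Prod.snd h
    refine ⟨h1, ?_⟩
    rw [show (u, (e.symm (u, 0)).2) = e.symm (u, 0) from Prod.ext h1.symm rfl]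
    exact sub_eq_zero.mp h2
  let ev : C(PathDom, E) →L[ℝ] E := ContinuousMap.evalCLM ℝ (⟨1, by simp⟩ : PathDom)
  have hembed : Continuous fun u : (Fin m → ℝ) × E => (u, (0 : C(PathDom, E))) := by fun_prop
  refine ⟨Ψ, {u | (u, 0) ∈ e.target}, e.open_target.preimage hembed, ?_, ?_, ?_, ?_, ?_⟩
  · have := e.map_source he0
    rwa [heG, hz₀] at this
  · have h1 : ContDiffOn ℝ ∞ (fun u : (Fin m → ℝ) × E => (e.symm (u, 0)).2)
        {u | (u, 0) ∈ e.target} :=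
      contDiff_snd.comp_contDiffOn
        (hes.comp (contDiff_id.prodMk contDiff_const).contDiffOn fun u hu => hu)
    exact ev.contDiff.comp_contDiffOn h1
  · intro x hx
    have h := (hinv _ hx).2
    have : (e.symm ((0, x), 0)).2 = pathConst x := by
      rw [h]
      simp [flowOperator]
    simp [Ψ, this]
  · intro u hu
    exact heV (e.map_target hu) (mem_univ _)
  · intro u hu j
    obtain ⟨h1, h2⟩ := hinv u hu
    set γ := (e.symm (u, 0)).2 with hγ
    have hz : e.symm (u, 0) = (u, γ) := Prod.ext h1 rfl
    obtain ⟨L, hL, hL'⟩ := hed _ (e.map_target hu)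
    have h3 : G (e.symm (u, 0)) = (u, 0) := by rw [← heG]; exact e.right_inv hu
    rw [h3] at hL'
    let η : C(PathDom, E) := ⟨fun t => (t : ℝ) • XC j (γ t), by fun_prop⟩
    have h4 : L ((Pi.single j 1, 0), η) = ((Pi.single j 1, 0), 0) := by
      have h5 := flowOperatorDeriv_apply_single XC X' hX' u.1 u.2 γ h2 (fun t i k => by
        have hU' : γ t ∈ U := heV (e.map_target hu) (mem_univ t)
        exact (lieBracket_eq_zero_iff.mp (hcomm k i _ hU'))) j
      have h6 := (hG' (e.symm (u, 0))).unique hL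
      change L.toContinuousLinearMap _ = _
      rw [← h6, hz]
      refine Prod.ext rfl ?_
      exact sub_eq_zero.mpr h5.symm
    have h7 : HasFDerivAt Ψ (ev.comp
        ((ContinuousLinearMap.snd ℝ ((Fin m → ℝ) × E) C(PathDom, E)).comp
          (L.symm.toContinuousLinearMap.comp (ContinuousLinearMap.inl ℝ
              ((Fin m → ℝ) × E) C(PathDom, E))))) u := by
      refine ev.hasFDerivAt.comp u ?_
      refine hasFDerivAt_snd.comp u ?_
      refine HasFDerivAt.comp u hL' ?_
      exact hasFDerivAt_id u |>.prodMk (hasFDerivAt_const 0 u)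
    rw [h7.fderiv]
    have h8 : L.symm ((Pi.single j 1, 0), 0) = ((Pi.single j 1, 0), η) := by
      rw [← h4, L.symm_apply_apply]
    change (L.symm ((Pi.single j 1, 0), 0)).2 _ = _
    rw [h8]
    simp [η, XC, Ψ, ← hγ]

end Flow

/-! ### Straightening commuting vector fields -/

section Straighten
open Set Topology

/-- A map which is smooth near a point agrees near this point with a smooth map defined
everywhere. -/
theorem exists_contDiff_eventuallyEq {E F : Type*} [NormedAddCommGroup E] [InnerProductSpace ℝ E]
    [FiniteDimensional ℝ E]
    [NormedAddCommGroup F] [NormedSpace ℝ F] {f : E → F} {U : Set E} (hU : IsOpen U)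
    (hf : ContDiffOn ℝ ∞ f U) {q : E} (hq : q ∈ U) :
    ∃ g : E → F, ContDiff ℝ ∞ g ∧ g =ᶠ[𝓝 q] f := by
  obtain ⟨r, hr, hrU⟩ := Metric.isOpen_iff.mp hU q hq
  let b : ContDiffBump q := ⟨r / 4, r / 2, by positivity, by linarith⟩
  refine ⟨fun x => b x • f x, ?_, ?_⟩
  · rw [contDiff_iff_contDiffAt]
    intro x
    by_cases hx : x ∈ U
    · exact b.contDiff.contDiffAt.smul (hf.contDiffAt (hU.mem_nhds hx))
    · have h1 : (fun x => b x • f x) =ᶠ[𝓝 x] fun _ => 0 := by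
        have h2 : (Metric.closedBall q (r / 2))ᶜ ∈ 𝓝 x := by
          refine Metric.isClosed_closedBall.isOpen_compl.mem_nhds fun h => hx (hrU ?_)
          exact Metric.closedBall_subset_ball (by linarith) h
        filter_upwards [h2] with y hy
        have : b y = 0 := b.zero_of_le_dist (by
          rw [mem_compl_iff, Metric.mem_closedBall, not_le] at hy
          exact hy.le)
        rw [this, zero_smul]
      exact contDiffAt_const.congr_of_eventuallyEq h1
  · filter_upwards [b.eventuallyEq_one] with x hx
    rw [hx]
    simp

/-- The projection onto the coordinates with index `ι j`. -/
def coordProj {m : ℕ} (ι : Fin m → Fin 5) : E5 →L[ℝ] (Fin m → ℝ) :=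
  ContinuousLinearMap.pi fun j => coordCovec (ι j)

/-- Commuting vector fields `Xⱼ` are, in suitable coordinates, coordinate vector fields, provided
that a linear isomorphism takes coordinate vectors to the `Xⱼ(q)`. -/
theorem exists_straightening {m : ℕ} (ι : Fin m → Fin 5) (hι : Function.Injective ι)
    (X : Fin m → E5 → E5) {U : Set E5} (hU : IsOpen U) (hX : ∀ j, ContDiffOn ℝ ∞ (X j) U)
    (hcomm : ∀ i j, ∀ x ∈ U, VectorField.lieBracket ℝ (X i) (X j) x = 0) {q : E5} (hq : q ∈ U)
    (T : E5 ≃L[ℝ] E5) (hT : ∀ j, T (basisVec (ι j)) = X j q) :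
    ∃ e : OpenPartialHomeomorph E5 E5, 0 ∈ e.source ∧ e 0 = q ∧ e.target ⊆ U ∧
      ContDiffOn ℝ ∞ e e.source ∧ ContDiffOn ℝ ∞ e.symm e.target ∧
      ∀ z ∈ e.source, ∃ L : E5 ≃L[ℝ] E5, HasFDerivAt e (L : E5 →L[ℝ] E5) z ∧
        HasFDerivAt e.symm (L.symm : E5 →L[ℝ] E5) (e z) ∧
        ∀ j, L (basisVec (ι j)) = X j (e z) := by
  choose Y hY hYX using fun j => exists_contDiff_eventuallyEq hU (hX j) hq
  have hev : ∀ᶠ x in 𝓝 q, x ∈ U ∧ ∀ j, Y j x = X j x :=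
    (hU.eventually_mem hq).and (Filter.eventually_all.mpr hYX)
  obtain ⟨V, hVU, hV, hqV⟩ := eventually_nhds_iff.mp hev
  have hYcomm : ∀ i j, ∀ x ∈ V, VectorField.lieBracket ℝ (Y i) (Y j) x = 0 := fun i j x hx => by
    rw [← hcomm i j x (hVU x hx).1]
    have h1 : ∀ j, Y j =ᶠ[𝓝 x] X j := fun j => by
      filter_upwards [hV.mem_nhds hx] with y hy using (hVU y hy).2 j
    exact (h1 i).lieBracket_vectorField_eq (h1 j)
  obtain ⟨Ψ, N, hN, hqN, hΨ, hΨ0, hΨV, hΨ'⟩ := exists_commuting_flow Y hY hV hqV hYcomm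
  -- the new coordinates are the flow parameters and affine coordinates on a transversal subspace:
  -- the map is `Ψ ∘ c` with `c z = (σ z, q + T (z - s (σ z)))`, where `σ` is `coordProj ι`
  let s : (Fin m → ℝ) →L[ℝ] E5 :=
    ∑ j, (ContinuousLinearMap.proj (R := ℝ) (φ := fun _ : Fin m => ℝ) j).smulRight
      (basisVec (ι j))
  have hs : ∀ j, s (Pi.single j 1) = basisVec (ι j) := fun j => by
    simp [s, Pi.single_apply]
  have hσ : ∀ j, coordProj ι (basisVec (ι j)) = Pi.single j 1 := fun j => by
    ext i
    simp [coordProj, coordCovec_basisVec, Pi.single_apply, hι.eq_iff]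
  let A : E5 →L[ℝ] E5 := T.toContinuousLinearMap.comp
    (ContinuousLinearMap.id ℝ E5 - s.comp (coordProj ι))
  let D : E5 →L[ℝ] (Fin m → ℝ) × E5 := (coordProj ι).prod A
  let c : E5 → (Fin m → ℝ) × E5 := fun z => (0, q) + D z
  have hc : ContDiff ℝ ∞ c := contDiff_const.add D.contDiff
  have hc' : ∀ z, HasFDerivAt c D z := fun z => D.hasFDerivAt.const_add (0, q)
  have hc0 : c 0 = (0, q) := by simp [c]
  have hDe : ∀ j, D (basisVec (ι j)) = (Pi.single j 1, 0) := fun j => by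
    simp [D, A, hσ, hs]
  have hΨd : ∀ u ∈ N, HasFDerivAt Ψ (fderiv ℝ Ψ u) u := fun u hu =>
    ((hΨ.contDiffAt (hN.mem_nhds hu)).differentiableAt (by simp)).hasFDerivAt
  have hΘ : ∀ z, c z ∈ N → HasFDerivAt (Ψ ∘ c) ((fderiv ℝ Ψ (c z)).comp D) z := fun z hz =>
    (hΨd _ hz).comp z (hc' z)
  have hΘe : ∀ z, c z ∈ N → ∀ j, (fderiv ℝ Ψ (c z)).comp D (basisVec (ι j)) = X j (Ψ (c z)) :=
    fun z hz j => by
      rw [ContinuousLinearMap.comp_apply, hDe, hΨ' _ hz, (hVU _ (hΨV _ hz)).2]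
  -- the derivative at the origin is `T`
  have hd0 : (fderiv ℝ Ψ (c 0)).comp D = T.toContinuousLinearMap := by
    have h0 : c 0 ∈ N := by rwa [hc0]
    have hright : ∀ v : E5, fderiv ℝ Ψ (c 0) (0, v) = v := fun v => by
      have h1 : HasFDerivAt (fun x : E5 => Ψ (0, x))
          ((fderiv ℝ Ψ (c 0)).comp (ContinuousLinearMap.inr ℝ (Fin m → ℝ) E5)) q := by
        have := hΨd _ h0
        rw [hc0] at this ⊢
        exact this.comp q ((hasFDerivAt_const 0 q).prodMk (hasFDerivAt_id q))
      have h2 : (fun x : E5 => Ψ (0, x)) =ᶠ[𝓝 q] id := by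
        have : Continuous fun x : E5 => ((0 : Fin m → ℝ), x) := by fun_prop
        filter_upwards [(hN.preimage this).mem_nhds hqN] with x hx using hΨ0 x hx
      have h3 := h1.unique ((hasFDerivAt_id q).congr_of_eventuallyEq h2)
      exact congrArg (fun L : E5 →L[ℝ] E5 => L v) h3
    have hleft : ∀ a : Fin m → ℝ, fderiv ℝ Ψ (c 0) (a, 0) = T (s a) := fun a => by
      have h1 : (fderiv ℝ Ψ (c 0)).comp (ContinuousLinearMap.inl ℝ (Fin m → ℝ) E5) =
          T.toContinuousLinearMap.comp s := by
        refine ContinuousLinearMap.coe_injective (LinearMap.pi_ext' fun j => LinearMap.ext_ring ?_)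
        have := hΨ' _ h0 j
        rw [(hVU _ (hΨV _ h0)).2, hc0, hΨ0 q hqN, ← hT, ← hs, ← hc0] at this
        exact this
      exact congrArg (fun L : (Fin m → ℝ) →L[ℝ] E5 => L a) h1
    ext1 v
    have h4 : D v = (coordProj ι v, 0) + (0, A v) := by simp [D]
    rw [ContinuousLinearMap.comp_apply, h4, map_add, hleft, hright]
    simp [A]
  obtain ⟨e, he0, heN, hee, hes, hed⟩ := exists_smooth_local_inverse (f := Ψ ∘ c)
    (hN.preimage hc.continuous) (hΨ.comp hc.contDiffOn fun z hz => hz) (a := 0)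
    (by rw [mem_preimage, hc0]; exact hqN) T
    (hd0 ▸ hΘ 0 (by rw [hc0]; exact hqN))
  refine ⟨e, he0, ?_, ?_, ?_, hes, ?_⟩
  · rw [hee, Function.comp_apply, hc0, hΨ0 q hqN]
  · intro y hy
    rw [← e.right_inv hy, hee]
    exact (hVU _ (hΨV _ (heN (e.map_target hy)))).1
  · rw [hee]
    exact (hΨ.comp hc.contDiffOn fun z hz => hz).mono heN
  · intro z hz
    obtain ⟨L, hL, hL'⟩ := hed z hz
    refine ⟨L, hee ▸ hL, hee ▸ hL', fun j => ?_⟩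
    have h1 := hL.unique (hΘ z (heN hz))
    have h2 := hΘe z (heN hz) j
    rw [← h1] at h2
    rw [hee]
    exact h2

/-- Linearly independent vectors are images of the first coordinate vectors under a linear
isomorphism; by induction on the codimension `k`, adding one vector at a time. -/
theorem exists_linearEquiv_of_linearIndependent (k : ℕ) : ∀ {m : ℕ} (hm : m ≤ 5), m + k = 5 →
    ∀ {v : Fin m → E5}, LinearIndependent ℝ v →
      ∃ T : E5 ≃L[ℝ] E5, ∀ j, T (basisVec (Fin.castLE hm j)) = v j := by
  induction k with
  | zero =>
    intro m hm hk v hv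
    obtain rfl : m = 5 := by omega
    let b := basisOfLinearIndependentOfCardEqFinrank hv (by simp)
    refine ⟨LinearEquiv.toContinuousLinearEquiv
      ((EuclideanSpace.basisFun (Fin 5) ℝ).toBasis.equiv b (Equiv.refl _)), fun j => ?_⟩
    have h := (EuclideanSpace.basisFun (Fin 5) ℝ).toBasis.equiv_apply j b (Equiv.refl _)
    simpa [b, basisVec] using h
  | succ k ih =>
    intro m hm hk v hv
    obtain ⟨x, hx⟩ := exists_linearIndependent_snoc_of_lt_finrank (R := ℝ) hv
      (by rw [finrank_E5]; omega)
    obtain ⟨T, hT⟩ := ih (by omega) (by omega) hx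
    refine ⟨T, fun j => ?_⟩
    have := hT j.castSucc
    rw [Fin.snoc_castSucc] at this
    exact this

end Straighten

/-! ### The Lie derivative and closed forms -/

section LieDerivative
open Set Topology
variable {E : Type*} [NormedAddCommGroup E] [NormedSpace ℝ E]

/-- The Lie derivative of a differential form along a vector field `X`: the derivative of the
coefficients in the direction of `X`, plus the form with each argument `v` in turn replaced by
`DX(v)` and moved to the front. -/
def lieForm {n : ℕ} (X : E → E) (α : E → E [⋀^Fin (n + 1)]→L[ℝ] ℝ) (x : E) (v : Fin (n + 1) → E) :
    ℝ :=
  fderiv ℝ α x (X x) v + ∑ i : Fin (n + 1), (-1 : ℝ) ^ (i : ℕ) *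
    α x (Matrix.vecCons (fderiv ℝ X x (v i)) (i.removeNth v))

/-- Differentiation under a fixed continuous linear map. Where it is applied to spaces of
alternating forms, the explicit spaces keep unification from unfolding them. -/
theorem hasFDerivAt_clm_comp {F G : Type*} [NormedAddCommGroup F] [NormedSpace ℝ F]
    [NormedAddCommGroup G] [NormedSpace ℝ G] (L : F →L[ℝ] G) {α : E → F} {α' : E →L[ℝ] F} {x : E}
    (h : HasFDerivAt α α' x) : HasFDerivAt (fun y => L (α y)) (L.comp α') x :=
  L.hasFDerivAt.comp x h

theorem contDiffOn_clm_comp {F G : Type*} [NormedAddCommGroup F] [NormedSpace ℝ F]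
    [NormedAddCommGroup G] [NormedSpace ℝ G] (L : F →L[ℝ] G) {α : E → F} {U : Set E}
    (h : ContDiffOn ℝ ∞ α U) : ContDiffOn ℝ ∞ (fun y => L (α y)) U :=
  L.contDiff.comp_contDiffOn h

variable (E) in
/-- Contraction with the first argument, as a continuous linear map. -/
def curryLeftL (n : ℕ) : (E [⋀^Fin (n + 1)]→L[ℝ] ℝ) →L[ℝ] (E →L[ℝ] E [⋀^Fin n]→L[ℝ] ℝ) :=
  ContinuousAlternatingMap.curryLeftLI.toContinuousLinearMap

/-- The product rule for the contraction of a form with a vector field. -/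
theorem hasFDerivAt_curryLeft {n : ℕ} {α : E → E [⋀^Fin (n + 1)]→L[ℝ] ℝ} {X : E → E} {x : E}
    (hα : DifferentiableAt ℝ α x) (hX : DifferentiableAt ℝ X x) (w : E) :
    DifferentiableAt ℝ (fun y => (α y).curryLeft (X y)) x ∧
    fderiv ℝ (fun y => (α y).curryLeft (X y)) x w =
      (fderiv ℝ α x w).curryLeft (X x) + (α x).curryLeft (fderiv ℝ X x w) := by
  have h1 : HasFDerivAt (fun y => curryLeftL E n (α y)) ((curryLeftL E n).comp (fderiv ℝ α x)) x :=
    hasFDerivAt_clm_comp (F := E [⋀^Fin (n + 1)]→L[ℝ] ℝ) (G := E →L[ℝ] E [⋀^Fin n]→L[ℝ] ℝ)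
      (curryLeftL E n) hα.hasFDerivAt
  have h2 : HasFDerivAt (fun y => (α y).curryLeft (X y)) _ x := h1.clm_apply hX.hasFDerivAt
  refine ⟨h2.differentiableAt, ?_⟩
  rw [h2.fderiv, add_comm]
  rfl

/-- Cartan's formula for a closed form. -/
theorem lieForm_eq_extDeriv {n : ℕ} {α : E → E [⋀^Fin (n + 1)]→L[ℝ] ℝ} {X : E → E} {x : E}
    (hα : DifferentiableAt ℝ α x) (hX : DifferentiableAt ℝ X x) (hc : extDeriv α x = 0)
    (v : Fin (n + 1) → E) :
    lieForm X α x v = extDeriv (fun y => (α y).curryLeft (X y)) x v := by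
  have h1 : extDeriv α x (Matrix.vecCons (X x) v) = 0 := by rw [hc]; rfl
  rw [extDeriv, ContinuousAlternatingMap.alternatizeUncurryFin_apply] at h1 ⊢
  rw [Fin.sum_univ_succ] at h1
  simp only [(hasFDerivAt_curryLeft hα hX _).2, ContinuousAlternatingMap.add_apply,
    ContinuousAlternatingMap.curryLeft_apply_apply, removeNth_succ_vecCons] at h1 ⊢
  have h0 : (0 : Fin (n + 1 + 1)).removeNth (Matrix.vecCons (X x) v) = v := rfl
  simp only [Matrix.cons_val_zero, Matrix.cons_val_succ, Fin.val_succ, pow_succ, h0, Fin.val_zero,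
    pow_zero, one_smul, smul_add, Finset.sum_add_distrib, mul_neg, mul_one, neg_smul,
    Finset.sum_neg_distrib, zsmul_eq_mul, Int.cast_pow, Int.cast_neg, Int.cast_one] at h1 ⊢
  rw [lieForm]
  linarith

/-- `L_X i_Z α = i_Z L_X α + i_{[X, Z]} α`. -/
theorem lieForm_curryLeft {n : ℕ} {α : E → E [⋀^Fin (n + 2)]→L[ℝ] ℝ} {X Z : E → E} {x : E}
    (hα : DifferentiableAt ℝ α x) (hZ : DifferentiableAt ℝ Z x) (w : Fin (n + 1) → E) :
    lieForm X (fun y => (α y).curryLeft (Z y)) x w =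
      lieForm X α x (Matrix.vecCons (Z x) w) +
        α x (Matrix.vecCons (VectorField.lieBracket ℝ X Z x) w) := by
  have hs : ∀ (a b : E) (u : Fin n → E), α x (Matrix.vecCons a (Matrix.vecCons b u)) =
      - α x (Matrix.vecCons b (Matrix.vecCons a u)) := fun a b u =>
    congrArg (fun η => η u) (curryLeft_curryLeft_swap (α x) a b)
  have h0 : (0 : Fin (n + 1 + 1)).removeNth (Matrix.vecCons (Z x) w) = w := rfl
  have hb : ∀ a b : E, α x (Matrix.vecCons (a - b) w) = α x (Matrix.vecCons a w) -
      α x (Matrix.vecCons b w) := fun a b =>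
    congrArg (fun η => η w) ((α x).curryLeft.map_sub a b)
  rw [lieForm, lieForm, (hasFDerivAt_curryLeft hα hZ _).2, Fin.sum_univ_succ (n := n + 1),
    VectorField.lieBracket, hb]
  simp only [ContinuousAlternatingMap.add_apply,
    ContinuousAlternatingMap.curryLeft_apply_apply, removeNth_succ_vecCons, h0,
    Matrix.cons_val_zero, Matrix.cons_val_succ, Fin.val_succ, pow_succ, Fin.val_zero,
    pow_zero, mul_neg, mul_one, neg_mul, hs (Z x)]
  simp
  ring

theorem alternatizeUncurryFin_apply_two (T : E →L[ℝ] E [⋀^Fin 1]→L[ℝ] ℝ) (a b : E) :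
    ContinuousAlternatingMap.alternatizeUncurryFin T ![a, b] = T a ![b] - T b ![a] := by
  have h0 : (0 : Fin 2).removeNth ![a, b] = ![b] := by ext i; fin_cases i; rfl
  have h1 : (1 : Fin 2).removeNth ![a, b] = ![a] := by ext i; fin_cases i; rfl
  rw [ContinuousAlternatingMap.alternatizeUncurryFin_apply]
  simp [Fin.sum_univ_succ, h0, h1]
  ring

theorem alternatizeUncurryFin_apply_three (T : E →L[ℝ] E [⋀^Fin 2]→L[ℝ] ℝ) (a b c : E) :
    ContinuousAlternatingMap.alternatizeUncurryFin T ![a, b, c] =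
      T a ![b, c] - T b ![a, c] + T c ![a, b] := by
  have h0 : (0 : Fin 3).removeNth ![a, b, c] = ![b, c] := by ext i; fin_cases i <;> rfl
  have h1 : (1 : Fin 3).removeNth ![a, b, c] = ![a, c] := by ext i; fin_cases i <;> rfl
  have h2 : (2 : Fin 3).removeNth ![a, b, c] = ![a, b] := by ext i; fin_cases i <;> rfl
  rw [ContinuousAlternatingMap.alternatizeUncurryFin_apply]
  simp [Fin.sum_univ_three, h0, h1, h2]
  ring

theorem alternatizeUncurryFin_apply_four (T : E →L[ℝ] E [⋀^Fin 3]→L[ℝ] ℝ) (a b c d : E) :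
    ContinuousAlternatingMap.alternatizeUncurryFin T ![a, b, c, d] =
      T a ![b, c, d] - T b ![a, c, d] + T c ![a, b, d] - T d ![a, b, c] := by
  have h0 : (0 : Fin 4).removeNth ![a, b, c, d] = ![b, c, d] := by ext i; fin_cases i <;> rfl
  have h1 : (1 : Fin 4).removeNth ![a, b, c, d] = ![a, c, d] := by ext i; fin_cases i <;> rfl
  have h2 : (2 : Fin 4).removeNth ![a, b, c, d] = ![a, b, d] := by ext i; fin_cases i <;> rfl
  have h3 : (3 : Fin 4).removeNth ![a, b, c, d] = ![a, b, c] := by ext i; fin_cases i <;> rfl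
  rw [ContinuousAlternatingMap.alternatizeUncurryFin_apply]
  simp [Fin.sum_univ_four, h0, h1, h2, h3, pow_succ]
  ring

theorem wedge_one_one_apply (α β : E [⋀^Fin 1]→L[ℝ] ℝ) (a b : E) :
    wedge α β ![a, b] = α ![a] * β ![b] - α ![b] * β ![a] := by
  have e1 : wedge α β ![a, b] = ((wedge α β).curryLeft a) ![b] := rfl
  have e2 : wedge α (β.curryLeft a) ![b] = β ![a] * α ![b] :=
    congrArg (fun η : E [⋀^Fin 1]→L[ℝ] ℝ => η ![b]) (wedge_one_zero α (β.curryLeft a))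
  have e3 : wedge (α.curryLeft a) β ![b] = α ![a] * β ![b] :=
    congrArg (fun η => η ![b]) (wedge_zero_left (α.curryLeft a) β)
  rw [e1, curryLeft_wedge_one]
  refine (congrArg₂ (· - ·) e3 e2).trans ?_
  ring

theorem wedge_one_two_apply (α : E [⋀^Fin 1]→L[ℝ] ℝ) (β : E [⋀^Fin 2]→L[ℝ] ℝ) (a b c : E) :
    wedge α β ![a, b, c] = α ![a] * β ![b, c] - α ![b] * β ![a, c] + α ![c] * β ![a, b] := by
  have e1 : wedge α β ![a, b, c] = ((wedge α β).curryLeft a) ![b, c] := rfl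
  have e2 : wedge α (β.curryLeft a) ![b, c] = α ![b] * β ![a, c] - α ![c] * β ![a, b] :=
    wedge_one_one_apply α (β.curryLeft a) b c
  have e3 : wedge (α.curryLeft a) β ![b, c] = α ![a] * β ![b, c] :=
    congrArg (fun η => η ![b, c]) (wedge_zero_left (α.curryLeft a) β)
  rw [e1, curryLeft_wedge_one]
  refine (congrArg₂ (· - ·) e3 e2).trans ?_
  ring

/-- The product rule for the wedge product. -/
theorem fderiv_wedge {k n : ℕ} {θ : E → E [⋀^Fin k]→L[ℝ] ℝ} {β : E → E [⋀^Fin n]→L[ℝ] ℝ} {x : E}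
    (hθ : DifferentiableAt ℝ θ x) (hβ : DifferentiableAt ℝ β x) (w : E) :
    fderiv ℝ (fun y => wedge (θ y) (β y)) x w =
      wedge (fderiv ℝ θ x w) (β x) + wedge (θ x) (fderiv ℝ β x w) := by
  have h1 : HasFDerivAt (fun y => wedgeL k n (θ y)) ((wedgeL k n).comp (fderiv ℝ θ x)) x :=
    hasFDerivAt_clm_comp (F := E [⋀^Fin k]→L[ℝ] ℝ)
      (G := (E [⋀^Fin n]→L[ℝ] ℝ) →L[ℝ] (E [⋀^Fin (n + k)]→L[ℝ] ℝ)) (wedgeL k n) hθ.hasFDerivAt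
  have h2 : HasFDerivAt (fun y => wedge (θ y) (β y)) _ x := h1.clm_apply hβ.hasFDerivAt
  rw [h2.fderiv]
  exact add_comm (wedge (θ x) (fderiv ℝ β x w)) _

theorem contDiffOn_wedge {k n : ℕ} {θ : E → E [⋀^Fin k]→L[ℝ] ℝ} {β : E → E [⋀^Fin n]→L[ℝ] ℝ}
    {U : Set E} (hθ : ContDiffOn ℝ ∞ θ U) (hβ : ContDiffOn ℝ ∞ β U) :
    ContDiffOn ℝ ∞ (fun y => wedge (θ y) (β y)) U :=
  ContDiffOn.clm_apply (contDiffOn_clm_comp (F := E [⋀^Fin k]→L[ℝ] ℝ)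
    (G := (E [⋀^Fin n]→L[ℝ] ℝ) →L[ℝ] (E [⋀^Fin (n + k)]→L[ℝ] ℝ)) (wedgeL k n) hθ) hβ

theorem contDiffOn_curryLeft {n : ℕ} {α : E → E [⋀^Fin (n + 1)]→L[ℝ] ℝ} {X : E → E}
    {U : Set E} (hα : ContDiffOn ℝ ∞ α U) (hX : ContDiffOn ℝ ∞ X U) :
    ContDiffOn ℝ ∞ (fun y => (α y).curryLeft (X y)) U :=
  ContDiffOn.clm_apply (contDiffOn_clm_comp (F := E [⋀^Fin (n + 1)]→L[ℝ] ℝ)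
    (G := E →L[ℝ] E [⋀^Fin n]→L[ℝ] ℝ) (curryLeftL E n) hα) hX

/-- The derivative of a closed one-form is symmetric. -/
theorem fderiv_apply_comm_of_extDeriv_eq_zero {θ : E → E [⋀^Fin 1]→L[ℝ] ℝ} {x : E}
    (hθ : extDeriv θ x = 0) (a b : E) : fderiv ℝ θ x a ![b] = fderiv ℝ θ x b ![a] := by
  have := congrArg (fun η => η ![a, b]) hθ
  rw [extDeriv] at this
  exact sub_eq_zero.mp ((alternatizeUncurryFin_apply_two _ _ _).symm.trans this)

/-- The exterior product of closed one-forms is closed. -/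
theorem extDeriv_wedge_one_one {θ η : E → E [⋀^Fin 1]→L[ℝ] ℝ} {x : E}
    (hθ : DifferentiableAt ℝ θ x) (hη : DifferentiableAt ℝ η x) (hθc : extDeriv θ x = 0)
    (hηc : extDeriv η x = 0) : extDeriv (fun y => wedge (θ y) (η y)) x = 0 := by
  ext v
  obtain ⟨a, b, c, rfl⟩ : ∃ a b c, v = ![a, b, c] := ⟨v 0, v 1, v 2, by ext i; fin_cases i <;> rfl⟩
  refine (alternatizeUncurryFin_apply_three _ a b c).trans ?_
  have e : ∀ a b c, fderiv ℝ (fun y => wedge (θ y) (η y)) x a ![b, c] =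
      fderiv ℝ θ x a ![b] * η x ![c] - fderiv ℝ θ x a ![c] * η x ![b] +
      (θ x ![b] * fderiv ℝ η x a ![c] - θ x ![c] * fderiv ℝ η x a ![b]) := fun a b c => by
    rw [fderiv_wedge hθ hη]
    exact congrArg₂ (· + ·) (wedge_one_one_apply _ _ _ _) (wedge_one_one_apply _ _ _ _)
  refine (congrArg₂ (· + ·) (congrArg₂ (· - ·) (e a b c) (e b a c)) (e c a b)).trans ?_
  have s := fderiv_apply_comm_of_extDeriv_eq_zero hθc
  have t := fderiv_apply_comm_of_extDeriv_eq_zero hηc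
  rw [s b a, s c a, s c b, t b a, t c a, t c b]
  change (_ : ℝ) = 0
  ring

/-- The exterior product of a closed one-form and a closed two-form is closed. -/
theorem extDeriv_wedge_one_two {θ : E → E [⋀^Fin 1]→L[ℝ] ℝ} {β : E → E [⋀^Fin 2]→L[ℝ] ℝ} {x : E}
    (hθ : DifferentiableAt ℝ θ x) (hβ : DifferentiableAt ℝ β x) (hθc : extDeriv θ x = 0)
    (hβc : extDeriv β x = 0) : extDeriv (fun y => wedge (θ y) (β y)) x = 0 := by
  ext v
  obtain ⟨a, b, c, d, rfl⟩ : ∃ a b c d, v = ![a, b, c, d] :=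
    ⟨v 0, v 1, v 2, v 3, by ext i; fin_cases i <;> rfl⟩
  refine (alternatizeUncurryFin_apply_four _ a b c d).trans ?_
  have e : ∀ a b c d, fderiv ℝ (fun y => wedge (θ y) (β y)) x a ![b, c, d] =
      fderiv ℝ θ x a ![b] * β x ![c, d] - fderiv ℝ θ x a ![c] * β x ![b, d] +
        fderiv ℝ θ x a ![d] * β x ![b, c] +
      (θ x ![b] * fderiv ℝ β x a ![c, d] - θ x ![c] * fderiv ℝ β x a ![b, d] +
        θ x ![d] * fderiv ℝ β x a ![b, c]) := fun a b c d => by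
    rw [fderiv_wedge hθ hβ]
    exact congrArg₂ (· + ·) (wedge_one_two_apply _ _ _ _ _) (wedge_one_two_apply _ _ _ _ _)
  refine (congrArg₂ (· - ·) (congrArg₂ (· + ·) (congrArg₂ (· - ·) (e a b c d) (e b a c d))
    (e c a b d)) (e d a b c)).trans ?_
  have s := fderiv_apply_comm_of_extDeriv_eq_zero hθc
  have t : ∀ a b c, fderiv ℝ β x a ![b, c] - fderiv ℝ β x b ![a, c] + fderiv ℝ β x c ![a, b] = 0 :=
    fun a b c => (alternatizeUncurryFin_apply_three _ a b c).symm.trans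
      (congrArg (fun η => η ![a, b, c]) hβc)
  rw [s b a, s c a, s c b, s d a, s d b, s d c]
  change (_ : ℝ) = 0
  linear_combination (-θ x ![a]) * t b c d + θ x ![b] * t a c d - θ x ![c] * t a b d +
    θ x ![d] * t a b c

end LieDerivative

/-! ### Commuting fields of the normalized data -/

open Set Topology

section Bracket
variable {E : Type*} [NormedAddCommGroup E] [NormedSpace ℝ E]

/-- The contraction of a form `α` with `[X, Z]` vanishes if `α` and its contractions with `X`, `Z`
and both of them are closed. -/
theorem curryLeft_lieBracket_eq_zero {n : ℕ} {α : E → E [⋀^Fin (n + 2)]→L[ℝ] ℝ} {X Z : E → E}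
    {x : E} (hα : DifferentiableAt ℝ α x) (hX : DifferentiableAt ℝ X x)
    (hZ : DifferentiableAt ℝ Z x) (hc : extDeriv α x = 0)
    (h1 : extDeriv (fun y => (α y).curryLeft (X y)) x = 0)
    (h2 : extDeriv (fun y => (α y).curryLeft (Z y)) x = 0)
    (h3 : extDeriv (fun y => ((α y).curryLeft (Z y)).curryLeft (X y)) x = 0) :
    (α x).curryLeft (VectorField.lieBracket ℝ X Z x) = 0 := by
  ext w
  have e := lieForm_curryLeft (X := X) hα hZ w
  rw [lieForm_eq_extDeriv (hasFDerivAt_curryLeft hα hZ 0).1 hX h2, h3,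
    lieForm_eq_extDeriv hα hX hc, h1] at e
  rw [ContinuousAlternatingMap.curryLeft_apply_apply]
  simpa using e.symm

theorem diffAt_of_isOpen {F : Type*} [NormedAddCommGroup F] [NormedSpace ℝ F] {f : E → F}
    {U : Set E} (hU : IsOpen U) (hf : ContDiffOn ℝ ∞ f U) {x : E} (hx : x ∈ U) :
    DifferentiableAt ℝ f x :=
  (hf.contDiffAt (hU.mem_nhds hx)).differentiableAt (by simp)

theorem extDeriv_eq_zero_of_eqOn_const {n : ℕ} {α : E → E [⋀^Fin n]→L[ℝ] ℝ} {U : Set E}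
    (hU : IsOpen U) {x : E} (hx : x ∈ U) {c : E [⋀^Fin n]→L[ℝ] ℝ} (h : ∀ y ∈ U, α y = c) :
    extDeriv α x = 0 := by
  have h1 : α =ᶠ[𝓝 x] fun _ => c := by
    filter_upwards [hU.mem_nhds hx] with y hy using h y hy
  rw [h1.extDeriv_eq, extDeriv, fderiv_const_apply]
  ext v
  simp [ContinuousAlternatingMap.alternatizeUncurryFin_apply]

end Bracket

/-- The local data carried by a solution of the variational equations in normalised form: closed
forms `Ω` and `χ` of degrees two and three and vector fields `X`, `Z`, `Y` representing the
four-forms `γ₁`, `γ₂` and `Ω ∧ Ω`, with the algebraic relations that tie them together. The volume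
form enters only through these relations. -/
structure NormalData (ε : ℝ) (U : Set E5) (Ω : E5 → E5 [⋀^Fin 2]→L[ℝ] ℝ)
    (χ : E5 → E5 [⋀^Fin 3]→L[ℝ] ℝ) (X Z Y : E5 → E5) : Prop where
  isOpen : IsOpen U
  smooth_two : ContDiffOn ℝ ∞ Ω U
  smooth_three : ContDiffOn ℝ ∞ χ U
  smooth_X : ContDiffOn ℝ ∞ X U
  smooth_Z : ContDiffOn ℝ ∞ Z U
  smooth_Y : ContDiffOn ℝ ∞ Y U
  closed_two : ∀ y ∈ U, extDeriv Ω y = 0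
  closed_three : ∀ y ∈ U, extDeriv χ y = 0
  closed_X : ∀ y ∈ U, extDeriv (fun y => (Ω y).curryLeft (X y)) y = 0
  closed_Z : ∀ y ∈ U, extDeriv (fun y => (Ω y).curryLeft (Z y)) y = 0
  pairing : ∀ y ∈ U, Ω y ![X y, Z y] = ε / 8
  two_Y : ∀ y ∈ U, (Ω y).curryLeft (Y y) = 0
  three_X : ∀ y ∈ U, (χ y).curryLeft (X y) = 0
  three_Z : ∀ y ∈ U, (χ y).curryLeft (Z y) = 0
  three_Y : ∀ y ∈ U, (χ y).curryLeft (Y y) = -reduced (-ε) (Ω y) (X y) (Z y)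
  eq_zero : ∀ y ∈ U, ∀ z, (Ω y).curryLeft z = 0 → (χ y).curryLeft z = 0 → z = 0

namespace NormalData
variable {ε : ℝ} {U : Set E5} {Ω : E5 → E5 [⋀^Fin 2]→L[ℝ] ℝ} {χ : E5 → E5 [⋀^Fin 3]→L[ℝ] ℝ}
  {X Z Y : E5 → E5}

theorem smooth_reduced (h : NormalData ε U Ω χ X Z Y) :
    ContDiffOn ℝ ∞ (fun y => reduced (-ε) (Ω y) (X y) (Z y)) U :=
  h.smooth_two.add ((contDiffOn_wedge (contDiffOn_curryLeft h.smooth_two h.smooth_X)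
    (contDiffOn_curryLeft h.smooth_two h.smooth_Z)).const_smul (8 * -ε))

theorem closed_reduced (h : NormalData ε U Ω χ X Z Y) {x : E5} (hx : x ∈ U) :
    extDeriv (fun y => reduced (-ε) (Ω y) (X y) (Z y)) x = 0 := by
  have hX := diffAt_of_isOpen h.isOpen (contDiffOn_curryLeft h.smooth_two h.smooth_X) hx
  have hZ := diffAt_of_isOpen h.isOpen (contDiffOn_curryLeft h.smooth_two h.smooth_Z) hx
  have hw := diffAt_of_isOpen h.isOpen (contDiffOn_wedge
      (contDiffOn_curryLeft h.smooth_two h.smooth_X)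
    (contDiffOn_curryLeft h.smooth_two h.smooth_Z)) hx
  have e := extDeriv_fun_add (diffAt_of_isOpen h.isOpen h.smooth_two hx) (hw.const_smul (8 * -ε))
  have e2 := extDeriv_smul (x := x) (8 * -ε)
    (fun y => wedge ((Ω y).curryLeft (X y)) ((Ω y).curryLeft (Z y)))
  rw [extDeriv_wedge_one_one hX hZ (h.closed_X x hx) (h.closed_Z x hx), smul_zero] at e2
  refine e.trans ?_
  rw [h.closed_two x hx, zero_add]
  exact e2

theorem reduced_X (hε : ε * ε = 1) (h : NormalData ε U Ω χ X Z Y) {x : E5} (hx : x ∈ U) :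
    (reduced (-ε) (Ω x) (X x) (Z x)).curryLeft (X x) = 0 :=
  reduced_curryLeft_left (by linarith) (by rw [h.pairing x hx]; ring)

theorem reduced_Z (hε : ε * ε = 1) (h : NormalData ε U Ω χ X Z Y) {x : E5} (hx : x ∈ U) :
    (reduced (-ε) (Ω x) (X x) (Z x)).curryLeft (Z x) = 0 :=
  reduced_curryLeft_right (by linarith) (by rw [h.pairing x hx]; ring)

theorem reduced_Y (h : NormalData ε U Ω χ X Z Y) {x : E5} (hx : x ∈ U) :
    (reduced (-ε) (Ω x) (X x) (Z x)).curryLeft (Y x) = 0 := by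
  have hY : ∀ a, Ω x ![a, Y x] = 0 := fun a => by
    rw [two_form_swap, ← covec_curryLeft_apply, h.two_Y x hx]
    simp [covec_apply]
  rw [reduced_curryLeft, h.two_Y x hx, hY, hY]
  simp

theorem closed_three_Y (h : NormalData ε U Ω χ X Z Y) {x : E5} (hx : x ∈ U) :
    extDeriv (fun y => (χ y).curryLeft (Y y)) x = 0 := by
  have h1 : (fun y => (χ y).curryLeft (Y y)) =ᶠ[𝓝 x]
      ((-1 : ℝ) • fun y => reduced (-ε) (Ω y) (X y) (Z y)) := by
    filter_upwards [h.isOpen.mem_nhds hx] with y hy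
    rw [h.three_Y y hy]
    exact (neg_one_smul ℝ _).symm
  rw [h1.extDeriv_eq, extDeriv_smul, h.closed_reduced hx, smul_zero]

theorem lieBracket_X_Z (h : NormalData ε U Ω χ X Z Y) {x : E5} (hx : x ∈ U) :
    VectorField.lieBracket ℝ X Z x = 0 := by
  have hz : ∀ {n : ℕ} {α : E5 → E5 [⋀^Fin n]→L[ℝ] ℝ}, (∀ y ∈ U, α y = 0) → extDeriv α x = 0 :=
    fun h0 => extDeriv_eq_zero_of_eqOn_const h.isOpen hx h0
  refine h.eq_zero x hx _ ?_ ?_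
  · refine curryLeft_lieBracket_eq_zero (diffAt_of_isOpen h.isOpen h.smooth_two hx)
      (diffAt_of_isOpen h.isOpen h.smooth_X hx) (diffAt_of_isOpen h.isOpen h.smooth_Z hx)
      (h.closed_two x hx)
      (h.closed_X x hx) (h.closed_Z x hx)
      (extDeriv_eq_zero_of_eqOn_const h.isOpen hx (c := zeroForm (-(ε / 8))) fun y hy => ?_)
    ext w
    rw [Subsingleton.elim w ![], ContinuousAlternatingMap.curryLeft_apply_apply,
      ContinuousAlternatingMap.curryLeft_apply_apply, zeroForm_apply, ← h.pairing y hy]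
    exact two_form_swap _ _ _
  · refine curryLeft_lieBracket_eq_zero (diffAt_of_isOpen h.isOpen h.smooth_three hx)
      (diffAt_of_isOpen h.isOpen h.smooth_X hx) (diffAt_of_isOpen h.isOpen h.smooth_Z hx)
      (h.closed_three x hx)
      (hz h.three_X) (hz h.three_Z) (hz fun y hy => ?_)
    rw [h.three_Z y hy, ContinuousAlternatingMap.curryLeft_zero]
    rfl

theorem lieBracket_Y (h : NormalData ε U Ω χ X Z Y) {x : E5} (hx : x ∈ U) {W : E5 → E5}
    (hW : ContDiffOn ℝ ∞ W U) (h2 : ∀ y ∈ U, extDeriv (fun y => (Ω y).curryLeft (W y)) y = 0)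
    (h3 : ∀ y ∈ U, (χ y).curryLeft (W y) = 0)
    (h4 : ∀ y ∈ U, (reduced (-ε) (Ω y) (X y) (Z y)).curryLeft (W y) = 0) :
    VectorField.lieBracket ℝ W Y x = 0 := by
  have hz : ∀ {n : ℕ} {α : E5 → E5 [⋀^Fin n]→L[ℝ] ℝ}, (∀ y ∈ U, α y = 0) → extDeriv α x = 0 :=
    fun h0 => extDeriv_eq_zero_of_eqOn_const h.isOpen hx h0
  refine h.eq_zero x hx _ ?_ ?_
  · refine curryLeft_lieBracket_eq_zero (diffAt_of_isOpen h.isOpen h.smooth_two hx)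
      (diffAt_of_isOpen h.isOpen hW hx) (diffAt_of_isOpen h.isOpen h.smooth_Y hx)
      (h.closed_two x hx)
      (h2 x hx) (hz h.two_Y) (hz fun y hy => ?_)
    rw [h.two_Y y hy, ContinuousAlternatingMap.curryLeft_zero]
    rfl
  · refine curryLeft_lieBracket_eq_zero (diffAt_of_isOpen h.isOpen h.smooth_three hx)
      (diffAt_of_isOpen h.isOpen hW hx) (diffAt_of_isOpen h.isOpen h.smooth_Y hx)
      (h.closed_three x hx)
      (hz h3) (h.closed_three_Y hx) (hz fun y hy => ?_)
    rw [h.three_Y y hy, curryLeft_neg_apply, h4 y hy, neg_zero]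

/-- The three vector fields commute. -/
theorem lieBracket_eq_zero (hε : ε * ε = 1) (h : NormalData ε U Ω χ X Z Y) (i j : Fin 3) {x : E5}
    (hx : x ∈ U) :
    VectorField.lieBracket ℝ ((![X, Z, Y] : Fin 3 → E5 → E5) i) ((![X, Z, Y] : Fin 3 → E5 → E5) j) x
      = 0 := by
  have h1 := h.lieBracket_X_Z hx
  have h2 := h.lieBracket_Y hx h.smooth_X h.closed_X h.three_X fun y hy => h.reduced_X hε hy
  have h3 := h.lieBracket_Y hx h.smooth_Z h.closed_Z h.three_Z fun y hy => h.reduced_Z hε hy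
  have h4 : VectorField.lieBracket ℝ Z X x = 0 := by rw [VectorField.lieBracket_swap, h1, neg_zero]
  have h5 : VectorField.lieBracket ℝ Y X x = 0 := by rw [VectorField.lieBracket_swap, h2, neg_zero]
  have h6 : VectorField.lieBracket ℝ Y Z x = 0 := by rw [VectorField.lieBracket_swap, h3, neg_zero]
  fin_cases i <;> fin_cases j <;> simp [h1, h2, h3, h4, h5, h6]

theorem linearIndependent (hε : ε * ε = 1) (h : NormalData ε U Ω χ X Z Y) {x : E5} (hx : x ∈ U)
    (h0 : reduced (-ε) (Ω x) (X x) (Z x) ≠ 0) : LinearIndependent ℝ ![X x, Z x, Y x] := by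
  have hY : Y x ≠ 0 := fun hY => h0 <| by
    have := h.three_Y x hx
    rw [hY, map_zero] at this
    exact neg_eq_zero.mp this.symm
  have hε0 : ε ≠ 0 := fun h0 => by simp [h0] at hε
  rw [Fintype.linearIndependent_iff]
  intro g hg
  simp only [Fin.sum_univ_three, Matrix.cons_val_zero, Matrix.cons_val_one, Matrix.cons_val] at hg
  have e : g 0 • (Ω x).curryLeft (X x) + g 1 • (Ω x).curryLeft (Z x) = 0 := by
    have := congrArg (Ω x).curryLeft hg
    simpa [h.two_Y x hx] using this
  have e1 := congrArg (fun η : E5 [⋀^Fin 1]→L[ℝ] ℝ => η ![Z x]) e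
  have e2 := congrArg (fun η : E5 [⋀^Fin 1]→L[ℝ] ℝ => η ![X x]) e
  have hp := h.pairing x hx
  simp [two_form_self, two_form_swap (Ω x) (Z x) (X x), hp, hε0] at e1 e2
  rw [e1, e2] at hg
  have e3 : g 2 = 0 := by simpa [hY] using hg
  intro i
  fin_cases i <;> assumption

end NormalData

/-! ### Closed two-forms in two of the coordinates -/

section Coordinates

/-- The map with given components into the model space. -/
def ofComponents (u : Fin 5 → E5 → ℝ) (x : E5) : E5 := ∑ i, u i x • basisVec i

theorem hasFDerivAt_ofComponents {u : Fin 5 → E5 → ℝ} {u' : Fin 5 → E5 →L[ℝ] ℝ} {x : E5}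
    (h : ∀ i, HasFDerivAt (u i) (u' i) x) :
    HasFDerivAt (ofComponents u) (∑ i, (u' i).smulRight (basisVec i)) x :=
  HasFDerivAt.fun_sum fun i _ => (h i).smul_const (basisVec i)

theorem contDiffOn_ofComponents {u : Fin 5 → E5 → ℝ} {U : Set E5}
    (h : ∀ i, ContDiffOn ℝ ∞ (u i) U) : ContDiffOn ℝ ∞ (ofComponents u) U :=
  ContDiffOn.sum fun i _ => (h i).smul contDiffOn_const

theorem sum_smulRight_apply (u : Fin 5 → E5 →L[ℝ] ℝ) (v : E5) :
    (∑ i, (u i).smulRight (basisVec i)) v = ∑ i, u i v • basisVec i := by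
  simp [sum_apply]

theorem coordCovec_sum_smul (c : Fin 5 → ℝ) (i : Fin 5) :
    coordCovec i (∑ j, c j • basisVec j) = c i := by
  simp [coordCovec_basisVec]

theorem clm_ext_basisVec {F : Type*} [AddCommGroup F] [Module ℝ F] [TopologicalSpace F]
    {f g : E5 →L[ℝ] F} (h : ∀ i, f (basisVec i) = g (basisVec i)) : f = g := by
  ext x
  rw [← basisVec_expansion x]
  simp only [map_sum, map_smul, h]

theorem two_form_ext {β γ : E5 [⋀^Fin 2]→L[ℝ] ℝ}
    (h : ∀ i j, β ![basisVec i, basisVec j] = γ ![basisVec i, basisVec j]) : β = γ := by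
  refine curryLeft_injective fun x => ?_
  have : β.curryLeft = γ.curryLeft := clm_ext_basisVec fun i => by
    rw [← oneForm_covec (β.curryLeft _), ← oneForm_covec (γ.curryLeft _)]
    congr 1
    refine clm_ext_basisVec fun j => ?_
    rw [covec_curryLeft_apply, covec_curryLeft_apply, h]
  rw [this]

/-- A two-form annihilated by the first three coordinate vectors is the product of `dx₅` with a
covector `ξ` which has the right value on the fourth coordinate vector and vanishes on the first
three; its value on the fifth one is immaterial. -/
theorem two_form_eq_wedge_dx (β : E5 [⋀^Fin 2]→L[ℝ] ℝ) (h0 : β.curryLeft (basisVec 0) = 0)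
    (h1 : β.curryLeft (basisVec 1) = 0) (h2 : β.curryLeft (basisVec 2) = 0) (ξ : E5 →L[ℝ] ℝ)
    (hξ : ∀ j, j < 3 → ξ (basisVec j) = 0) (h3 : ξ (basisVec 3) = β ![basisVec 3, basisVec 4]) :
    β = wedge (oneForm ξ) (dx 4) := by
  have hz : ∀ i j, i < 3 → β ![basisVec i, basisVec j] = 0 := fun i j hi => by
    rw [← covec_curryLeft_apply]
    have : β.curryLeft (basisVec i) = 0 := by
      obtain rfl | rfl | rfl : i = 0 ∨ i = 1 ∨ i = 2 := by omega
      exacts [h0, h1, h2]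
    rw [this]
    simp [covec_apply]
  have key : ∀ i j, β ![basisVec i, basisVec j] =
      ξ (basisVec i) * coordCovec 4 (basisVec j) - ξ (basisVec j) * coordCovec 4 (basisVec i) := by
    intro i j
    rw [coordCovec_basisVec, coordCovec_basisVec]
    by_cases hi : i < 3
    · rw [hz i j hi, hξ i hi, if_neg (by omega : (4 : Fin 5) ≠ i)]
      simp
    by_cases hj : j < 3
    · rw [two_form_swap, hz j i hj, hξ j hj, if_neg (by omega : (4 : Fin 5) ≠ j)]
      simp
    obtain rfl | rfl : i = 3 ∨ i = 4 := by omega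
    · obtain rfl | rfl : j = 3 ∨ j = 4 := by omega
      · simp [two_form_self]
      · simp [h3]
    · obtain rfl | rfl : j = 3 ∨ j = 4 := by omega
      · rw [two_form_swap, ← h3]
        simp
      · simp [two_form_self]
  refine two_form_ext fun i j => (key i j).trans (wedge_one_one_apply (oneForm ξ) (dx 4) _ _).symm

/-- A closed two-form annihilated by the first three coordinate vectors is, near a point where it
does not vanish, of the form `df ∧ dx₅` with `f` independent of the first three coordinates. -/
theorem exists_eq_fderiv_wedge_dx {V : Set E5} (hV : IsOpen V) {a : E5} (ha : a ∈ V)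
    {β : E5 → E5 [⋀^Fin 2]→L[ℝ] ℝ} (hβ : ContDiffOn ℝ ∞ β V) (hc : ∀ z ∈ V, extDeriv β z = 0)
    (hi : ∀ z ∈ V, ∀ j, j < 3 → (β z).curryLeft (basisVec j) = 0) (h0 : β a ≠ 0) :
    ∃ W : Set E5, IsOpen W ∧ a ∈ W ∧ W ⊆ V ∧ ∃ (f : E5 → ℝ) (f' : E5 → E5 →L[ℝ] ℝ),
      ContDiffOn ℝ ∞ f W ∧ ∀ z ∈ W, HasFDerivAt f (f' z) z ∧
        (∀ j, j < 3 → f' z (basisVec j) = 0) ∧ f' z (basisVec 3) ≠ 0 ∧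
        β z = wedge (oneForm (f' z)) (dx 4) := by
  set h : E5 → ℝ := fun z => β z ![basisVec 3, basisVec 4] with hh
  have hhs : ContDiffOn ℝ ∞ h V := contDiffOn_clm_comp (F := E5 [⋀^Fin 2]→L[ℝ] ℝ) (G := ℝ)
    (ContinuousAlternatingMap.apply ℝ E5 ℝ ![basisVec 3, basisVec 4]) hβ
  have hha : h a ≠ 0 := fun h1 => h0 <| by
    rw [two_form_eq_wedge_dx (β a) (hi a ha 0 (by decide)) (hi a ha 1 (by decide))
      (hi a ha 2 (by decide)) 0 (fun _ _ => rfl) h1.symm]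
    exact wedge_zero_form_left _
  -- by Cartan's formula the coefficient `h` does not depend on the first three coordinates
  have hd : ∀ z ∈ V, ∀ j, j < 3 → fderiv ℝ h z (basisVec j) = 0 := fun z hz j hj => by
    have hβz := diffAt_of_isOpen hV hβ hz
    have e1 := lieForm_eq_extDeriv (X := fun _ => basisVec j) hβz
      (differentiableAt_const _) (hc z hz) ![basisVec 3, basisVec 4]
    rw [extDeriv_eq_zero_of_eqOn_const hV hz fun y hy => hi y hy j hj, lieForm] at e1
    have e2 : HasFDerivAt h _ z := hasFDerivAt_clm_comp (F := E5 [⋀^Fin 2]→L[ℝ] ℝ) (G := ℝ)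
      (ContinuousAlternatingMap.apply ℝ E5 ℝ ![basisVec 3, basisVec 4]) hβz.hasFDerivAt
    rw [e2.fderiv]
    refine Eq.trans ?_ e1
    have e3 : ∀ (α : E5 [⋀^Fin 2]→L[ℝ] ℝ) (u : Fin 1 → E5), α (Matrix.vecCons 0 u) = 0 :=
      fun α u => α.map_coord_zero 0 rfl
    simp [e3]
  obtain ⟨W₀, hW₀, hW₀V⟩ : ∃ W₀ : Set E5, IsOpen W₀ ∧ W₀ = V ∩ {z | h z ≠ 0} :=
    ⟨_, hhs.continuousOn.isOpen_inter_preimage hV isOpen_ne, rfl⟩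
  have haW : a ∈ W₀ := hW₀V ▸ ⟨ha, hha⟩
  have hsub : W₀ ⊆ V := hW₀V ▸ inter_subset_left
  have hne : ∀ z ∈ W₀, h z ≠ 0 := fun z hz => (hW₀V ▸ hz : z ∈ V ∩ {z | h z ≠ 0}).2
  have hinv : ContDiffOn ℝ ∞ (fun z => (h z)⁻¹) W₀ := (hhs.mono hsub).inv hne
  -- straightening `h⁻¹ ∂₄` together with the first three coordinate fields gives a function `f`
  -- with `∂₄ f = h` which does not depend on the first three coordinates
  let X : Fin 4 → E5 → E5 := ![fun _ => basisVec 0, fun _ => basisVec 1, fun _ => basisVec 2,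
    fun z => (h z)⁻¹ • basisVec 3]
  have hX : ∀ j, ContDiffOn ℝ ∞ (X j) W₀ := by
    intro j
    fin_cases j
    · exact contDiffOn_const
    · exact contDiffOn_const
    · exact contDiffOn_const
    · exact hinv.smul contDiffOn_const
  have hlin : LinearIndependent ℝ fun j => X j a := by
    rw [Fintype.linearIndependent_iff]
    intro g hg
    have hg' : ∀ i, coordCovec i (∑ j, g j • X j a) = 0 := fun i => by rw [hg, map_zero]
    have q0 := hg' 0
    have q1 := hg' 1
    have q2 := hg' 2
    have q3 := hg' 3
    simp [Fin.sum_univ_four, X, coordCovec_basisVec, hha] at q0 q1 q2 q3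
    intro i
    fin_cases i <;> assumption
  obtain ⟨T, hT⟩ := exists_linearEquiv_of_linearIndependent 1 (by norm_num) (by norm_num) hlin
  have hb3 : ∀ z ∈ W₀, ∀ j, j < 3 →
      VectorField.lieBracket ℝ (fun _ : E5 => basisVec j)
        (fun z => (h z)⁻¹ • basisVec 3) z = 0 := by
    intro z hz j hj
    have hdz := (diffAt_of_isOpen hV hhs (hsub hz)).hasFDerivAt
    have e2 := ((hasDerivAt_inv (hne z hz)).comp_hasFDerivAt z hdz).smul_const (basisVec 3)
    change HasFDerivAt (fun z => (h z)⁻¹ • basisVec 3) _ z at e2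
    rw [VectorField.lieBracket, HasFDerivAt.fderiv e2]
    simp [hd z (hsub hz) j hj]
  have hb3' : ∀ z ∈ W₀, ∀ j, j < 3 →
      VectorField.lieBracket ℝ (fun z => (h z)⁻¹ • basisVec 3)
        (fun _ : E5 => basisVec j) z = 0 := by
    intro z hz j hj
    rw [VectorField.lieBracket_swap, hb3 z hz j hj, neg_zero]
  have hcomm : ∀ i j, ∀ x ∈ W₀, VectorField.lieBracket ℝ (X i) (X j) x = 0 := by
    have hcc : ∀ (u v : E5) (x : E5),
        VectorField.lieBracket ℝ (fun _ : E5 => u) (fun _ => v) x = 0 := fun u v x => by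
      simp [VectorField.lieBracket]
    intro i j x hx
    fin_cases i <;> fin_cases j <;>
      first
      | exact hcc _ _ _
      | exact congrFun VectorField.lieBracket_self x
      | exact hb3 x hx 0 (by decide)
      | exact hb3 x hx 1 (by decide)
      | exact hb3 x hx 2 (by decide)
      | exact hb3' x hx 0 (by decide)
      | exact hb3' x hx 1 (by decide)
      | exact hb3' x hx 2 (by decide)
  obtain ⟨e, he0, hea, heW, hes, hes', hL⟩ := exists_straightening (Fin.castLE (by norm_num))
    (Fin.castLE_injective _) X hW₀ hX hcomm haW T hT
  refine ⟨e.target, e.open_target, hea ▸ e.map_source he0, heW.trans hsub,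
    fun z => coordCovec 3 (e.symm z), fun z => fderiv ℝ (fun z => coordCovec 3 (e.symm z)) z,
    contDiffOn_clm_comp _ hes', fun z hz => ?_⟩
  obtain ⟨L, -, hLs, hLX⟩ := hL (e.symm z) (e.map_target hz)
  rw [e.right_inv hz] at hLs hLX
  have hf := hasFDerivAt_clm_comp (coordCovec 3) hLs
  have hs : ∀ j, L.symm (X j z) = basisVec (Fin.castLE (by norm_num) j) := fun j => by
    rw [← hLX j, L.symm_apply_apply]
  beta_reduce
  rw [hf.fderiv]
  have k0 : L.symm (basisVec 0) = basisVec 0 := hs 0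
  have k1 : L.symm (basisVec 1) = basisVec 1 := hs 1
  have k2 : L.symm (basisVec 2) = basisVec 2 := hs 2
  have k3 : L.symm ((h z)⁻¹ • basisVec 3) = basisVec 3 := hs 3
  have hzn := hne z (heW hz)
  have f3 : coordCovec 3 (L.symm (basisVec 3)) = h z := by
    have : basisVec 3 = h z • ((h z)⁻¹ • basisVec 3) := by
      rw [smul_smul, mul_inv_cancel₀ hzn, one_smul]
    rw [this, map_smul, k3]
    simp [coordCovec_basisVec]
  have fj : ∀ j, j < 3 →
      ((coordCovec 3).comp (L.symm : E5 →L[ℝ] E5)) (basisVec j) = 0 := fun j hj => by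
    obtain rfl | rfl | rfl : j = 0 ∨ j = 1 ∨ j = 2 := by omega
    · simp [k0, coordCovec_basisVec]
    · simp [k1, coordCovec_basisVec]
    · simp [k2, coordCovec_basisVec]
  have hzV := hsub (heW hz)
  refine ⟨hf, fj, ?_, ?_⟩
  · change coordCovec 3 (L.symm (basisVec 3)) ≠ 0
    rwa [f3]
  · exact two_form_eq_wedge_dx (β z) (hi z hzV 0 (by decide)) (hi z hzV 1 (by decide))
      (hi z hzV 2 (by decide)) _ fj f3

end Coordinates

/-! ### Normal coordinates for the two-form -/

/-- Covectors and one-forms are the same, as a continuous linear equivalence. -/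
def oneFormEquiv (E : Type*) [NormedAddCommGroup E] [NormedSpace ℝ E] :
    (E →L[ℝ] ℝ) ≃L[ℝ] (E [⋀^Fin 1]→L[ℝ] ℝ) :=
  LinearIsometryEquiv.toContinuousLinearEquiv
    (ContinuousAlternatingMap.ofSubsingletonLIE (𝕜 := ℝ) (E := E) (F := ℝ) (0 : Fin 1))

theorem contDiffOn_covec {E F : Type*} [NormedAddCommGroup E] [NormedSpace ℝ E]
    [NormedAddCommGroup F] [NormedSpace ℝ F] {θ : F → E [⋀^Fin 1]→L[ℝ] ℝ} {U : Set F}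
    (h : ContDiffOn ℝ ∞ θ U) : ContDiffOn ℝ ∞ (fun y => covec (θ y)) U :=
  contDiffOn_clm_comp (F := E [⋀^Fin 1]→L[ℝ] ℝ) (G := E →L[ℝ] ℝ)
    (oneFormEquiv E).symm.toContinuousLinearMap h

theorem contDiffOn_oneForm {E F : Type*} [NormedAddCommGroup E] [NormedSpace ℝ E]
    [NormedAddCommGroup F] [NormedSpace ℝ F] {θ : F → E →L[ℝ] ℝ} {U : Set F}
    (h : ContDiffOn ℝ ∞ θ U) : ContDiffOn ℝ ∞ (fun y => oneForm (θ y)) U :=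
  contDiffOn_clm_comp (F := E →L[ℝ] ℝ) (G := E [⋀^Fin 1]→L[ℝ] ℝ)
    (oneFormEquiv E).toContinuousLinearMap h

/-- The pull-back of a smooth family of two-forms by a smooth family of linear maps is smooth:
two-forms are sums of products of one-forms, on which pull-back is composition. -/
theorem contDiffOn_pullback_two {U : Set E5} {L : E5 → E5 →L[ℝ] E5} (hL : ContDiffOn ℝ ∞ L U)
    {η : E5 → E5 [⋀^Fin 2]→L[ℝ] ℝ} (hη : ContDiffOn ℝ ∞ η U) :
    ContDiffOn ℝ ∞ (fun y => (η y).compContinuousLinearMap (L y)) U := by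
  have h1 : ∀ y, (η y).compContinuousLinearMap (L y) = (2⁻¹ : ℝ) • ∑ j,
      wedge (oneForm ((coordCovec j).comp (L y)))
        (oneForm ((covec ((η y).curryLeft (basisVec j))).comp (L y))) := fun y => by
    have e1 := sum_coord_wedge_curryLeft (η y)
    have e2 : η y = (2⁻¹ : ℝ) • ∑ j, wedge (oneForm (coordCovec j))
        (oneForm (covec ((η y).curryLeft (basisVec j)))) := by
      simp only [oneForm_covec]
      rw [e1]
      ext v
      simp only [ContinuousAlternatingMap.smul_apply, smul_eq_mul]
      push_cast
      ring
    conv_lhs => rw [e2]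
    ext v
    simp only [ContinuousAlternatingMap.compContinuousLinearMap_apply,
      ContinuousAlternatingMap.smul_apply, ContinuousAlternatingMap.sum_apply]
    congr 1
    refine Finset.sum_congr rfl fun j _ => ?_
    exact (congrArg (fun γ => γ v) (wedge_compContinuousLinearMap (L y) (oneForm (coordCovec j))
      (oneForm (covec ((η y).curryLeft (basisVec j)))))).symm
  simp only [h1]
  refine ContDiffOn.const_smul (2⁻¹ : ℝ) (ContDiffOn.sum fun j _ => contDiffOn_wedge
    (contDiffOn_oneForm (contDiffOn_const.clm_comp hL))
    (contDiffOn_oneForm (ContDiffOn.clm_comp (contDiffOn_covec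
      (contDiffOn_curryLeft hη contDiffOn_const)) hL)))

/-- A closed one-form has a primitive near each point. -/
theorem exists_local_primitive {U : Set E5} (hU : IsOpen U) {q : E5} (hq : q ∈ U)
    {θ : E5 → E5 [⋀^Fin 1]→L[ℝ] ℝ} (hθ : ContDiffOn ℝ ∞ θ U) (hc : ∀ y ∈ U, extDeriv θ y = 0) :
    ∃ r > 0, Metric.ball q r ⊆ U ∧ ∃ f : E5 → ℝ, ContDiffOn ℝ ∞ f (Metric.ball q r) ∧
      ∀ y ∈ Metric.ball q r, HasFDerivAt f (covec (θ y)) y := by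
  obtain ⟨r, hr, hrU⟩ := Metric.isOpen_iff.mp hU q hq
  have hs : ContDiffOn ℝ ∞ (fun y => covec (θ y)) U := contDiffOn_covec hθ
  obtain ⟨f, hf⟩ := (convex_ball q r).exists_forall_hasFDerivAt_of_fderiv_symmetric
    Metric.isOpen_ball ((hs.mono hrU).differentiableOn (by simp))
    fun a ha x y => by
      have h1 : HasFDerivAt (fun y => covec (θ y)) _ a :=
        hasFDerivAt_clm_comp (F := E5 [⋀^Fin 1]→L[ℝ] ℝ) (G := E5 →L[ℝ] ℝ)
          (oneFormEquiv E5).symm.toContinuousLinearMap (diffAt_of_isOpen hU hθ (hrU ha)).hasFDerivAt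
      rw [h1.fderiv]
      change covec (fderiv ℝ θ a x) y = covec (fderiv ℝ θ a y) x
      rw [covec_apply, covec_apply]
      exact fderiv_apply_comm_of_extDeriv_eq_zero (hc a (hrU ha)) x y
  refine ⟨r, hr, hrU, f, ?_, hf⟩
  have h2 : ContDiffOn ℝ (∞ + 1) f (Metric.ball q r) := by
    rw [contDiffOn_succ_iff_hasFDerivWithinAt_of_uniqueDiffOn Metric.isOpen_ball.uniqueDiffOn]
    exact ⟨by simp, _, hs.mono hrU, fun y hy => (hf y hy).hasFDerivWithinAt⟩
  simpa using h2

theorem dx_comp (i : Fin 5) (L : E5 →L[ℝ] E5) :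
    (dx i).compContinuousLinearMap L = oneForm ((coordCovec i).comp L) := rfl

/-- Coordinates in which `Ω` is the standard two-form and the three commuting fields are constant,
near a point where the reduced two-form does not vanish. -/
theorem exists_normal_coordinates {ε : ℝ} (hε : ε * ε = 1) {U : Set E5}
    {Ω : E5 → E5 [⋀^Fin 2]→L[ℝ] ℝ} {χ : E5 → E5 [⋀^Fin 3]→L[ℝ] ℝ} {X Z Y : E5 → E5}
    (h : NormalData ε U Ω χ X Z Y) {q : E5} (hq : q ∈ U)
    (h0 : reduced (-ε) (Ω q) (X q) (Z q) ≠ 0) :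
    ∃ e : OpenPartialHomeomorph E5 E5, q ∈ e.source ∧ e.source ⊆ U ∧ ContDiffOn ℝ ∞ e e.source ∧
      ContDiffOn ℝ ∞ e.symm e.target ∧ ∀ x ∈ e.source, ∃ L : E5 ≃L[ℝ] E5,
        HasFDerivAt e (L : E5 →L[ℝ] E5) x ∧ HasFDerivAt e.symm (L.symm : E5 →L[ℝ] E5) (e x) ∧
        L (X x) = -(ε / √8) • basisVec 1 ∧ L (Z x) = (1 / √8) • basisVec 0 ∧
        L (Y x) = (2 / √8) • basisVec 4 ∧
        Ω x = (wedge (dx 0) (dx 1) + wedge (dx 2) (dx 3)).compContinuousLinearMap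
          (L : E5 →L[ℝ] E5) := by
  have hε0 : ε ≠ 0 := fun h0 => by simp [h0] at hε
  set m : ℝ := √8 with hm
  have hmm : m * m = 8 := Real.mul_self_sqrt (by norm_num)
  have hm0 : m ≠ 0 := fun h => by simp [h] at hmm
  -- coordinates in which the commuting fields are coordinate fields
  have hXs : ∀ j, ContDiffOn ℝ ∞ ((![X, Z, Y] : Fin 3 → E5 → E5) j) U := fun j => by
    fin_cases j
    exacts [h.smooth_X, h.smooth_Z, h.smooth_Y]
  have hli : LinearIndependent ℝ fun j => (![X, Z, Y] : Fin 3 → E5 → E5) j q := by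
    convert h.linearIndependent hε hq h0 using 1
    ext j : 1
    fin_cases j <;> rfl
  obtain ⟨T, hT⟩ := exists_linearEquiv_of_linearIndependent 2 (by norm_num) (by norm_num) hli
  obtain ⟨e₁, h10, h1q, h1U, h1s, h1s', h1L⟩ := exists_straightening (Fin.castLE (by norm_num))
    (Fin.castLE_injective _) _ h.isOpen hXs (fun i j x hx => h.lieBracket_eq_zero hε i j hx) hq T hT
  -- the reduced form in these coordinates
  let β : E5 → E5 [⋀^Fin 2]→L[ℝ] ℝ := fun z =>
    (reduced (-ε) (Ω (e₁ z)) (X (e₁ z)) (Z (e₁ z))).compContinuousLinearMap (fderiv ℝ e₁ z)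
  have hβs : ContDiffOn ℝ ∞ β e₁.source :=
    contDiffOn_pullback_two (h1s.fderiv_of_isOpen e₁.open_source (by simp))
      (h.smooth_reduced.comp h1s fun z hz => h1U (e₁.map_source hz))
  have hβc : ∀ z ∈ e₁.source, extDeriv β z = 0 := fun z hz => by
    have hz' := h1U (e₁.map_source hz)
    refine (extDeriv_pullback (f := e₁) (r := ∞)
      (diffAt_of_isOpen h.isOpen h.smooth_reduced hz')
      (h1s.contDiffAt (e₁.open_source.mem_nhds hz))
      (by simpa using WithTop.coe_le_coe.mpr (le_top : (2 : ℕ∞) ≤ ⊤))).trans ?_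
    rw [h.closed_reduced hz']
    rfl
  have hβcurry : ∀ z v, (β z).curryLeft v = ((reduced (-ε) (Ω (e₁ z)) (X (e₁ z))
      (Z (e₁ z))).curryLeft (fderiv ℝ e₁ z v)).compContinuousLinearMap (fderiv ℝ e₁ z) := by
    intro z v
    ext w
    change (reduced (-ε) (Ω (e₁ z)) (X (e₁ z)) (Z (e₁ z))) _ =
      (reduced (-ε) (Ω (e₁ z)) (X (e₁ z)) (Z (e₁ z))) _
    congr 1
    ext i : 1
    refine Fin.cases rfl (fun i => rfl) i
  have hβi : ∀ z ∈ e₁.source, ∀ j, j < 3 → (β z).curryLeft (basisVec j) = 0 := fun z hz j hj => by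
    obtain ⟨L, hL, -, hLX⟩ := h1L z hz
    have hz' := h1U (e₁.map_source hz)
    rw [hβcurry, hL.fderiv]
    have hk : (reduced (-ε) (Ω (e₁ z)) (X (e₁ z)) (Z (e₁ z))).curryLeft (L (basisVec j)) = 0 := by
      obtain rfl | rfl | rfl : j = 0 ∨ j = 1 ∨ j = 2 := by omega
      · rw [← h.reduced_X hε hz']; exact congrArg _ (hLX 0)
      · rw [← h.reduced_Z hε hz']; exact congrArg _ (hLX 1)
      · rw [← h.reduced_Y hz']; exact congrArg _ (hLX 2)
    exact (congrArg (fun η : E5 [⋀^Fin 1]→L[ℝ] ℝ => η.compContinuousLinearMap _) hk).trans rfl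
  have hβback : ∀ z ∈ e₁.source, ∀ L : E5 ≃L[ℝ] E5, HasFDerivAt e₁ (L : E5 →L[ℝ] E5) z →
      reduced (-ε) (Ω (e₁ z)) (X (e₁ z)) (Z (e₁ z)) =
        (β z).compContinuousLinearMap (L.symm : E5 →L[ℝ] E5) := fun z hz L hL => by
    ext v
    simp only [β, hL.fderiv, ContinuousAlternatingMap.compContinuousLinearMap_apply]
    congr 1
    ext i : 1
    simp
  have hβ0 : β 0 ≠ 0 := fun hb => h0 <| by
    obtain ⟨L, hL, -, -⟩ := h1L 0 h10
    have := hβback 0 h10 L hL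
    rw [hb, h1q] at this
    exact this
  obtain ⟨W, hW, h0W, hWs, f, f', hfs, hf⟩ :=
    exists_eq_fderiv_wedge_dx e₁.open_source h10 hβs hβc hβi hβ0
  -- primitives of the contractions of `Ω`
  obtain ⟨r₁, hr₁, hr₁U, f₁, hf₁s, hf₁⟩ := exists_local_primitive h.isOpen hq
    (contDiffOn_curryLeft h.smooth_two h.smooth_X) h.closed_X
  obtain ⟨r₂, hr₂, hr₂U, f₂, hf₂s, hf₂⟩ := exists_local_primitive h.isOpen hq
    (contDiffOn_curryLeft h.smooth_two h.smooth_Z) h.closed_Z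
  -- the set on which all five coordinates are defined
  obtain ⟨N, hNo, hN⟩ : ∃ N : Set E5, IsOpen N ∧ N =
      (e₁.target ∩ e₁.symm ⁻¹' W) ∩ (Metric.ball q r₁ ∩ Metric.ball q r₂) :=
    ⟨_, (e₁.symm.isOpen_inter_preimage hW).inter (Metric.isOpen_ball.inter Metric.isOpen_ball), rfl⟩
  have hqt : q ∈ e₁.target := h1q ▸ e₁.map_source h10
  have hqs : e₁.symm q = 0 := by rw [← h1q, e₁.left_inv h10]
  have hqN : q ∈ N := by
    rw [hN]
    exact ⟨⟨hqt, by rw [mem_preimage, hqs]; exact h0W⟩, Metric.mem_ball_self hr₁,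
      Metric.mem_ball_self hr₂⟩
  have hN' : ∀ x ∈ N, x ∈ e₁.target ∧ e₁.symm x ∈ W ∧ x ∈ Metric.ball q r₁ ∧
      x ∈ Metric.ball q r₂ := fun x hx => by
    rw [hN] at hx
    exact ⟨hx.1.1, hx.1.2, hx.2.1, hx.2.2⟩
  -- as `m ^ 2 = 8`, the first two coordinates satisfy `du₁ ∧ du₂ = 8 ε θ₁ ∧ θ₂`; the factor of the
  -- last one makes `Y` the vector of `Ω ∧ Ω` for the volume form with coefficient `m`
  let u : Fin 5 → E5 → ℝ := ![fun x => (ε * m) * f₁ x, fun x => m * f₂ x, fun x => f (e₁.symm x),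
    fun x => coordCovec 4 (e₁.symm x), fun x => (2 / m) * coordCovec 2 (e₁.symm x)]
  have h1s'N : ContDiffOn ℝ ∞ e₁.symm N := h1s'.mono fun x hx => (hN' x hx).1
  have hus : ∀ i, ContDiffOn ℝ ∞ (u i) N := by
    intro i
    fin_cases i
    · exact contDiffOn_const.mul (hf₁s.mono fun x hx => (hN' x hx).2.2.1)
    · exact contDiffOn_const.mul (hf₂s.mono fun x hx => (hN' x hx).2.2.2)
    · exact hfs.comp h1s'N fun x hx => (hN' x hx).2.1
    · exact contDiffOn_clm_comp _ h1s'N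
    · exact contDiffOn_const.mul (contDiffOn_clm_comp (coordCovec 2) h1s'N)
  -- the derivative of these coordinates
  have hder : ∀ x ∈ N, ∃ u' : Fin 5 → E5 →L[ℝ] ℝ, (∀ i, HasFDerivAt (u i) (u' i) x) ∧
      (∀ v, (∀ i, u' i v = 0) → v = 0) ∧
      (∑ i, u' i (X x) • basisVec i = -(ε / m) • basisVec 1) ∧
      (∑ i, u' i (Z x) • basisVec i = (1 / m) • basisVec 0) ∧
      (∑ i, u' i (Y x) • basisVec i = (2 / m) • basisVec 4) ∧
      Ω x = wedge (oneForm (u' 0)) (oneForm (u' 1)) + wedge (oneForm (u' 2)) (oneForm (u' 3)) := by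
    intro x hx
    obtain ⟨hx1, hxW, hxr₁, hxr₂⟩ := hN' x hx
    have hxU := h1U hx1
    obtain ⟨L, hL, hLs, hLX⟩ := h1L (e₁.symm x) (e₁.map_target hx1)
    have hback := hβback (e₁.symm x) (e₁.map_target hx1) L hL
    rw [e₁.right_inv hx1] at hLs hLX hback
    obtain ⟨hfd, hfj, hf3, hβe⟩ := hf (e₁.symm x) hxW
    have lX : L.symm (X x) = basisVec 0 := by rw [L.symm_apply_eq]; exact (hLX 0).symm
    have lZ : L.symm (Z x) = basisVec 1 := by rw [L.symm_apply_eq]; exact (hLX 1).symm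
    have lY : L.symm (Y x) = basisVec 2 := by rw [L.symm_apply_eq]; exact (hLX 2).symm
    have hp := h.pairing x hxU
    have hp' : Ω x ![Z x, X x] = -(ε / 8) := by rw [two_form_swap, hp]
    have hYz : ∀ a, Ω x ![a, Y x] = 0 := fun a => by
      rw [two_form_swap, ← covec_curryLeft_apply, h.two_Y x hxU]
      simp [covec_apply]
    have a0 := hfj 0 (by decide)
    have a1 := hfj 1 (by decide)
    have a2 := hfj 2 (by decide)
    let u' : Fin 5 → E5 →L[ℝ] ℝ := ![(ε * m) • covec ((Ω x).curryLeft (X x)),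
      m • covec ((Ω x).curryLeft (Z x)), (f' (e₁.symm x)).comp (L.symm : E5 →L[ℝ] E5),
      (coordCovec 4).comp (L.symm : E5 →L[ℝ] E5),
      (2 / m) • (coordCovec 2).comp (L.symm : E5 →L[ℝ] E5)]
    have u0 : ∀ v, u' 0 v = ε * m * Ω x ![X x, v] := fun v => by
      rw [← covec_curryLeft_apply]; rfl
    have u1 : ∀ v, u' 1 v = m * Ω x ![Z x, v] := fun v => by
      rw [← covec_curryLeft_apply]; rfl
    have u2 : ∀ v, u' 2 v = f' (e₁.symm x) (L.symm v) := fun v => rfl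
    have u3 : ∀ v, u' 3 v = coordCovec 4 (L.symm v) := fun v => rfl
    have u4 : ∀ v, u' 4 v = (2 / m) * coordCovec 2 (L.symm v) := fun v => rfl
    refine ⟨u', fun i => ?_, fun v hv => ?_, ?_, ?_, ?_, ?_⟩
    · fin_cases i
      · exact (hf₁ x hxr₁).const_mul _
      · exact (hf₂ x hxr₂).const_mul _
      · exact hfd.comp x hLs
      · exact hasFDerivAt_clm_comp (coordCovec 4) hLs
      · exact (hasFDerivAt_clm_comp (coordCovec 2) hLs).const_mul _
    · have v0 := hv 0
      have v1 := hv 1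
      have v2 := hv 2
      have v3 := hv 3
      have v4 := hv 4
      rw [u0] at v0
      rw [u1] at v1
      rw [u2] at v2
      rw [u3] at v3
      rw [u4] at v4
      have hexp := basisVec_expansion (L.symm v)
      rw [Fin.sum_univ_five] at hexp
      have c2 : coordCovec 2 (L.symm v) = 0 := by simpa [hm0] using v4
      rw [← hexp, v3, c2] at v2
      have c3 : coordCovec 3 (L.symm v) = 0 := by simpa [a0, a1, a2, hf3] using v2
      rw [v3, c2, c3] at hexp
      have hv' : v = coordCovec 0 (L.symm v) • X x + coordCovec 1 (L.symm v) • Z x := by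
        apply L.symm.injective
        simp only [map_add, map_smul, lX, lZ]
        simpa using hexp.symm
      rw [hv', two_form_add_right, two_form_smul_right, two_form_smul_right, two_form_self,
        hp] at v0
      rw [hv', two_form_add_right, two_form_smul_right, two_form_smul_right, two_form_self,
        hp'] at v1
      have c0 : coordCovec 0 (L.symm v) = 0 := by simpa [hm0, hε0] using v1
      have c1 : coordCovec 1 (L.symm v) = 0 := by simpa [hm0, hε0] using v0
      rw [hv', c0, c1]
      simp
    · have w1 : m * (ε / 8) = ε / m := by
        field_simp
        linear_combination hmm
      simp [Fin.sum_univ_five, u0, u1, u2, u3, u4, lX, two_form_self, hp', a0, coordCovec_basisVec]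
      rw [w1]
    · have w1 : ε * m * (ε / 8) = m⁻¹ := by
        field_simp
        linear_combination m * m * hε + hmm
      simp [Fin.sum_univ_five, u0, u1, u2, u3, u4, lZ, two_form_self, hp, a1, coordCovec_basisVec]
      rw [w1]
    · simp [Fin.sum_univ_five, u0, u1, u2, u3, u4, lY, hYz, a2, coordCovec_basisVec]
    · have e1 : wedge (oneForm (u' 0)) (oneForm (u' 1)) =
          (8 * ε) • wedge ((Ω x).curryLeft (X x)) ((Ω x).curryLeft (Z x)) := by
        have q0 : oneForm (u' 0) = (ε * m) • (Ω x).curryLeft (X x) := by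
          rw [← oneForm_covec ((Ω x).curryLeft (X x))]; rfl
        have q1 : oneForm (u' 1) = m • (Ω x).curryLeft (Z x) := by
          rw [← oneForm_covec ((Ω x).curryLeft (Z x))]; rfl
        rw [q0, q1, wedge_smul_left, wedge_smul_right, smul_smul]
        congr 1
        linear_combination ε * hmm
      have e2 : wedge (oneForm (u' 2)) (oneForm (u' 3)) =
          reduced (-ε) (Ω x) (X x) (Z x) := by
        rw [hback, hβe, ← wedge_compContinuousLinearMap]
        rfl
      rw [e1, e2, reduced]
      module
  obtain ⟨u', hu', hinj, -⟩ := hder q hqN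
  obtain ⟨D, hD⟩ : ∃ D : E5 ≃L[ℝ] E5, (D : E5 →L[ℝ] E5) = ∑ i, (u' i).smulRight (basisVec i) := by
    have hi : Function.Injective (∑ i, (u' i).smulRight (basisVec i) : E5 →L[ℝ] E5) := by
      rw [injective_iff_map_eq_zero]
      intro v hv
      rw [sum_smulRight_apply] at hv
      refine hinj v fun i => ?_
      rw [← coordCovec_sum_smul (fun i => u' i v) i, hv, map_zero]
    refine ⟨LinearEquiv.toContinuousLinearEquiv (LinearEquiv.ofInjectiveEndo
      ((∑ i, (u' i).smulRight (basisVec i) : E5 →L[ℝ] E5) : E5 →ₗ[ℝ] E5) hi), ?_⟩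
    ext v
    rfl
  obtain ⟨e, hqe, heN, hee, hes, hed⟩ := exists_smooth_local_inverse hNo
    (contDiffOn_ofComponents hus) hqN D (hD ▸ hasFDerivAt_ofComponents hu')
  have hNU : N ⊆ U := fun x hx => h1U (hN' x hx).1
  refine ⟨e, hqe, heN.trans hNU, hee ▸ (contDiffOn_ofComponents hus).mono heN, hes,
    fun x hx => ?_⟩
  obtain ⟨L, hL, hLs⟩ := hed x hx
  obtain ⟨w', hw', -, hwX, hwZ, hwY, hwΩ⟩ := hder x (heN hx)
  have hLw : (L : E5 →L[ℝ] E5) = ∑ i, (w' i).smulRight (basisVec i) :=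
    hL.unique (hasFDerivAt_ofComponents hw')
  have hLa : ∀ v, L v = ∑ i, w' i v • basisVec i := fun v => by
    rw [← sum_smulRight_apply, ← hLw]
    rfl
  have hc : ∀ i, (coordCovec i).comp (L : E5 →L[ℝ] E5) = w' i := fun i => by
    ext v
    change coordCovec i (L v) = _
    rw [hLa, coordCovec_sum_smul]
  refine ⟨L, hee ▸ hL, by rw [hee]; exact hLs, (hLa _).trans hwX, (hLa _).trans hwZ,
    (hLa _).trans hwY, ?_⟩
  have e3 : (wedge (dx 0) (dx 1) + wedge (dx 2) (dx 3)).compContinuousLinearMap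
      (L : E5 →L[ℝ] E5) = (wedge (dx 0) (dx 1)).compContinuousLinearMap (L : E5 →L[ℝ] E5) +
      (wedge (dx 2) (dx 3)).compContinuousLinearMap (L : E5 →L[ℝ] E5) := rfl
  rw [e3, ← wedge_compContinuousLinearMap, ← wedge_compContinuousLinearMap, dx_comp, dx_comp,
    dx_comp, dx_comp, hc, hc, hc, hc]
  exact hwΩ

/-! ### Pull-back by linear isomorphisms -/

section Pullback

/-- The pull-back of an even form by a linear map. -/
def evenPull (L : E5 →L[ℝ] E5) (ρ : EvenForm E5) : EvenForm E5 :=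
  (ρ.1.compContinuousLinearMap L, ρ.2.1.compContinuousLinearMap L,
    ρ.2.2.compContinuousLinearMap L)

/-- The pull-back of an odd form by a linear map. -/
def oddPull (L : E5 →L[ℝ] E5) (ρ : OddForm E5) : OddForm E5 :=
  (ρ.1.compContinuousLinearMap L, ρ.2.1.compContinuousLinearMap L,
    ρ.2.2.compContinuousLinearMap L)

/-- The pull-back of a pair of even forms. -/
def pairPull (L : E5 →L[ℝ] E5) (ρ : EvenForm E5 × EvenForm E5) : EvenForm E5 × EvenForm E5 :=
  (evenPull L ρ.1, evenPull L ρ.2)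

/-- The transport of an element of `T ⊕ T*` by a linear isomorphism `L`, compatible with the
pull-back of forms by `L`. -/
def genPull (L : E5 ≃L[ℝ] E5) (u : GenVec E5) : GenVec E5 :=
  (L.symm u.1, u.2.comp (L : E5 →L[ℝ] E5))

theorem curryLeft_pullback {n : ℕ} (α : E5 [⋀^Fin (n + 1)]→L[ℝ] ℝ) (L : E5 →L[ℝ] E5) (v : E5) :
    (α.compContinuousLinearMap L).curryLeft v = (α.curryLeft (L v)).compContinuousLinearMap L := by
  ext w
  change α _ = α _
  congr 1
  ext i : 1
  refine Fin.cases rfl (fun i => rfl) i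

theorem pullback_symm_pullback {n : ℕ} (α : E5 [⋀^Fin n]→L[ℝ] ℝ) (L : E5 ≃L[ℝ] E5) :
    (α.compContinuousLinearMap (L.symm : E5 →L[ℝ] E5)).compContinuousLinearMap
      (L : E5 →L[ℝ] E5) = α := by
  ext v
  simp only [ContinuousAlternatingMap.compContinuousLinearMap_apply]
  congr 1
  ext i : 1
  simp

theorem pullback_ne_zero {n : ℕ} {α : E5 [⋀^Fin n]→L[ℝ] ℝ} (hα : α ≠ 0) (L : E5 ≃L[ℝ] E5) :
    α.compContinuousLinearMap (L : E5 →L[ℝ] E5) ≠ 0 := fun h => hα <| by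
  have := pullback_symm_pullback α L.symm
  rw [ContinuousLinearEquiv.symm_symm, h] at this
  exact this.symm

variable {ν : E5 [⋀^Fin 5]→L[ℝ] ℝ}

theorem gvec_pullback (hν : ν ≠ 0) (L : E5 ≃L[ℝ] E5) (γ : E5 [⋀^Fin 4]→L[ℝ] ℝ) :
    gvec (ν.compContinuousLinearMap (L : E5 →L[ℝ] E5))
      (γ.compContinuousLinearMap (L : E5 →L[ℝ] E5)) = L.symm (gvec ν γ) := by
  have h1 : γ = ν.curryLeft (gvec ν γ) := gvec_injective hν (gvec_curryLeft hν _).symm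
  conv_lhs => rw [h1]
  have h2 := curryLeft_pullback ν (L : E5 →L[ℝ] E5) (L.symm (gvec ν γ))
  rw [ContinuousLinearEquiv.coe_coe, L.apply_symm_apply] at h2
  rw [← h2, gvec_curryLeft (pullback_ne_zero hν L)]

theorem sqvec_pullback (hν : ν ≠ 0) (L : E5 ≃L[ℝ] E5) (α β : E5 [⋀^Fin 2]→L[ℝ] ℝ) :
    sqvec (ν.compContinuousLinearMap (L : E5 →L[ℝ] E5))
      (α.compContinuousLinearMap (L : E5 →L[ℝ] E5))
      (β.compContinuousLinearMap (L : E5 →L[ℝ] E5)) = L.symm (sqvec ν α β) := by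
  rw [sqvec, wedge_compContinuousLinearMap]
  exact gvec_pullback hν L _

theorem covec_pullback (α : E5 [⋀^Fin 1]→L[ℝ] ℝ) (L : E5 →L[ℝ] E5) :
    covec (α.compContinuousLinearMap L) = (covec α).comp L := rfl

theorem pullback_zero_apply (c : E5 [⋀^Fin 0]→L[ℝ] ℝ) (L : E5 →L[ℝ] E5) :
    c.compContinuousLinearMap L ![] = c ![] :=
  congrArg c (Subsingleton.elim _ _)

theorem Qpolar_pullback (hν : ν ≠ 0) (L : E5 ≃L[ℝ] E5) (ρ σ : EvenForm E5) :
    Qpolar (ν.compContinuousLinearMap (L : E5 →L[ℝ] E5)) (evenPull L ρ) (evenPull L σ) =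
      genPull L (Qpolar ν ρ σ) := by
  refine Prod.ext ?_ ?_
  · simp only [Qpolar, evenPull, genPull, gvec_pullback hν, sqvec_pullback hν, pullback_zero_apply,
      map_sub, map_add, map_smul]
  · simp only [Qpolar, evenPull, genPull, gvec_pullback hν, curryLeft_pullback, covec_pullback,
      ContinuousLinearEquiv.coe_coe, L.apply_symm_apply]
    ext v
    simp

theorem genInner_genPull (L : E5 ≃L[ℝ] E5) (u v : GenVec E5) :
    genInner (genPull L u) (genPull L v) = genInner u v := by
  simp [genInner, genPull]

theorem quartic_pullback (hν : ν ≠ 0) (L : E5 ≃L[ℝ] E5) (ρ : EvenForm E5 × EvenForm E5) :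
    quartic (ν.compContinuousLinearMap (L : E5 →L[ℝ] E5)) (pairPull L ρ) = quartic ν ρ := by
  simp only [quartic, Qvec_eq (pullback_ne_zero hν L), Qvec_eq hν, pairPull, Qpolar_pullback hν,
    genInner_genPull]

theorem triple_pullback (hν : ν ≠ 0) (L : E5 ≃L[ℝ] E5) (ρ : EvenForm E5 × EvenForm E5) (i : Fin 3) :
    triple (ν.compContinuousLinearMap (L : E5 →L[ℝ] E5)) (pairPull L ρ) i =
      genPull L (triple ν ρ i) := by
  rw [triple_eq (pullback_ne_zero hν L), triple_eq hν]
  fin_cases i <;> exact Qpolar_pullback hν L _ _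

theorem volOf_pullback (hν : ν ≠ 0) (L : E5 ≃L[ℝ] E5) (ρ : EvenForm E5 × EvenForm E5) :
    volOf (ν.compContinuousLinearMap (L : E5 →L[ℝ] E5)) (pairPull L ρ) =
      (volOf ν ρ).compContinuousLinearMap (L : E5 →L[ℝ] E5) := by
  rw [volOf, quartic_pullback hν]
  rfl

theorem expB_pullback (L : E5 →L[ℝ] E5) (B : E5 [⋀^Fin 2]→L[ℝ] ℝ) (ρ : EvenForm E5) :
    expB (B.compContinuousLinearMap L) (evenPull L ρ) = evenPull L (expB B ρ) := by
  refine Prod.ext rfl (Prod.ext ?_ ?_)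
  · simp only [expB, evenPull, pullback_zero_apply]
    rfl
  · simp only [expB, evenPull, pullback_zero_apply, wedge_compContinuousLinearMap]
    rfl

theorem transformAt_pullback (L : E5 →L[ℝ] E5) (A : Matrix (Fin 2) (Fin 2) ℝ)
    (B : E5 [⋀^Fin 2]→L[ℝ] ℝ) (ρ : EvenForm E5 × EvenForm E5) :
    transformAt A (B.compContinuousLinearMap L) (pairPull L ρ) =
      pairPull L (transformAt A B ρ) := by
  simp only [transformAt, pairPull, expB_pullback]
  rfl

theorem mukai_pullback (L : E5 →L[ℝ] E5) (φ : OddForm E5) (ψ : EvenForm E5) :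
    mukai (oddPull L φ) (evenPull L ψ) = (mukai φ ψ).compContinuousLinearMap L := by
  simp only [mukai, oddPull, evenPull, wedge_compContinuousLinearMap]
  rfl

/-- The dual pair is natural: every variation of the pulled back pair is itself a pull-back. -/
theorem isHat_pullback (hν : ν ≠ 0) (L : E5 ≃L[ℝ] E5) {ρ : EvenForm E5 × EvenForm E5}
    {ρ' : OddForm E5 × OddForm E5} (h : IsHat ν ρ ρ') :
    IsHat (ν.compContinuousLinearMap (L : E5 →L[ℝ] E5)) (pairPull L ρ)
      (oddPull L ρ'.1, oddPull L ρ'.2) := by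
  intro σ
  obtain ⟨τ, rfl⟩ : ∃ τ, σ = pairPull L τ := by
    refine ⟨pairPull L.symm σ, ?_⟩
    simp only [pairPull, evenPull, pullback_symm_pullback]
  have h1 := h τ
  have h2 : ∀ t : ℝ, volOf (ν.compContinuousLinearMap (L : E5 →L[ℝ] E5))
      (pairPull L ρ + t • pairPull L τ) =
      ContinuousAlternatingMap.compContinuousLinearMapCLM (L : E5 →L[ℝ] E5)
        (volOf ν (ρ + t • τ)) := fun t =>
    volOf_pullback hν L (ρ + t • τ)
  simp only [h2]
  have h3 : mukai (oddPull L ρ'.1) (pairPull L τ).1 + mukai (oddPull L ρ'.2) (pairPull L τ).2 =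
      ContinuousAlternatingMap.compContinuousLinearMapCLM (L : E5 →L[ℝ] E5)
        (mukai ρ'.1 τ.1 + mukai ρ'.2 τ.2) := by
    rw [pairPull, mukai_pullback, mukai_pullback]
    rfl
  rw [h3]
  exact (ContinuousAlternatingMap.compContinuousLinearMapCLM
    (L : E5 →L[ℝ] E5)).hasFDerivAt.comp_hasDerivAt (0 : ℝ) h1

end Pullback

/-! ### The normal form at a point -/

section NormalForm

/-- The two-form `dx₁ ∧ dx₂ + dx₃ ∧ dx₄` of the normal form. -/
def omega : E5 [⋀^Fin 2]→L[ℝ] ℝ := wedge (dx 0) (dx 1) + wedge (dx 2) (dx 3)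

theorem dx_apply (i j : Fin 5) : (dx i).curryLeft (basisVec j) ![] = if i = j then 1 else 0 :=
  coordCovec_basisVec i j

theorem wedge_self_one (α : E5 [⋀^Fin 1]→L[ℝ] ℝ) : wedge α α = 0 := by
  ext v
  have := congrArg (fun η => η v) (wedge_comm_one_one α α)
  change wedge α α v = -wedge α α v at this
  change wedge α α v = 0
  linarith

theorem wedge_omega_omega : wedge omega omega =
    (2 : ℝ) • wedge (dx 0) (wedge (dx 1) (wedge (dx 2) (dx 3))) := by
  have h1 : ∀ α β : E5 [⋀^Fin 1]→L[ℝ] ℝ, wedge (wedge α β) (wedge α β) = 0 := fun α β => by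
    have e : wedge β (wedge α β) = 0 := by
      rw [← wedge_assoc_one_one_one, wedge_comm_one_one β α, wedge_neg_left,
        wedge_assoc_one_one_one, wedge_self_one]
      exact neg_eq_zero.mpr (wedge_zero_form_right _)
    rw [wedge_assoc_one_one_two, e]
    exact wedge_zero_form_right _
  have h2 : wedge (wedge (dx 2) (dx 3)) (wedge (dx 0) (dx 1)) =
      wedge (wedge (dx 0) (dx 1)) (wedge (dx 2) (dx 3)) := wedge_comm_two_two _ _
  rw [omega, wedge_add_left, wedge_add_right, wedge_add_right, h1, h1, h2, zero_add, add_zero,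
    wedge_assoc_one_one_two]
  exact (two_smul ℝ _).symm

/-- The standard volume element, with `dx₅` as the first factor, as it appears in `dx₅ ∧ ω ∧ ω`. -/
def stdVol : E5 [⋀^Fin 5]→L[ℝ] ℝ :=
  wedge (dx 4) (wedge (dx 0) (wedge (dx 1) (wedge (dx 2) (dx 3))))

theorem wedge_dx_move (i j k l : Fin 5) :
    wedge (dx l) (wedge (dx i) (wedge (dx j) (dx k))) =
      -wedge (dx i) (wedge (dx j) (wedge (dx k) (dx l))) := by
  rw [wedge_comm_one_three]
  have e : wedge (wedge (dx i) (wedge (dx j) (dx k))) (dx l) =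
      wedge (dx i) (wedge (wedge (dx j) (dx k)) (dx l)) := wedge_assoc_one_two_one _ _ _
  rw [e, wedge_assoc_one_one_one]

theorem stdVol_curryLeft_zero : stdVol.curryLeft (basisVec 0) =
    wedge (dx 1) (wedge (dx 2) (wedge (dx 3) (dx 4))) := by
  have e := wedge_dx_move 1 2 3 4
  have h : stdVol.curryLeft (basisVec 0) = -wedge (dx 4) (wedge (dx 1) (wedge (dx 2) (dx 3))) := by
    rw [stdVol, curryLeft_wedge_one, curryLeft_wedge_one (dx 0), curryLeft_wedge_one (dx 1),
      curryLeft_wedge_one (dx 2)]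
    simp only [wedge_zero_left, wedge_one_zero, dx_apply]
    simp
  rw [h, e]
  exact neg_neg _

theorem stdVol_curryLeft_one : stdVol.curryLeft (basisVec 1) =
    -wedge (dx 0) (wedge (dx 2) (wedge (dx 3) (dx 4))) := by
  have e := wedge_dx_move 0 2 3 4
  have h : stdVol.curryLeft (basisVec 1) = wedge (dx 4) (wedge (dx 0) (wedge (dx 2) (dx 3))) := by
    rw [stdVol, curryLeft_wedge_one, curryLeft_wedge_one (dx 0), curryLeft_wedge_one (dx 1),
      curryLeft_wedge_one (dx 2)]
    simp only [wedge_zero_left, wedge_one_zero, dx_apply]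
    simp
    rw [wedge_neg_right]
    exact neg_neg _
  rw [h, e]

/-- A pair of the normalised shape whose two-form is the standard one and whose vector fields are
the expected constant multiples of coordinate vectors is the normal form; the volume form is then
determined. -/
theorem eq_normalForm {ε m : ℝ} (hm : m * m = 8) {ν : E5 [⋀^Fin 5]→L[ℝ] ℝ} (hν : ν ≠ 0)
    {γ₁ γ₂ : E5 [⋀^Fin 4]→L[ℝ] ℝ} (h1 : gvec ν γ₁ = -(ε / m) • basisVec 1)
    (h2 : gvec ν γ₂ = (1 / m) • basisVec 0) (hY : sqvec ν omega omega = (2 / m) • basisVec 4) :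
    (((0, omega, γ₁), (zeroForm 1, 0, γ₂)) : EvenForm E5 × EvenForm E5) = normalForm ε := by
  have hm0 : m ≠ 0 := fun h => by simp [h] at hm
  -- `dx₅ ∧ ω ∧ ω = dx₅(Y) ν` determines the volume form
  have hν' : ν = m • stdVol := by
    have e := wedge_one_four hν (dx 4) (wedge omega omega)
    have e' : dx 4 ![gvec ν (wedge omega omega)] = 2 / m := by
      change coordCovec 4 (sqvec ν omega omega) = _
      rw [hY, map_smul, coordCovec_basisVec]
      simp
    rw [e', wedge_omega_omega, wedge_smul_right] at e
    have e2 : ν = (m / 2) • ((2 / m) • ν) := by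
      rw [smul_smul, div_mul_div_cancel₀ two_ne_zero, div_self hm0, one_smul]
    rw [e2, ← e, smul_smul]
    congr 1
    ring
  have c : ∀ γ : E5 [⋀^Fin 4]→L[ℝ] ℝ, γ = m • stdVol.curryLeft (gvec ν γ) := fun γ => by
    have : γ = ν.curryLeft (gvec ν γ) := gvec_injective hν (gvec_curryLeft hν _).symm
    exact this.trans (congrArg (fun η : E5 [⋀^Fin 5]→L[ℝ] ℝ => η.curryLeft (gvec ν γ)) hν')
  have q1 : γ₁ = ε • wedge (dx 0) (wedge (dx 2) (wedge (dx 3) (dx 4))) := by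
    rw [c γ₁, h1, map_smul, stdVol_curryLeft_one, smul_smul]
    have : m * -(ε / m) = -ε := by field_simp
    rw [this]
    exact neg_smul_neg _ _
  have q2 : γ₂ = wedge (dx 1) (wedge (dx 2) (wedge (dx 3) (dx 4))) := by
    rw [c γ₂, h2, map_smul, stdVol_curryLeft_zero, smul_smul, mul_one_div_cancel hm0]
    exact one_smul _ _
  rw [q1, q2]
  rfl

/-- For such a pair the vectors `v₁, h, v₂` are constant multiples of the vectors of the normal
form, the last two of which are exchanged. -/
theorem triple_of_gvec {ε m : ℝ} {ν : E5 [⋀^Fin 5]→L[ℝ] ℝ} (hν : ν ≠ 0)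
    {γ₁ γ₂ : E5 [⋀^Fin 4]→L[ℝ] ℝ} (h1 : gvec ν γ₁ = -(ε / m) • basisVec 1)
    (h2 : gvec ν γ₂ = (1 / m) • basisVec 0) (hY : sqvec ν omega omega = (2 / m) • basisVec 4) :
    triple ν ((0, omega, γ₁), (zeroForm 1, 0, γ₂)) =
      ![(-4 / m) • normalTriple ε 0, (-2 / m) • normalTriple ε 2, (4 / m) • normalTriple ε 1] := by
  have o0 : covec (omega.curryLeft (basisVec 0)) = coordCovec 1 := by
    have : omega.curryLeft (basisVec 0) = oneForm (coordCovec 1) := by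
      rw [omega, curryLeft_add_apply, curryLeft_wedge_one, curryLeft_wedge_one]
      simp only [wedge_zero_left, wedge_one_zero, dx_apply]
      simp
      rfl
    rw [this]; rfl
  have o1 : covec (omega.curryLeft (basisVec 1)) = -coordCovec 0 := by
    have : omega.curryLeft (basisVec 1) = oneForm (-coordCovec 0) := by
      rw [omega, curryLeft_add_apply, curryLeft_wedge_one, curryLeft_wedge_one]
      simp only [wedge_zero_left, wedge_one_zero, dx_apply]
      simp
      rfl
    rw [this]; rfl
  have z : ∀ x, covec ((0 : E5 [⋀^Fin 2]→L[ℝ] ℝ).curryLeft x) = 0 := fun x => rfl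
  have s : sqvec ν omega 0 = 0 := by
    simpa using sqvec_smul_right (ν := ν) 0 omega 0
  have s' : sqvec ν 0 0 = 0 := by
    simpa using sqvec_smul_right (ν := ν) 0 0 0
  have k : ∀ c : E5, ∀ a : ℝ, covec (omega.curryLeft (a • c)) = a • covec (omega.curryLeft c) :=
    fun c a => by rw [map_smul, covec_smul]
  rw [triple_eq hν]
  funext i
  fin_cases i
  · refine Prod.ext ?_ ?_
    · simp [Qpolar, hY, normalTriple]
      module
    · change (-2 : ℝ) •
        (covec (omega.curryLeft (gvec ν γ₁)) + covec (omega.curryLeft (gvec ν γ₁))) =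
        (-4 / m) • ε • coordCovec 0
      rw [h1, k, o1]
      module
  · refine Prod.ext ?_ ?_
    · simp [Qpolar, h1, s, normalTriple]
      module
    · change (-2 : ℝ) • (covec (omega.curryLeft (gvec ν γ₂)) +
        covec ((0 : E5 [⋀^Fin 2]→L[ℝ] ℝ).curryLeft (gvec ν γ₁))) = (-2 / m) • coordCovec 1
      rw [h2, k, o0, z]
      module
  · refine Prod.ext ?_ ?_
    · simp [Qpolar, h2, s', normalTriple]
      module
    · change (-2 : ℝ) • (covec ((0 : E5 [⋀^Fin 2]→L[ℝ] ℝ).curryLeft (gvec ν γ₂)) +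
        covec ((0 : E5 [⋀^Fin 2]→L[ℝ] ℝ).curryLeft (gvec ν γ₂))) = (4 / m) • (0 : E5 →L[ℝ] ℝ)
      rw [z]
      simp

end NormalForm

/-! ### The local theorem on an open set of the model space -/

theorem apply_basisVec_ne_zero {ν : E5 [⋀^Fin 5]→L[ℝ] ℝ} (hν : ν ≠ 0) : ν basisVec ≠ 0 := fun h =>
  hν <| by
    have := topRatio_smul ν hν
    rw [topRatio, h, div_zero, zero_smul] at this
    exact this.symm

/-- The vector of a smooth four-form relative to a nowhere vanishing smooth volume form is smooth.
-/
theorem contDiffOn_gvec {U : Set E5} {ν : E5 → E5 [⋀^Fin 5]→L[ℝ] ℝ}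
    {γ : E5 → E5 [⋀^Fin 4]→L[ℝ] ℝ} (hν : ContDiffOn ℝ ∞ ν U) (hν0 : ∀ y ∈ U, ν y ≠ 0)
    (hγ : ContDiffOn ℝ ∞ γ U) : ContDiffOn ℝ ∞ (fun y => gvec (ν y) (γ y)) U := by
  have hev : ∀ {μ : E5 → E5 [⋀^Fin 5]→L[ℝ] ℝ}, ContDiffOn ℝ ∞ μ U →
      ContDiffOn ℝ ∞ (fun y => μ y basisVec) U := fun h =>
    contDiffOn_clm_comp (F := E5 [⋀^Fin 5]→L[ℝ] ℝ) (G := ℝ)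
      (ContinuousAlternatingMap.apply ℝ E5 ℝ basisVec) h
  refine ContDiffOn.sum fun i _ => ContDiffOn.smul (ContDiffOn.div
    (hev (contDiffOn_wedge contDiffOn_const hγ)) (hev hν)
    fun y hy => apply_basisVec_ne_zero (hν0 y hy)) contDiffOn_const

theorem extDeriv_sub_smul {n : ℕ} {α β : E5 → E5 [⋀^Fin n]→L[ℝ] ℝ} {x : E5}
    (hα : DifferentiableAt ℝ α x) (hβ : DifferentiableAt ℝ β x) (h1 : extDeriv α x = 0)
    (h2 : extDeriv β x = 0) (a b : ℝ) : extDeriv (fun y => a • α y - b • β y) x = 0 := by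
  have e : (fun y => a • α y - b • β y) = a • α + (-b) • β := by
    funext y
    change _ = a • α y + (-b) • β y
    module
  rw [e, extDeriv_add (hα.const_smul a) (hβ.const_smul (-b)), extDeriv_smul, extDeriv_smul, h1, h2]
  simp

/-- A solution of the variational equations on an open subset of the model space, of the normalised
shape, and with the two-form of maximal rank at `q`, has the normal form in suitable coordinates
near `q`. -/
theorem exists_normalForm_coordinates {U : Set E5} (hU : IsOpen U)
    {ν : E5 → E5 [⋀^Fin 5]→L[ℝ] ℝ} {R : E5 → EvenForm E5 × EvenForm E5}
    {R' : E5 → OddForm E5 × OddForm E5} {B Ω : E5 → E5 [⋀^Fin 2]→L[ℝ] ℝ}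
    {γ₁ γ₂ : E5 → E5 [⋀^Fin 4]→L[ℝ] ℝ} {A : Matrix (Fin 2) (Fin 2) ℝ} (hA : A.det = 1)
    (hν0 : ∀ y ∈ U, ν y ≠ 0) (hvol : ∀ y ∈ U, volOf (ν y) (R y) = ν y)
    (hhat : ∀ y ∈ U, IsHat (ν y) (R y) (R' y))
    (hT : ∀ y ∈ U, transformAt A (B y) (R y) = ((0, Ω y, γ₁ y), (zeroForm 1, 0, γ₂ y)))
    (hν : ContDiffOn ℝ ∞ ν U) (hB : ContDiffOn ℝ ∞ B U) (hΩ : ContDiffOn ℝ ∞ Ω U)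
    (hγ₁ : ContDiffOn ℝ ∞ γ₁ U) (hγ₂ : ContDiffOn ℝ ∞ γ₂ U)
    (h11 : ContDiffOn ℝ ∞ (fun y => (R' y).1.1) U) (h21 : ContDiffOn ℝ ∞ (fun y => (R' y).2.1) U)
    (h13 : ContDiffOn ℝ ∞ (fun y => (R' y).1.2.1) U)
    (h23 : ContDiffOn ℝ ∞ (fun y => (R' y).2.2.1) U)
    (cB : ∀ y ∈ U, extDeriv B y = 0) (cΩ : ∀ y ∈ U, extDeriv Ω y = 0)
    (c11 : ∀ y ∈ U, extDeriv (fun y => (R' y).1.1) y = 0)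
    (c21 : ∀ y ∈ U, extDeriv (fun y => (R' y).2.1) y = 0)
    (c13 : ∀ y ∈ U, extDeriv (fun y => (R' y).1.2.1) y = 0)
    (c23 : ∀ y ∈ U, extDeriv (fun y => (R' y).2.2.1) y = 0)
    {q : E5} (hq : q ∈ U) (hrank : rankTwoForm (Ω q) = 4) {ε : ℝ}
    (hε : ε = -SignType.sign (quartic (ν q) (R q))) :
    ∃ e : OpenPartialHomeomorph E5 E5, q ∈ e.source ∧ e.source ⊆ U ∧ ContDiffOn ℝ ∞ e e.source ∧
      ContDiffOn ℝ ∞ e.symm e.target ∧ ∀ x ∈ e.source, ∃ L : E5 ≃L[ℝ] E5,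
        HasFDerivAt e (L : E5 →L[ℝ] E5) x ∧ HasFDerivAt e.symm (L.symm : E5 →L[ℝ] E5) (e x) ∧
        pairPull L.symm (transformAt A (B x) (R x)) = normalForm ε ∧
        triple ((ν x).compContinuousLinearMap (L.symm : E5 →L[ℝ] E5))
          (pairPull L.symm (transformAt A (B x) (R x))) =
          ![(-4 / √8) • normalTriple ε 0, (-2 / √8) • normalTriple ε 2,
            (4 / √8) • normalTriple ε 1] := by
  have hrel := fun y hy => hat_relations (hν0 y hy) hA (hvol y hy) (hhat y hy) (hT y hy)
  have hq1 : ∀ y ∈ U, quartic (ν y) (R y) = 1 ∨ quartic (ν y) (R y) = -1 := fun y hy =>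
    eq_or_eq_neg_of_abs_eq (hrel y hy).1
  have hεq : ε = -quartic (ν q) (R q) := by
    rw [hε]
    rcases hq1 q hq with h | h <;> simp [h]
  have hεε : ε * ε = 1 := by
    rw [hεq]
    rcases hq1 q hq with h | h <;> simp [h]
  have sX := contDiffOn_gvec hν hν0 hγ₁
  have sZ := contDiffOn_gvec hν hν0 hγ₂
  -- the sign of the quartic is locally constant
  have hcont : ContinuousOn (fun y => Ω y ![gvec (ν y) (γ₁ y), gvec (ν y) (γ₂ y)]) U := by
    have h1 := (contDiffOn_covec (contDiffOn_curryLeft hΩ sX)).clm_apply sZ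
    refine h1.continuousOn.congr fun y _ => ?_
    exact (covec_curryLeft_apply _ _ _).symm
  obtain ⟨V, hV, hVdef⟩ : ∃ V : Set E5, IsOpen V ∧
      V = U ∩ (fun y => Ω y ![gvec (ν y) (γ₁ y), gvec (ν y) (γ₂ y)]) ⁻¹' {t | 0 < ε * t} :=
    ⟨_, hcont.isOpen_inter_preimage hU (isOpen_lt continuous_const (continuous_const.mul
      continuous_id)), rfl⟩
  have hVU : V ⊆ U := hVdef ▸ inter_subset_left
  have hqV : ∀ y ∈ V, quartic (ν y) (R y) = -ε := fun y hy => by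
    have h1 : 0 < ε * Ω y ![gvec (ν y) (γ₁ y), gvec (ν y) (γ₂ y)] := by
      rw [hVdef] at hy
      exact hy.2
    have h2 := (hrel y (hVU hy)).2.1
    have h3 : 0 < ε * -quartic (ν y) (R y) := by
      rw [h2]
      linarith
    rcases hq1 y (hVU hy) with h | h <;> rcases mul_self_eq_one_iff.mp hεε with h' | h' <;>
      rw [h, h'] at h3 <;> rw [h, h'] <;> linarith
  have hqmem : q ∈ V := by
    rw [hVdef]
    refine ⟨hq, ?_⟩
    have h2 := (hrel q hq).2.1
    rw [← neg_eq_iff_eq_neg.mpr hεq] at h2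
    change 0 < ε * Ω q ![gvec (ν q) (γ₁ q), gvec (ν q) (γ₂ q)]
    have : Ω q ![gvec (ν q) (γ₁ q), gvec (ν q) (γ₂ q)] = ε / 8 := by linarith
    rw [this]
    linarith
  -- the three-form of the dual pair, transformed by `A` and `B`; it is closed as `B` is
  let χ : E5 → E5 [⋀^Fin 3]→L[ℝ] ℝ := fun y =>
    A 1 1 • (R' y).1.2.1 - A 1 0 • (R' y).2.2.1 +
      wedge (A 1 1 • (R' y).1.1 - A 1 0 • (R' y).2.1) (B y)
  have hχ : ∀ y ∈ U, ∀ β : E5 [⋀^Fin 2]→L[ℝ] ℝ, wedge (χ y) β =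
      (4 * quartic (ν y) (R y) * β ![gvec (ν y) (γ₁ y), gvec (ν y) (γ₂ y)]) • ν y :=
    fun y hy => (hrel y hy).2.2.2.2
  have sθ : ContDiffOn ℝ ∞ (fun y => A 1 1 • (R' y).1.1 - A 1 0 • (R' y).2.1) U :=
    (h11.const_smul _).sub (h21.const_smul _)
  have s3 : ContDiffOn ℝ ∞ (fun y => A 1 1 • (R' y).1.2.1 - A 1 0 • (R' y).2.2.1) U :=
    (h13.const_smul _).sub (h23.const_smul _)
  have sw := contDiffOn_wedge sθ hB
  have cθ : ∀ y ∈ U, extDeriv (fun y => A 1 1 • (R' y).1.1 - A 1 0 • (R' y).2.1) y = 0 :=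
    fun y hy => extDeriv_sub_smul (diffAt_of_isOpen hU h11 hy) (diffAt_of_isOpen hU h21 hy)
      (c11 y hy) (c21 y hy) _ _
  have cθ' : ∀ y ∈ U, extDeriv (fun y => A 0 0 • (R' y).2.1 - A 0 1 • (R' y).1.1) y = 0 :=
    fun y hy => extDeriv_sub_smul (diffAt_of_isOpen hU h21 hy) (diffAt_of_isOpen hU h11 hy)
      (c21 y hy) (c11 y hy) _ _
  have hqq : ∀ y ∈ U, quartic (ν y) (R y) * quartic (ν y) (R y) = 1 := fun y hy => by
    rcases hq1 y hy with h | h <;> simp [h]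
  have hdata : NormalData ε V Ω χ (fun y => gvec (ν y) (γ₁ y)) (fun y => gvec (ν y) (γ₂ y))
      (fun y => sqvec (ν y) (Ω y) (Ω y)) := by
    refine ⟨hV, hΩ.mono hVU, (s3.add sw).mono hVU, sX.mono hVU, sZ.mono hVU,
      (contDiffOn_gvec hν hν0 (contDiffOn_wedge hΩ hΩ)).mono hVU, fun y hy => cΩ y (hVU hy), ?_, ?_,
      ?_, ?_, ?_, ?_, ?_, ?_, ?_⟩
    · intro y hy
      have hyU := hVU hy
      refine (extDeriv_fun_add (diffAt_of_isOpen hU s3 hyU)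
        (diffAt_of_isOpen hU sw hyU)).trans ?_
      rw [extDeriv_wedge_one_two (diffAt_of_isOpen hU sθ hyU) (diffAt_of_isOpen hU hB hyU)
        (cθ y hyU) (cB y hyU)]
      refine (add_zero _).trans ?_
      exact extDeriv_sub_smul (diffAt_of_isOpen hU h13 hyU) (diffAt_of_isOpen hU h23 hyU)
        (c13 y hyU) (c23 y hyU) _ _
    · intro y hy
      have h1 : (fun y => (Ω y).curryLeft (gvec (ν y) (γ₁ y))) =ᶠ[𝓝 y]
          ((ε / 4) • fun y => A 0 0 • (R' y).2.1 - A 0 1 • (R' y).1.1) := by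
        filter_upwards [hV.mem_nhds hy] with z hz
        rw [Pi.smul_apply, (hrel z (hVU hz)).2.2.2.1, hqV z hz, smul_smul]
        have : ε / 4 * (-4 * -ε) = 1 := by linear_combination hεε
        rw [this]
        exact (one_smul _ _).symm
      rw [h1.extDeriv_eq, extDeriv_smul, cθ' y (hVU hy), smul_zero]
    · intro y hy
      have h1 : (fun y => (Ω y).curryLeft (gvec (ν y) (γ₂ y))) =ᶠ[𝓝 y]
          ((-ε / 4) • fun y => A 1 1 • (R' y).1.1 - A 1 0 • (R' y).2.1) := by
        filter_upwards [hV.mem_nhds hy] with z hz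
        rw [Pi.smul_apply, (hrel z (hVU hz)).2.2.1, hqV z hz, smul_smul]
        have : -ε / 4 * (4 * -ε) = 1 := by linear_combination hεε
        rw [this]
        exact (one_smul _ _).symm
      rw [h1.extDeriv_eq, extDeriv_smul, cθ y (hVU hy), smul_zero]
    · intro y hy
      have h1 := (hrel y (hVU hy)).2.1
      rw [hqV y hy] at h1
      linarith
    · exact fun y hy => curryLeft_sqvec (hν0 y (hVU hy)) _
    · exact fun y hy => chi_curryLeft_left (hχ y (hVU hy))
    · exact fun y hy => chi_curryLeft_right (hχ y (hVU hy))
    · intro y hy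
      rw [← hqV y hy]
      exact chi_curryLeft_sqvec (hν0 y (hVU hy)) (hχ y (hVU hy)) (hqq y (hVU hy))
        (hrel y (hVU hy)).2.1
    · intro y hy z h1 h2
      exact eq_zero_of_contractions (hν0 y (hVU hy)) (hχ y (hVU hy)) (hqq y (hVU hy))
        (hrel y (hVU hy)).2.1 h1 h2
  obtain ⟨e, hqe, heV, hes, hes', hL⟩ := exists_normal_coordinates hεε hdata hqmem
    (reduced_ne_zero hrank _ _ _)
  refine ⟨e, hqe, heV.trans hVU, hes, hes', fun x hx => ?_⟩
  obtain ⟨L, hd, hd', hLX, hLZ, hLY, hLΩ⟩ := hL x hx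
  have hν0x := hν0 x (hVU (heV hx))
  have hν' : (ν x).compContinuousLinearMap (L.symm : E5 →L[ℝ] E5) ≠ 0 :=
      pullback_ne_zero hν0x L.symm
  have hΩ' : (Ω x).compContinuousLinearMap (L.symm : E5 →L[ℝ] E5) = omega := by
    rw [hLΩ]
    exact pullback_symm_pullback omega L.symm
  have hP : pairPull L.symm (transformAt A (B x) (R x)) =
      ((0, omega, (γ₁ x).compContinuousLinearMap (L.symm : E5 →L[ℝ] E5)),
        (zeroForm 1, 0, (γ₂ x).compContinuousLinearMap (L.symm : E5 →L[ℝ] E5))) := by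
    rw [hT x (hVU (heV hx)), ← hΩ']
    rfl
  have g1 := (gvec_pullback hν0x L.symm (γ₁ x)).trans hLX
  have g2 := (gvec_pullback hν0x L.symm (γ₂ x)).trans hLZ
  have g3 := (sqvec_pullback hν0x L.symm (Ω x) (Ω x)).trans hLY
  rw [hΩ'] at g3
  refine ⟨L, hd, hd', ?_, ?_⟩
  · rw [hP]
    exact eq_normalForm (Real.mul_self_sqrt (by norm_num)) hν' g1 g2 g3
  · rw [hP]
    exact triple_of_gvec hν' g1 g2 g3

/-! ### Charts and forms on the manifold -/

section Charts
variable {M : Type*} [TopologicalSpace M] [ChartedSpace E5 M]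

theorem mdifferentiable_of_mem_maximalAtlas {e : OpenPartialHomeomorph M E5}
    [IsManifold (𝓡 5) ∞ M]
    (he : e ∈ IsManifold.maximalAtlas (𝓡 5) ∞ M) : e.MDifferentiable (𝓡 5) (𝓡 5) :=
  ⟨(contMDiffOn_of_mem_maximalAtlas he).mdifferentiableOn (by simp),
    (contMDiffOn_symm_of_mem_maximalAtlas he).mdifferentiableOn (by simp)⟩

/-- The differentials of a chart and its inverse are mutually inverse. -/
theorem exists_chartSymmDeriv_equiv [IsManifold (𝓡 5) ∞ M] {e : OpenPartialHomeomorph M E5}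
    (he : e ∈ IsManifold.maximalAtlas (𝓡 5) ∞ M) {y : E5} (hy : y ∈ e.target) :
    ∃ L : E5 ≃L[ℝ] E5, chartSymmDeriv e y = (L : E5 →L[ℝ] E5) ∧
      chartDeriv e (e.symm y) = (L.symm : E5 →L[ℝ] E5) := by
  have hd := mdifferentiable_of_mem_maximalAtlas he
  have h1 := hd.comp_symm_deriv hy
  have h2 := hd.symm_comp_deriv (e.map_target hy)
  rw [e.right_inv hy] at h2
  exact ⟨ContinuousLinearEquiv.equivOfInverse (chartSymmDeriv e y) (chartDeriv e (e.symm y))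
    (fun v => congrArg (fun L : E5 →L[ℝ] E5 => L v) h1)
    (fun v => congrArg (fun L : E5 →L[ℝ] E5 => L v) h2), rfl, rfl⟩

/-- The composition of a chart with a local diffeomorphism of the model space is a chart. -/
theorem trans_mem_maximalAtlas {e : OpenPartialHomeomorph M E5}
    (he : e ∈ IsManifold.maximalAtlas (𝓡 5) ∞ M) {Φ : OpenPartialHomeomorph E5 E5}
    (h1 : ContDiffOn ℝ ∞ Φ Φ.source) (h2 : ContDiffOn ℝ ∞ Φ.symm Φ.target) :
    e.trans Φ ∈ IsManifold.maximalAtlas (𝓡 5) ∞ M := by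
  have hΦ : Φ ∈ contDiffGroupoid ∞ (𝓡 5) := by
    rw [contDiffGroupoid, mem_groupoid_of_pregroupoid]
    simp only [contDiffPregroupoid]
    constructor
    · simpa using h1
    · simpa using h2
  intro e' he'
  obtain ⟨l, r⟩ := mem_maximalAtlas_iff.mp he e' he'
  refine ⟨?_, ?_⟩
  · rw [OpenPartialHomeomorph.trans_symm_eq_symm_trans_symm, OpenPartialHomeomorph.trans_assoc]
    exact (contDiffGroupoid ∞ (𝓡 5)).trans ((contDiffGroupoid ∞ (𝓡 5)).symm hΦ) l
  · rw [← OpenPartialHomeomorph.trans_assoc]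
    exact (contDiffGroupoid ∞ (𝓡 5)).trans r hΦ

/-- The chain rule for the inverse of a chart composed with a local diffeomorphism. -/
theorem chartSymmDeriv_trans [IsManifold (𝓡 5) ∞ M] {e : OpenPartialHomeomorph M E5}
    (he : e ∈ IsManifold.maximalAtlas (𝓡 5) ∞ M) {Φ : OpenPartialHomeomorph E5 E5} {y : E5}
    (hy : Φ.symm y ∈ e.target) {K : E5 →L[ℝ] E5} (hK : HasFDerivAt Φ.symm K y) :
    chartSymmDeriv (e.trans Φ) y = (chartSymmDeriv e (Φ.symm y)).comp K := by
  have h1 := ((mdifferentiable_of_mem_maximalAtlas he).mdifferentiableAt_symm hy).hasMFDerivAt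
  have h2 : HasMFDerivAt (𝓡 5) (𝓡 5) Φ.symm y K := hasMFDerivAt_iff_hasFDerivAt.mpr hK
  exact (h1.comp y h2).mfderiv

end Charts

section Forms
variable {M : Type*} [TopologicalSpace M] [ChartedSpace E5 M]

theorem SmoothForm.smul_add_smul {k : ℕ} {α β : M → E5 [⋀^Fin k]→L[ℝ] ℝ} (hα : SmoothForm α)
    (hβ : SmoothForm β) (a b : ℝ) : SmoothForm fun p => a • α p + b • β p := fun e he =>
  ((hα e he).const_smul a).add ((hβ e he).const_smul b)

theorem ClosedForm.smul_add_smul {k : ℕ} {α β : M → E5 [⋀^Fin k]→L[ℝ] ℝ} (hα : SmoothForm α)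
    (hβ : SmoothForm β) (hα' : ClosedForm α) (hβ' : ClosedForm β) (a b : ℝ) :
    ClosedForm fun p => a • α p + b • β p := fun e he y hy => by
  have h1 := diffAt_of_isOpen e.open_target (hα e he) hy
  have h2 := diffAt_of_isOpen e.open_target (hβ e he) hy
  have h3 := extDeriv_sub_smul h1 h2 (hα' e he y hy) (hβ' e he y hy) a (-b)
  refine Eq.trans (congrArg (fun f => extDeriv f y) ?_) h3
  funext z
  change a • formRep e α z + b • formRep e β z = a • formRep e α z - (-b) • formRep e β z
  module

/-- A closed form of degree zero is locally constant. -/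
theorem isLocallyConstant_of_closedForm [IsManifold (𝓡 5) ∞ M] {α : M → E5 [⋀^Fin 0]→L[ℝ] ℝ}
    (h1 : SmoothForm α) (h2 : ClosedForm α) : IsLocallyConstant fun p => α p ![] := by
  rw [IsLocallyConstant.iff_exists_open]
  intro p
  set e := chartAt E5 p with he
  have hea : e ∈ IsManifold.maximalAtlas (𝓡 5) ∞ M := IsManifold.chart_mem_maximalAtlas p
  let f : E5 → ℝ := fun y => formRep e α y ![]
  have hform : ∀ y, formRep e α y = ContinuousAlternatingMap.constOfIsEmpty ℝ E5 (Fin 0) (f y) := by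
    intro y
    ext v
    rw [Subsingleton.elim v ![]]
    rfl
  have hf : ContDiffOn ℝ ∞ f e.target := contDiffOn_clm_comp (F := E5 [⋀^Fin 0]→L[ℝ] ℝ) (G := ℝ)
      (ContinuousAlternatingMap.apply ℝ E5 ℝ ![]) (h1 e hea)
  have hd : e.target.EqOn (fderiv ℝ f) 0 := fun y hy => by
    have h3 := h2 e hea y hy
    rw [funext hform, extDeriv_constOfIsEmpty] at h3
    exact (ContinuousAlternatingMap.ofSubsingleton ℝ E5 ℝ (0 : Fin 1)).injective (h3.trans rfl)
  have ho := e.open_target.isOpen_inter_preimage_of_fderiv_eq_zero (hf.differentiableOn (by simp))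
    hd {α p ![]}
  have hfp : ∀ x ∈ e.source, f (e x) = α x ![] := fun x hx => by
    change α (e.symm (e x)) _ = _
    rw [e.left_inv hx]
    exact congrArg _ (Subsingleton.elim _ _)
  refine ⟨_, e.isOpen_inter_preimage ho, ⟨mem_chart_source E5 p, e.map_source
      (mem_chart_source E5 p),
    hfp p (mem_chart_source E5 p)⟩, fun x hx => ?_⟩
  rw [← hfp x hx.1]
  exact hx.2.2

/-- A solution is brought to the normalised shape by a matrix that takes the constants of degree
zero to `(0, 1)`, and the two-form which removes the term of degree two of the second component. -/
theorem exists_normalizes [IsManifold (𝓡 5) ∞ M] [ConnectedSpace M]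
    {ρ : M → EvenForm E5 × EvenForm E5} (s1 : SmoothEven fun p => (ρ p).1)
    (s2 : SmoothEven fun p => (ρ p).2) (c1 : ClosedEven fun p => (ρ p).1)
    (c2 : ClosedEven fun p => (ρ p).2) (h0 : ∃ p, ((ρ p).1.1, (ρ p).2.1) ≠ 0) :
    ∃ A B, Normalizes A B ρ := by
  obtain ⟨p₀, hp₀⟩ := h0
  set a := (ρ p₀).1.1 ![] with ha
  set b := (ρ p₀).2.1 ![] with hb
  have hconst : ∀ p, (ρ p).1.1 ![] = a ∧ (ρ p).2.1 ![] = b := fun p =>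
    ⟨(isLocallyConstant_of_closedForm s1.1 c1.1).apply_eq_of_preconnectedSpace p p₀,
      (isLocallyConstant_of_closedForm s2.1 c2.1).apply_eq_of_preconnectedSpace p p₀⟩
  have hne : a ^ 2 + b ^ 2 ≠ 0 := fun h => hp₀ <| by
    have ha0 : a = 0 := by nlinarith [sq_nonneg a, sq_nonneg b]
    have hb0 : b = 0 := by nlinarith [sq_nonneg a, sq_nonneg b]
    refine Prod.ext ?_ ?_
    · ext v
      rw [Subsingleton.elim v ![]]
      exact ha0
    · ext v
      rw [Subsingleton.elim v ![]]
      exact hb0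
  have e1 : b * a + -a * b = 0 := by ring
  have e2 : a / (a ^ 2 + b ^ 2) * a + b / (a ^ 2 + b ^ 2) * b = 1 := by field_simp
  refine ⟨!![b, -a; a / (a ^ 2 + b ^ 2), b / (a ^ 2 + b ^ 2)],
    fun p => (-(a / (a ^ 2 + b ^ 2))) • (ρ p).1.2.1 + (-(b / (a ^ 2 + b ^ 2))) • (ρ p).2.2.1,
    ?_, s1.2.1.smul_add_smul s2.2.1 _ _,
    ClosedForm.smul_add_smul s1.2.1 s2.2.1 c1.2.1 c2.2.1 _ _, ?_, ?_, ?_⟩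
  · rw [Matrix.det_fin_two_of]
    field_simp
    ring
  · intro p
    ext v
    rw [Subsingleton.elim v ![]]
    change b * (ρ p).1.1 ![] + -a * (ρ p).2.1 ![] = 0
    rw [(hconst p).1, (hconst p).2, e1]
  · intro p
    ext v
    rw [Subsingleton.elim v ![]]
    change a / (a ^ 2 + b ^ 2) * (ρ p).1.1 ![] + b / (a ^ 2 + b ^ 2) * (ρ p).2.1 ![] = 1
    rw [(hconst p).1, (hconst p).2, e2]
  · intro p
    have : ∀ (s t : ℝ) (β β' : E5 [⋀^Fin 2]→L[ℝ] ℝ), s * a + t * b = 1 →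
        s • (β + a • ((-s) • β + (-t) • β')) + t • (β' + b • ((-s) • β + (-t) • β')) = 0 := by
      intro s t β β' h
      have h1 : s • (β + a • ((-s) • β + (-t) • β')) + t • (β' + b • ((-s) • β + (-t) • β')) =
          (1 - (s * a + t * b)) • (s • β + t • β') := by module
      rw [h1, h, sub_self, zero_smul]
    refine Eq.trans ?_ (this _ _ (ρ p).1.2.1 (ρ p).2.2.1 e2)
    change (a / (a ^ 2 + b ^ 2)) • ((ρ p).1.2.1 + (ρ p).1.1 ![] • _) +
      (b / (a ^ 2 + b ^ 2)) • ((ρ p).2.2.1 + (ρ p).2.1 ![] • _) = _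
    rw [(hconst p).1, (hconst p).2]

end Forms

theorem rankTwoForm_pullback (L : E5 ≃L[ℝ] E5) (α : E5 [⋀^Fin 2]→L[ℝ] ℝ) :
    rankTwoForm (α.compContinuousLinearMap (L : E5 →L[ℝ] E5)) = rankTwoForm α := by
  let P : (E5 [⋀^Fin 1]→L[ℝ] ℝ) →ₗ[ℝ] (E5 [⋀^Fin 1]→L[ℝ] ℝ) :=
    (ContinuousAlternatingMap.compContinuousLinearMapCLM (L : E5 →L[ℝ] E5) :
      (E5 [⋀^Fin 1]→L[ℝ] ℝ) →L[ℝ] (E5 [⋀^Fin 1]→L[ℝ] ℝ))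
  have hP : Function.Injective P := fun η η' h => by
    have h1 : η.compContinuousLinearMap (L : E5 →L[ℝ] E5) =
      η'.compContinuousLinearMap (L : E5 →L[ℝ] E5) := h
    have h2 := pullback_symm_pullback η L.symm
    have h3 := pullback_symm_pullback η' L.symm
    rw [ContinuousLinearEquiv.symm_symm] at h2 h3
    rw [← h2, ← h3, h1]
  have hr : LinearMap.range ((α.compContinuousLinearMap (L : E5 →L[ℝ] E5)).curryLeft :
      E5 →ₗ[ℝ] E5 [⋀^Fin 1]→L[ℝ] ℝ) =
      (LinearMap.range (α.curryLeft : E5 →ₗ[ℝ] E5 [⋀^Fin 1]→L[ℝ] ℝ)).map P := by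
    ext η
    constructor
    · rintro ⟨v, rfl⟩
      exact ⟨_, ⟨L v, rfl⟩, (curryLeft_pullback α (L : E5 →L[ℝ] E5) v).symm⟩
    · rintro ⟨_, ⟨v, rfl⟩, rfl⟩
      refine ⟨L.symm v, (curryLeft_pullback α (L : E5 →L[ℝ] E5) (L.symm v)).trans ?_⟩
      rw [ContinuousLinearEquiv.coe_coe, L.apply_symm_apply]
      rfl
  rw [rankTwoForm, hr]
  exact (LinearEquiv.finrank_eq (Submodule.equivMapOfInjective P hP _)).symm

/-- The Courant bracket of constant sections vanishes. -/
theorem courant_eq_zero {u v : E5 → GenVec E5} {U : Set E5} (hU : IsOpen U) {a b : GenVec E5}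
    (hu : ∀ y ∈ U, u y = a) (hv : ∀ y ∈ U, v y = b) {y : E5} (hy : y ∈ U) : courant u v y = 0 := by
  have key : ∀ {F : Type} [NormedAddCommGroup F] [NormedSpace ℝ F] {f : E5 → F} {c : F},
      (∀ z ∈ U, f z = c) → fderiv ℝ f y = 0 := by
    intro F _ _ f c h
    have h1 : f =ᶠ[𝓝 y] fun _ => c := by
      filter_upwards [hU.mem_nhds hy] with z hz using h z hz
    rw [h1.fderiv_eq]
    simp
  have u1 : fderiv ℝ (fun y => (u y).1) y = 0 := key fun z hz => by rw [hu z hz]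
  have u2 : fderiv ℝ (fun y => (u y).2) y = 0 := key fun z hz => by rw [hu z hz]
  have v1 : fderiv ℝ (fun y => (v y).1) y = 0 := key fun z hz => by rw [hv z hz]
  have v2 : fderiv ℝ (fun y => (v y).2) y = 0 := key fun z hz => by rw [hv z hz]
  have w : fderiv ℝ (fun y => (v y).2 (u y).1 - (u y).2 (v y).1) y = 0 := key fun z hz => by
    rw [hu z hz, hv z hz]
  simp [courant, lieDeriv, VectorField.lieBracket, u1, u2, v1, v2, w]

/-! ### Solutions on the manifold -/

/-- The components of the transform of a smooth pair by a matrix and a smooth two-form are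
smooth. -/
theorem contDiffOn_transformAt {U : Set E5} {R : E5 → EvenForm E5 × EvenForm E5}
    {B : E5 → E5 [⋀^Fin 2]→L[ℝ] ℝ} (A : Matrix (Fin 2) (Fin 2) ℝ) (hB : ContDiffOn ℝ ∞ B U)
    (h10 : ContDiffOn ℝ ∞ (fun y => (R y).1.1) U) (h12 : ContDiffOn ℝ ∞ (fun y => (R y).1.2.1) U)
    (h14 : ContDiffOn ℝ ∞ (fun y => (R y).1.2.2) U) (h20 : ContDiffOn ℝ ∞ (fun y => (R y).2.1) U)
    (h22 : ContDiffOn ℝ ∞ (fun y => (R y).2.2.1) U)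
    (h24 : ContDiffOn ℝ ∞ (fun y => (R y).2.2.2) U) :
    ContDiffOn ℝ ∞ (fun y => (transformAt A (B y) (R y)).1.2.1) U ∧
    ContDiffOn ℝ ∞ (fun y => (transformAt A (B y) (R y)).1.2.2) U ∧
    ContDiffOn ℝ ∞ (fun y => (transformAt A (B y) (R y)).2.2.2) U := by
  have hev : ∀ {μ : E5 → E5 [⋀^Fin 0]→L[ℝ] ℝ}, ContDiffOn ℝ ∞ μ U →
      ContDiffOn ℝ ∞ (fun y => μ y ![]) U := fun h =>
    contDiffOn_clm_comp (F := E5 [⋀^Fin 0]→L[ℝ] ℝ) (G := ℝ)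
      (ContinuousAlternatingMap.apply ℝ E5 ℝ ![]) h
  have two : ∀ {a : E5 → E5 [⋀^Fin 0]→L[ℝ] ℝ} {β : E5 → E5 [⋀^Fin 2]→L[ℝ] ℝ},
      ContDiffOn ℝ ∞ a U → ContDiffOn ℝ ∞ β U → ContDiffOn ℝ ∞ (fun y => β y + a y ![] • B y) U :=
    fun ha hβ => hβ.add ((hev ha).smul hB)
  have four : ∀ {a : E5 → E5 [⋀^Fin 0]→L[ℝ] ℝ} {β : E5 → E5 [⋀^Fin 2]→L[ℝ] ℝ}
      {γ : E5 → E5 [⋀^Fin 4]→L[ℝ] ℝ}, ContDiffOn ℝ ∞ a U → ContDiffOn ℝ ∞ β U →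
      ContDiffOn ℝ ∞ γ U →
      ContDiffOn ℝ ∞ (fun y => γ y + wedge (B y) (β y) + (a y ![] / 2) • wedge (B y) (B y)) U :=
    fun ha hβ hγ => (hγ.add (contDiffOn_wedge hB hβ)).add
      (((hev ha).div_const 2).smul (contDiffOn_wedge hB hB))
  exact ⟨((two h10 h12).const_smul (A 0 0)).add ((two h20 h22).const_smul (A 0 1)),
    ((four h10 h12 h14).const_smul (A 0 0)).add ((four h20 h22 h24).const_smul (A 0 1)),
    ((four h10 h12 h14).const_smul (A 1 0)).add ((four h20 h22 h24).const_smul (A 1 1))⟩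

section Main
variable {M : Type*} [TopologicalSpace M] [ChartedSpace E5 M] [IsManifold (𝓡 5) ∞ M]

/-- Near a point where the two-form has maximal rank there is a chart in which the transformed
solution is the normal form, and in which the vectors `v₁, h, v₂` are constant. -/
theorem exists_normalForm_chart {ρ : M → EvenForm E5 × EvenForm E5}
    {φ : M → E5 [⋀^Fin 5]→L[ℝ] ℝ} (hρ : IsSolution ρ φ) {A : Matrix (Fin 2) (Fin 2) ℝ}
    {B : M → E5 [⋀^Fin 2]→L[ℝ] ℝ} (hN : Normalizes A B ρ) {p : M}
    (hrank : rankTwoForm (transform A B ρ p).1.2.1 = 4) {ε : ℝ}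
    (hε : ε = -SignType.sign (quartic (φ p) (ρ p))) :
    ∃ e ∈ IsManifold.maximalAtlas (𝓡 5) ∞ M, p ∈ e.source ∧ ∀ y ∈ e.target,
      (evenRep e (fun q => (transform A B ρ q).1) y = (normalForm ε).1 ∧
        evenRep e (fun q => (transform A B ρ q).2) y = (normalForm ε).2) ∧
      ∀ i, genRep e (fun q => triple (φ q) (transform A B ρ q) i) y =
        (![(-4 / √8) • normalTriple ε 0, (-2 / √8) • normalTriple ε 2,
          (4 / √8) • normalTriple ε 1] : Fin 3 → GenVec E5) i := by
  obtain ⟨ρ', hhat, so1, so2, co1, co2⟩ := hρ.closed_hat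
  set c := chartAt E5 p with hc
  have hca : c ∈ IsManifold.maximalAtlas (𝓡 5) ∞ M := IsManifold.chart_mem_maximalAtlas p
  have hps : p ∈ c.source := mem_chart_source E5 p
  -- the solution and its transform in a chart at `p`
  let R : E5 → EvenForm E5 × EvenForm E5 := fun y =>
    pairPull (chartSymmDeriv c y) (ρ (c.symm y))
  let P : E5 → EvenForm E5 × EvenForm E5 := fun y => transformAt A (formRep c B y) (R y)
  have hP : ∀ y, P y = pairPull (chartSymmDeriv c y) (transform A B ρ (c.symm y)) := fun y =>
    transformAt_pullback (chartSymmDeriv c y) A (B (c.symm y)) (ρ (c.symm y))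
  have hP11 : ∀ y, (P y).1.1 = 0 := fun y => by
    rw [hP]
    change (transform A B ρ (c.symm y)).1.1.compContinuousLinearMap _ = 0
    rw [hN.deg_zero_fst]
    rfl
  have hT : ∀ y, P y = ((0, (P y).1.2.1, (P y).1.2.2), (zeroForm 1, 0, (P y).2.2.2)) := fun y => by
    have h2 : (P y).2.1 = zeroForm 1 := by
      rw [hP]
      change (transform A B ρ (c.symm y)).2.1.compContinuousLinearMap _ = _
      rw [hN.deg_zero_snd]
      rfl
    have h3 : (P y).2.2.1 = 0 := by
      rw [hP]
      change (transform A B ρ (c.symm y)).2.2.1.compContinuousLinearMap _ = _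
      rw [hN.deg_two_snd]
      rfl
    exact Prod.ext (Prod.ext (hP11 y) rfl) (Prod.ext h2 (Prod.ext h3 rfl))
  have sB := hN.smooth c hca
  obtain ⟨sΩ, sγ₁, sγ₂⟩ := contDiffOn_transformAt (R := R) A sB (hρ.smooth_fst.1 c hca)
    (hρ.smooth_fst.2.1 c hca) (hρ.smooth_fst.2.2 c hca) (hρ.smooth_snd.1 c hca)
    (hρ.smooth_snd.2.1 c hca) (hρ.smooth_snd.2.2 c hca)
  -- `B` does not contribute to the two-form, as the first component has no term of degree zero
  have cΩ : ∀ y ∈ c.target, extDeriv (fun y => (P y).1.2.1) y = 0 := fun y hy => by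
    have h3 := extDeriv_sub_smul
      (diffAt_of_isOpen c.open_target (hρ.smooth_fst.2.1 c hca) hy)
      (diffAt_of_isOpen c.open_target (hρ.smooth_snd.2.1 c hca) hy)
      (hρ.closed_fst.2.1 c hca y hy) (hρ.closed_snd.2.1 c hca y hy) (A 0 0) (-A 0 1)
    refine Eq.trans (congrArg (fun f => extDeriv f y) ?_) h3
    funext z
    have h4 : A 0 0 * (R z).1.1 ![] + A 0 1 * (R z).2.1 ![] = 0 :=
      congrArg (fun η : E5 [⋀^Fin 0]→L[ℝ] ℝ => η ![]) (hP11 z)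
    change A 0 0 • ((R z).1.2.1 + (R z).1.1 ![] • formRep c B z) +
      A 0 1 • ((R z).2.2.1 + (R z).2.1 ![] • formRep c B z) =
      A 0 0 • (R z).1.2.1 - (-A 0 1) • (R z).2.2.1
    have h5 : A 0 0 • ((R z).1.2.1 + (R z).1.1 ![] • formRep c B z) +
      A 0 1 • ((R z).2.2.1 + (R z).2.1 ![] • formRep c B z) =
      A 0 0 • (R z).1.2.1 - (-A 0 1) • (R z).2.2.1 +
        (A 0 0 * (R z).1.1 ![] + A 0 1 * (R z).2.1 ![]) • formRep c B z := by module
    rw [h5, h4, zero_smul, add_zero]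
  have hL : ∀ y ∈ c.target, ∃ L : E5 ≃L[ℝ] E5, chartSymmDeriv c y = (L : E5 →L[ℝ] E5) :=
    fun y hy => (exists_chartSymmDeriv_equiv hca hy).imp fun L hL => hL.1
  have hν0 : ∀ y ∈ c.target, formRep c φ y ≠ 0 := fun y hy => by
    obtain ⟨L, hL⟩ := hL y hy
    rw [formRep, hL]
    exact pullback_ne_zero (hρ.vol_ne_zero _) L
  have hcp : c p ∈ c.target := c.map_source hps
  have hcs : c.symm (c p) = p := c.left_inv hps
  obtain ⟨Φ, hpΦ, hΦc, hΦs, hΦs', hΦ⟩ := exists_normalForm_coordinates c.open_target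
    (ν := formRep c φ) (R := R) (B := formRep c B)
    (R' := fun y => (oddPull (chartSymmDeriv c y) (ρ' (c.symm y)).1,
      oddPull (chartSymmDeriv c y) (ρ' (c.symm y)).2))
    (Ω := fun y => (P y).1.2.1) (γ₁ := fun y => (P y).1.2.2) (γ₂ := fun y => (P y).2.2.2)
    hN.det_eq_one hν0
    (fun y hy => by
      obtain ⟨L, hL⟩ := hL y hy
      simp only [R, formRep, hL]
      rw [volOf_pullback (hρ.vol_ne_zero _), hρ.volOf_eq])
    (fun y hy => by
      obtain ⟨L, hL⟩ := hL y hy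
      simp only [R, formRep, hL]
      exact isHat_pullback (hρ.vol_ne_zero _) L (hhat _))
    (fun y _ => hT y) (hρ.smooth_vol c hca) sB sΩ sγ₁ sγ₂ (so1.1 c hca) (so2.1 c hca)
    (so1.2.1 c hca) (so2.2.1 c hca) (hN.closed c hca) cΩ (co1.1 c hca) (co2.1 c hca)
    (co1.2.1 c hca) (co2.2.1 c hca) hcp (ε := ε)
    (by
      obtain ⟨L, hL⟩ := hL _ hcp
      rw [hP, hL, hcs]
      exact (rankTwoForm_pullback L _).trans hrank)
    (by
      obtain ⟨L, hL⟩ := hL _ hcp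
      simp only [R, formRep, hL]
      rw [quartic_pullback (hρ.vol_ne_zero _), hcs]
      exact hε)
  have hea := trans_mem_maximalAtlas hca hΦs hΦs'
  refine ⟨c.trans Φ, hea, ?_, fun y hy => ?_⟩
  · rw [OpenPartialHomeomorph.trans_source]
    exact ⟨hps, hpΦ⟩
  have hy' : y ∈ Φ.target := by
    rw [OpenPartialHomeomorph.trans_target] at hy
    exact hy.1
  have hx : Φ.symm y ∈ Φ.source := Φ.map_target hy'
  obtain ⟨K, -, hK, hform, htriple⟩ := hΦ _ hx
  rw [Φ.right_inv hy'] at hK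
  have hder := chartSymmDeriv_trans hca (hΦc hx) hK
  have hpull : pairPull (chartSymmDeriv (c.trans Φ) y) (transform A B ρ ((c.trans Φ).symm y)) =
      pairPull K.symm (P (Φ.symm y)) := by
    rw [hder, hP]
    rfl
  refine ⟨?_, fun i => ?_⟩
  · have := hpull.trans hform
    exact ⟨congrArg Prod.fst this, congrArg Prod.snd this⟩
  · obtain ⟨L, hL, hL'⟩ := exists_chartSymmDeriv_equiv hea hy
    have h1 : genRep (c.trans Φ) (fun q => triple (φ q) (transform A B ρ q) i) y =
        genPull L (triple (φ ((c.trans Φ).symm y)) (transform A B ρ ((c.trans Φ).symm y)) i) := by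
      rw [genRep, hL, hL']
      rfl
    have h2 : (φ ((c.trans Φ).symm y)).compContinuousLinearMap (L : E5 →L[ℝ] E5) =
        (formRep c φ (Φ.symm y)).compContinuousLinearMap (K.symm : E5 →L[ℝ] E5) := by
      rw [← hL, hder]
      rfl
    rw [h1, ← triple_pullback (hρ.vol_ne_zero _), h2, ← hL, hpull]
    exact congrFun htriple i

/-- Multiplying three vectors by nonzero scalars and exchanging two of them does not change their
span. -/
theorem span_range_smul_swap {V : Type*} [AddCommGroup V] [Module ℝ V] {a b c : ℝ} (ha : a ≠ 0)
    (hb : b ≠ 0) (hc : c ≠ 0) (w w' : Fin 3 → V) (h0 : w' 0 = a • w 0) (h1 : w' 1 = b • w 2)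
    (h2 : w' 2 = c • w 1) :
    Submodule.span ℝ (range w') = Submodule.span ℝ (range w) := by
  apply le_antisymm
  · rw [Submodule.span_le]
    rintro _ ⟨i, rfl⟩
    have hw : ∀ j, w j ∈ Submodule.span ℝ (range w) := fun j => Submodule.subset_span ⟨j, rfl⟩
    fin_cases i
    · exact h0 ▸ Submodule.smul_mem _ a (hw 0)
    · exact h1 ▸ Submodule.smul_mem _ b (hw 2)
    · exact h2 ▸ Submodule.smul_mem _ c (hw 1)
  · rw [Submodule.span_le]
    rintro _ ⟨i, rfl⟩
    have hw : ∀ j, w' j ∈ Submodule.span ℝ (range w') := fun j => Submodule.subset_span ⟨j, rfl⟩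
    fin_cases i
    · exact (inv_smul_smul₀ ha (w 0)) ▸ Submodule.smul_mem _ a⁻¹ (h0 ▸ hw 0)
    · exact (inv_smul_smul₀ hc (w 1)) ▸ Submodule.smul_mem _ c⁻¹ (h2 ▸ hw 2)
    · exact (inv_smul_smul₀ hb (w 2)) ▸ Submodule.smul_mem _ b⁻¹ (h1 ▸ hw 1)

end Main

end GenGeom

end

open GenGeom in
theorem mainTheorem4 {M : Type*} [TopologicalSpace M] [ChartedSpace E5 M]
    [IsManifold (𝓡 5) ∞ M] [ConnectedSpace M]
    (ρ : M → EvenForm E5 × EvenForm E5) (φ : M → E5 [⋀^Fin 5]→L[ℝ] ℝ)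
    (hρ : IsSolution ρ φ)
    (h0 : ∃ p, ((ρ p).1.1, (ρ p).2.1) ≠ 0) :
    (∃ A B, Normalizes A B ρ) ∧
    ∀ A B, Normalizes A B ρ →
      ∀ p : M, rankTwoForm (transform A B ρ p).1.2.1 = 4 →
        ∀ ε : ℝ, ε = -SignType.sign (quartic (φ p) (ρ p)) →
          ∃ e ∈ IsManifold.maximalAtlas (𝓡 5) ∞ M, p ∈ e.source ∧
            (∀ y ∈ e.target,
              evenRep e (fun q => (transform A B ρ q).1) y = (normalForm ε).1 ∧
              evenRep e (fun q => (transform A B ρ q).2) y = (normalForm ε).2) ∧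
            Submodule.span ℝ (Set.range fun i : Fin 3 => e.target.domRestrict
                (genRep e fun q => triple (φ q) (transform A B ρ q) i)) =
              Submodule.span ℝ (Set.range fun i : Fin 3 => e.target.domRestrict
                fun _ => normalTriple ε i) ∧
            ∀ i j : Fin 3, ∀ y ∈ e.target,
              courant (genRep e fun q => triple (φ q) (transform A B ρ q) i)
                (genRep e fun q => triple (φ q) (transform A B ρ q) j) y = 0 := by
  refine ⟨exists_normalizes hρ.smooth_fst hρ.smooth_snd hρ.closed_fst hρ.closed_snd h0, ?_⟩
  intro A B hN p hrank ε hε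
  obtain ⟨e, hea, hpe, he⟩ := exists_normalForm_chart hρ hN hrank hε
  -- in this chart the three sections are constant
  have h8 : √8 ≠ 0 := by positivity
  refine ⟨e, hea, hpe, fun y hy => (he y hy).1, ?_, fun i j y hy => ?_⟩
  · refine span_range_smul_swap (a := -4 / √8) (b := -2 / √8) (c := 4 / √8)
      (div_ne_zero (by norm_num) h8) (div_ne_zero (by norm_num) h8) (div_ne_zero (by norm_num) h8)
      _ _ ?_ ?_ ?_ <;> exact funext fun y => (he y.1 y.2).2 _
  · exact courant_eq_zero e.open_target (fun z hz => (he z hz).2 i) (fun z hz => (he z hz).2 j) hy
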